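/- **Setting.** Let $n\ge 2$, let $\Omega\subset\mathbb R^n$ be open, and let $\mathcal M(\Omega;\mathbb R^n)$ and $\mathcal M(\Omega)$ be the spaces of finite $\mathbb R^n$-valued and finite signed Radon measures on $\Omega$. A measure $F\in\mathcal M(\Omega;\mathbb R^n)$ belongs to $\mathcal{DM}^{ext}(\Omega)$ if $\sup\{\int_\Omega\nabla\varphi\cdot dF:\varphi\in C^1_c(\Omega),\ |\varphi|\le 1\}<\infty$; then $\operatorname{div}F\in\mathcal M(\Omega)$ denotes the measure with $\int_\Omega\varphi\,d(\operatorname{div}F)=-\int_\Omega\nabla\varphi\cdot dF$ for all $\varphi\in C^1_c(\Omega)$. Elements of $W^{1,\infty}(\Omega)$ are identified with their continuous representatives. For $\phi\in W^{1,\infty}(\Omega)$, and also for $\phi=d$ below, $\overline{\nabla\phi\cdot F}\in\mathcal M(\Omega)$ denotes the measure with $$\int_\Omega\psi\,d\overline{\nabla\phi\cdot F}=\lim_{\delta\to0}\int_\Omega\psi\,\nabla(\phi*\rho_\delta)\cdot dF\qquad\text{for all }\psi\in C_c(\Omega)$$ and all standard mollifiers $\rho$ (that is, $0\le\rho\in C^\infty_c(\mathbb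 R^n)$ is supported in the closed unit ball, $\int\rho=1$, and $\rho_\delta(x)=\delta^{-n}\rho(x/\delta)$). For a Borel set $E\subset\Omega$ the normal trace of $F$ on $\partial E$ is $$\langle F\cdot\nu,\phi\rangle_{\partial E}=-\int_E d\overline{\nabla\phi\cdot F}-\int_E\phi\,d(\operatorname{div}F),\qquad\phi\in W^{1,\infty}(\Omega).$$ It is represented by a measure on $\partial E$ if there is a finite signed Radon measure $\mu$ on $\Omega$, concentrated on $\partial E\cap\Omega$, such that $\langle F\cdot\nu,\phi\rangle_{\partial E}=\int_{\partial E}\phi\,d\mu$ for all $\phi\in W^{1,\infty}(\Omega)$; this measure is then denoted by $(F\cdot\nu)_{\partial E}$. **Theorem.** Let $F\in\mathcal{DM}^{ext}(\Omega)$, let $U\subset\Omega$ be an arbitrary open set (not necessarily compactly contained in $\Omega$), let $d(x)=\operatorname{dist}(x,\partial U)$, and let $U^\varepsilon=\{x\in U:\operatorname{dist}(x,\partial U)>\varepsilon\}$ for $\varepsilon>0$ (if $\partial U=\varnothing$, put $U^\varepsilon=U$ and $d\equiv0$). Then the measures $\operatorname{div}F$, $\overline{\nabla\phi\cdot F}$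 for $\phi\in W^{1,\infty}(\Omega)$, and $\overline{\nabla d\cdot F}$ exist and are unique, and there is an $\mathcal L^1$-null set $\mathcal N\subset(0,\infty)$ such that the following hold. (i) For every $\varepsilon\in(0,\infty)\setminus\mathcal N$, the normal trace $\langle F\cdot\nu,\cdot\rangle_{\partial U^\varepsilon}$ is represented by a unique measure $(F\cdot\nu)_{\partial U^\varepsilon}$ on $\partial U^\varepsilon$. (ii) For every $\phi\in W^{1,\infty}(\Omega)$ and every sequence $\varepsilon_k\to0$ with $\varepsilon_k\in(0,\infty)\setminus\mathcal N$, $$\langle F\cdot\nu,\phi\rangle_{\partial U}=\lim_{k\to\infty}\int_{\partial U^{\varepsilon_k}}\phi\,d(F\cdot\nu)_{\partial U^{\varepsilon_k}}.$$ (iii) For every $\phi\in W^{1,\infty}(\Omega)$, $$\langle F\cdot\nu,\phi\rangle_{\partial U}=\lim_{\varepsilon\downarrow0}\frac1\varepsilon\int_{U\setminus\overline{U^\varepsilon}}\phi\,d\overline{\nabla d\cdot F}.$$ (iv) For every bounded Borel function $\phi$ on $\Omega$, the function $t\mapsto\int_{\partial U^t}\phi\,d(F\cdot\nu)_{\partial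 U^t}$, defined for $t\in(0,\infty)\setminus\mathcal N$, is integrable on $(0,\infty)$ and $$\int_0^\infty\int_{\partial U^t}\phi\,d(F\cdot\nu)_{\partial U^t}\,dt=\int_U\phi\,d\overline{\nabla d\cdot F}.$$ -/

import Mathlib

open MeasureTheory Set Filter Topology
open scoped ContDiff

noncomputable section

namespace DivMeas

/-- The space `ℝⁿ` with its Euclidean norm. -/
abbrev Euc (n : ℕ) := EuclideanSpace ℝ (Fin n)

variable {n : ℕ}

/-! ### Measures on an open set and integration

A finite `ℝⁿ`-valued (resp. signed) Radon measure on an open set `Ω ⊆ ℝⁿ` is a countably additive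
set function on the Borel sets of `ℝⁿ`, with values in `ℝⁿ` (resp. `ℝ`), that is concentrated
on `Ω`. -/

/-- `μ` is concentrated on `A`: its total variation satisfies `|μ|(ℝⁿ \ A) = 0`. -/
def ConcentratedOn {V : Type*} [NormedAddCommGroup V] (μ : VectorMeasure (Euc n) V)
    (A : Set (Euc n)) : Prop :=
  μ.variation Aᶜ = 0

/-- `∫ φ dμ` for a scalar function `φ` and a signed measure `μ`. -/
def integ (μ : SignedMeasure (Euc n)) (φ : Euc n → ℝ) : ℝ :=
  VectorMeasure.integral μ φ (ContinuousLinearMap.lsmul ℝ ℝ).flip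

/-- `∫_A φ dμ` for a scalar function `φ`, a signed measure `μ` and a Borel set `A`. -/
def setInteg (μ : SignedMeasure (Euc n)) (A : Set (Euc n)) (φ : Euc n → ℝ) : ℝ :=
  VectorMeasure.integral (VectorMeasure.restrict μ A) φ (ContinuousLinearMap.lsmul ℝ ℝ).flip

/-- `∫ X · dF` for a vector field `X` and an `ℝⁿ`-valued measure `F`. -/
def dotInteg (F : VectorMeasure (Euc n) (Euc n)) (X : Euc n → Euc n) : ℝ :=
  VectorMeasure.integral F X (innerSL ℝ)

/-! ### Function spaces -/

/-- `φ ∈ C_c(Ω)`. -/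
def IsCc (Ω : Set (Euc n)) (φ : Euc n → ℝ) : Prop :=
  Continuous φ ∧ HasCompactSupport φ ∧ tsupport φ ⊆ Ω

/-- `φ ∈ C¹_c(Ω)`. -/
def IsC1c (Ω : Set (Euc n)) (φ : Euc n → ℝ) : Prop :=
  ContDiff ℝ 1 φ ∧ HasCompactSupport φ ∧ tsupport φ ⊆ Ω

/-- `φ ∈ C^∞_c(Ω)`. -/
def IsCinfc (Ω : Set (Euc n)) (φ : Euc n → ℝ) : Prop :=
  ContDiff ℝ ∞ φ ∧ HasCompactSupport φ ∧ tsupport φ ⊆ Ω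

/-- `g` is the weak gradient of `φ` in `Ω`:
`∫_Ω φ ∇η dx = - ∫_Ω η g dx` for all `η ∈ C^∞_c(Ω)`. -/
def HasWeakGradient (Ω : Set (Euc n)) (φ : Euc n → ℝ) (g : Euc n → Euc n) : Prop :=
  ∀ η : Euc n → ℝ, IsCinfc Ω η →
    ∫ x in Ω, φ x • gradient η x = - ∫ x in Ω, η x • g x

/-- `φ ∈ W^{1,∞}(Ω)`: `φ` and its weak gradient are essentially bounded on `Ω`. As usual, an
element of `W^{1,∞}(Ω)` is identified with its continuous representative. The values of `φ` outside
`Ω` play no role. -/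
def IsW1inf (Ω : Set (Euc n)) (φ : Euc n → ℝ) : Prop :=
  ContinuousOn φ Ω ∧ MemLp φ ⊤ (volume.restrict Ω) ∧
    ∃ g : Euc n → Euc n, MemLp g ⊤ (volume.restrict Ω) ∧ HasWeakGradient Ω φ g

/-! ### Extended divergence-measure fields -/

/-- `|div F|(Ω) = sup { ∫ ∇φ · dF : φ ∈ C¹_c(Ω), |φ| ≤ 1 }`. -/
def divVariation (Ω : Set (Euc n)) (F : VectorMeasure (Euc n) (Euc n)) : ENNReal :=
  ⨆ (φ : Euc n → ℝ) (_ : IsC1c Ω φ) (_ : ∀ x, |φ x| ≤ 1),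
    ENNReal.ofReal (dotInteg F (gradient φ))

/-- `F ∈ DM^ext(Ω)`: `F` is a finite `ℝⁿ`-valued measure on `Ω` with `|div F|(Ω) < ∞`. -/
def IsDMext (Ω : Set (Euc n)) (F : VectorMeasure (Euc n) (Euc n)) : Prop :=
  ConcentratedOn F Ω ∧ divVariation Ω F < ⊤

/-- The finite signed measure `σ` on `Ω` represents the distributional divergence of `F`. -/
def IsDivergence (Ω : Set (Euc n)) (F : VectorMeasure (Euc n) (Euc n))
    (σ : SignedMeasure (Euc n)) : Prop :=
  ConcentratedOn σ Ω ∧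
    ∀ φ : Euc n → ℝ, IsC1c Ω φ → integ σ φ = - dotInteg F (gradient φ)

open Classical in
/-- The measure `div F` on `Ω` (`0` if the distributional divergence is not a finite measure). -/
def divMeasure (Ω : Set (Euc n)) (F : VectorMeasure (Euc n) (Euc n)) : SignedMeasure (Euc n) :=
  if h : ∃ σ, IsDivergence Ω F σ then h.choose else 0

/-! ### The pairing measure -/

/-- A standard mollifier: non-negative, smooth, supported in the unit ball, with integral one. -/
def IsStdMollifier (ρ : Euc n → ℝ) : Prop :=
  ContDiff ℝ ∞ ρ ∧ (∀ x, 0 ≤ ρ x) ∧ tsupport ρ ⊆ Metric.closedBall 0 1 ∧ ∫ x, ρ x = 1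

/-- The mollification `φ_δ(x) = ∫_Ω δ⁻ⁿ ρ((x - y)/δ) φ(y) dy` of a function `φ` on `Ω`. It is only
of interest at points `x` whose distance to the complement of `Ω` exceeds `δ`. -/
def mollify (Ω : Set (Euc n)) (ρ : Euc n → ℝ) (δ : ℝ) (φ : Euc n → ℝ) (x : Euc n) : ℝ :=
  ∫ y in Ω, (δ ^ n)⁻¹ * ρ (δ⁻¹ • (x - y)) * φ y

/-- The finite signed measure `μ` on `Ω` is the pairing measure of `∇φ` and `F`:
`∫ ψ dμ = lim_{δ → 0} ∫ ψ ∇φ_δ · dF` for all `ψ ∈ C_c(Ω)`. -/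
def IsPairing (Ω : Set (Euc n)) (F : VectorMeasure (Euc n) (Euc n)) (φ : Euc n → ℝ)
    (μ : SignedMeasure (Euc n)) : Prop :=
  ConcentratedOn μ Ω ∧
    ∀ ρ : Euc n → ℝ, IsStdMollifier ρ → ∀ ψ : Euc n → ℝ, IsCc Ω ψ →
      Tendsto (fun δ : ℝ => dotInteg F (fun x => ψ x • gradient (mollify Ω ρ δ φ) x))
        (𝓝[>] 0) (𝓝 (integ μ ψ))

open Classical in
/-- The pairing measure of `∇φ` and `F` (`0` if there is no such measure). -/
def pairing (Ω : Set (Euc n)) (F : VectorMeasure (Euc n) (Euc n)) (φ : Euc n → ℝ) :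
    SignedMeasure (Euc n) :=
  if h : ∃ μ, IsPairing Ω F φ μ then h.choose else 0

/-! ### The normal trace -/

/-- The normal trace `⟨F · ν, φ⟩_{∂E}` of `F` on the boundary of a Borel set `E ⊆ Ω`, tested
against `φ ∈ W^{1,∞}(Ω)`. -/
def normalTrace (Ω : Set (Euc n)) (F : VectorMeasure (Euc n) (Euc n)) (E : Set (Euc n))
    (φ : Euc n → ℝ) : ℝ :=
  - pairing Ω F φ E - setInteg (divMeasure Ω F) E φ

/-- The normal trace of `F` on `∂E` is represented by the finite signed measure `μ` on `∂E`
(contained in `Ω` up to a null set, as the test functions live on `Ω`). -/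
def IsTraceMeasure (Ω : Set (Euc n)) (F : VectorMeasure (Euc n) (Euc n)) (E : Set (Euc n))
    (μ : SignedMeasure (Euc n)) : Prop :=
  ConcentratedOn μ (frontier E ∩ Ω) ∧
    ∀ φ : Euc n → ℝ, IsW1inf Ω φ → normalTrace Ω F E φ = setInteg μ (frontier E) φ

open Classical in
/-- The measure `(F · ν)_{∂E}` (`0` if the normal trace is not represented by a measure). -/
def traceMeasure (Ω : Set (Euc n)) (F : VectorMeasure (Euc n) (Euc n)) (E : Set (Euc n)) :
    SignedMeasure (Euc n) :=
  if h : ∃ μ, IsTraceMeasure Ω F E μ then h.choose else 0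

/-! ### Interior approximations -/

/-- `U^ε = { x ∈ U : dist(x, ∂U) > ε }`, where the distance to the empty set is `+∞`. -/
def innerApprox (U : Set (Euc n)) (ε : ℝ) : Set (Euc n) :=
  {x | x ∈ U ∧ ENNReal.ofReal ε < Metric.infEDist x (frontier U)}

/-- `d(x) = dist(x, ∂U)` (`d = 0` in the degenerate case of an empty boundary `∂U`). -/
def bdryDist (U : Set (Euc n)) (x : Euc n) : ℝ :=
  Metric.infDist x (frontier U)

end DivMeas

end

open DivMeas

/-! Put m = |F| + |div F|, so that F = f m and div F = s m with |f|, |s| ≤ 1. For φ in W^{1,∞}(Ω)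
the mollified gradients are locally bounded by one constant C, so the functionals ψ ↦ ∫ ψ ∇φ_δ · f
dm are dominated by C ∫ |ψ| dm. After integration by parts against ψ in C¹_c they converge to -∫ ψ φ
s dm - ∫ φ ∇ψ · f dm. The limit inherits the bound, hence has a density g, and g m is the pairing
measure (`DivField.exists_hasDerivAlong`). The normal trace on ∂E becomes ∫_E -(g + φ s) dm. The
measure div F itself comes from Hahn-Banach and Riesz-Markov (`exists_isDivergence`).

Let u be the distance to the complement of U. If ∂U is nonempty, then U = {u > 0}, U^t = {u > t} for
t > 0, and u = d on U. Let gu be the density of the pairing of u, and let flux_φ(t) = ∫_{u > t} -(g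
+ φ s) dm, the trace of φ on ∂U^t. Let k vanish below some positive level and have compact support,
and let h be its primitive. Testing the equation of g with h(u) and using the chain rule gives ∫
k(u) φ gu dm = -∫ h(u) (g + φ s) dm (`DivField.level_identity`). By Fubini the right side is ∫ k(t)
flux_φ(t) dt. This yields the coarea formula ∫_{u ∈ B} φ gu dm = ∫_B flux_φ dt for bounded Borel B
in (0, ∞) (`DivField.setIntegral_preimage`).

Everything follows from this formula. The flux is continuous from the right, and its value at 0 is
the trace on ∂U; this is (ii), and taking averages over (0, ε) gives (iii). The image under u of
|gu| m restricted to U is absolutely continuous, so this measure disintegrates into measures L_t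
carried by {u = t}, and sgn(gu) L_t represents the flux. For a fixed φ this holds for almost every
t. The exceptional set can be chosen independently of φ because |flux_φ(t)| ≤ K_t sup |φ|, where K_t
is the derivative at t of the monotone function t ↦ ∫_{u ≤ t} |gu| dm (`DivField.ae_flux_le`), so
that a countable family dense in the uniform norm suffices (`DivField.exists_levelTrace`). Apart
from countably many t the set {u = t} lies on ∂U^t, whence (i). Statement (iv) is the disintegration
formula, which holds for bounded Borel functions.

If ∂U is empty, then U is empty or the whole space, and all traces vanish. -/

noncomputable section

namespace DivMeas

open scoped ENNReal NNReal

/-! ### Integration against vector measures given by densities. -/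

section General

variable {X V W G : Type*} [MeasurableSpace X]
  [NormedAddCommGroup V] [NormedSpace ℝ V] [CompleteSpace V]
  [NormedAddCommGroup W] [NormedSpace ℝ W]
  [NormedAddCommGroup G] [NormedSpace ℝ G] [CompleteSpace G]

theorem variation_withDensityV_le {m : Measure X} [IsFiniteMeasure m] {f : X → V}
    (hf : Integrable f m) (hb : ∀ᵐ x ∂m, ‖f x‖ ≤ 1) : (m.withDensityᵥ f).variation ≤ m := by
  rw [Measure.variation_withDensityᵥ hf]
  calc m.withDensity (fun x => ‖f x‖ₑ) ≤ m.withDensity (fun _ => 1) := by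
        apply withDensity_mono
        filter_upwards [hb] with x hx
        rw [← ofReal_norm]
        exact ENNReal.ofReal_le_one.2 hx
    _ = m := by simp

/-- When the density has norm at most one, the variation is dominated by m, so both sides are
continuous on L¹(m) and agreement on indicator functions is enough. -/
theorem vintegral_withDensityV_of_norm_le_one {m : Measure X} [IsFiniteMeasure m] {f : X → V}
    (hf : AEStronglyMeasurable f m) (hb : ∀ᵐ x ∂m, ‖f x‖ ≤ 1)
    (B : W →L[ℝ] V →L[ℝ] G) {Y : X → W} (hY : Integrable Y m) :
    VectorMeasure.integral (m.withDensityᵥ f) Y B = ∫ x, B (Y x) (f x) ∂m := by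
  have hfi : Integrable f m := Integrable.of_bound hf 1 hb
  have hle := variation_withDensityV_le hfi hb
  have hfin : IsFiniteMeasure (m.withDensityᵥ f).variation := isFiniteMeasure_of_le m hle
  have hint : ∀ {Z : X → W}, Integrable Z m → Integrable (fun x => B (Z x) (f x)) m := by
    intro Z hZ
    refine Integrable.mono' (hZ.norm.const_mul ‖B‖)
      (B.aestronglyMeasurable_comp₂ hZ.aestronglyMeasurable hf) ?_
    filter_upwards [hb] with x hx
    calc ‖B (Z x) (f x)‖ ≤ ‖B‖ * ‖Z x‖ * ‖f x‖ := B.le_opNorm₂ _ _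
      _ ≤ ‖B‖ * ‖Z x‖ * 1 := by gcongr
      _ = _ := mul_one _
  have hae : (ae (m.withDensityᵥ f).variation) ≤ ae m := ae_mono hle
  refine Integrable.induction (μ := m) (fun Y => VectorMeasure.integral (m.withDensityᵥ f) Y B =
    ∫ x, B (Y x) (f x) ∂m) ?_ ?_ ?_ ?_ hY
  · intro c s hs _
    rw [VectorMeasure.integral_indicator hs, VectorMeasure.integral_const,
      VectorMeasure.restrict_apply _ hs MeasurableSet.univ, univ_inter, withDensityᵥ_apply hfi hs]
    have : (fun x => B (s.indicator (fun _ => c) x) (f x)) = s.indicator (fun x => B c (f x)) := by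
      ext x
      by_cases hx : x ∈ s <;> simp [hx]
    rw [this, integral_indicator hs, ContinuousLinearMap.integral_comp_comm _ hfi.integrableOn]
  · intro Y Z _ hY hZ h1 h2
    rw [VectorMeasure.integral_add (hY.mono_measure hle) (hZ.mono_measure hle), h1, h2,
      ← integral_add (hint hY) (hint hZ)]
    simp
  · refine isClosed_eq ?_ ?_
    -- Since the variation is at most m, the integral may be computed by extension from simple
    -- functions in L¹(m), which makes it continuous there.
    · have : ∀ Y : X →₁[m] W, VectorMeasure.integral (m.withDensityᵥ f) Y B =
          setToFun m ((m.withDensityᵥ f).transpose B) (C := ‖B‖) (by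
            refine ⟨fun s t hs ht _ _ hd => cbmApplyMeasure_union _ _ hs ht hd, fun s hs hsf => ?_⟩
            refine (norm_cbmApplyMeasure_le _ _ _).trans ?_
            gcongr
            refine (VectorMeasure.norm_measure_le_variation).trans ?_
            exact ENNReal.toReal_mono hsf.ne (hle s)) Y := by
        intro Y
        exact (setToFun_congr_measure_of_integrable 1 (by simp) (by simpa using hle) _ _ _
          (L1.integrable_coeFn Y)).symm
      simp_rw [this]
      exact continuous_setToFun _
    · rw [continuous_iff_continuousAt]
      intro Y
      rw [ContinuousAt, tendsto_iff_norm_sub_tendsto_zero]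
      have h0 : Tendsto (fun Z : X →₁[m] W => ‖B‖ * ‖Z - Y‖) (𝓝 Y) (𝓝 (‖B‖ * ‖Y - Y‖)) :=
        (by fun_prop : Continuous fun Z : X →₁[m] W => ‖B‖ * ‖Z - Y‖).tendsto Y
      rw [sub_self, norm_zero, mul_zero] at h0
      refine squeeze_zero (fun _ => norm_nonneg _) (fun Z => ?_) h0
      rw [← integral_sub (hint (L1.integrable_coeFn Z)) (hint (L1.integrable_coeFn Y)),
        L1.norm_eq_integral_norm, ← integral_const_mul]
      refine norm_integral_le_of_norm_le ((L1.integrable_coeFn _).norm.const_mul _) ?_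
      filter_upwards [hb, Lp.coeFn_sub Z Y] with x hx hs
      rw [hs, ← sub_apply, ← map_sub]
      calc ‖B (Z x - Y x) (f x)‖ ≤ ‖B‖ * ‖Z x - Y x‖ * ‖f x‖ := B.le_opNorm₂ _ _
        _ ≤ ‖B‖ * ‖Z x - Y x‖ * 1 := by gcongr
        _ = _ := by simp
  · intro Y Z h _ h1
    rw [← VectorMeasure.integral_congr_ae (hae h), h1]
    refine integral_congr_ae ?_
    filter_upwards [h] with x hx
    rw [hx]

/-- The factor ‖f‖ is moved into the base measure; the remaining density f / ‖f‖ has norm at most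
one. -/
theorem vintegral_withDensityV {m : Measure X} [IsFiniteMeasure m] {f : X → V}
    (hf : Integrable f m) (B : W →L[ℝ] V →L[ℝ] G) {Y : X → W} (hY : AEStronglyMeasurable Y m)
    {C : ℝ} (hC : ∀ᵐ x ∂m, ‖Y x‖ ≤ C) :
    VectorMeasure.integral (m.withDensityᵥ f) Y B = ∫ x, B (Y x) (f x) ∂m := by
  set g : X → V := fun x => ‖f x‖⁻¹ • f x
  have hgf : (fun x => ‖f x‖₊ • g x) = f := by
    ext x
    by_cases h : f x = 0
    · simp [g, h]
    · simp only [g, NNReal.smul_def, coe_nnnorm]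
      rw [smul_smul, mul_inv_cancel₀ (norm_ne_zero_iff.2 h), one_smul]
  have hfm : AEMeasurable (fun x => ‖f x‖₊) m := hf.aestronglyMeasurable.nnnorm.aemeasurable
  have h1 : m.withDensityᵥ f = (m.withDensity (fun x => (‖f x‖₊ : ℝ≥0∞))).withDensityᵥ g := by
    rw [← withDensityᵥ_smul_eq_withDensityᵥ_withDensity hfm]
    · congr 1; exact hgf.symm
    · exact (by rw [← hgf] at hf; exact hf)
  have hfin : IsFiniteMeasure (m.withDensity (fun x => (‖f x‖₊ : ℝ≥0∞))) :=
    isFiniteMeasure_withDensity hf.2.ne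
  have hac : m.withDensity (fun x => (‖f x‖₊ : ℝ≥0∞)) ≪ m := withDensity_absolutelyContinuous _ _
  have hg : AEStronglyMeasurable g m :=
    (hf.aestronglyMeasurable.norm.aemeasurable.inv.aestronglyMeasurable).smul
      hf.aestronglyMeasurable
  have hg1 : ∀ x, ‖g x‖ ≤ 1 := fun x => by
    simp only [g, norm_smul, norm_inv, norm_norm]
    exact inv_mul_le_one
  rw [h1, vintegral_withDensityV_of_norm_le_one (hg.mono_ac hac) (ae_of_all _ hg1) B
    (Integrable.of_bound (hY.mono_ac hac) C (hac.ae_le hC)),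
    integral_withDensity_eq_integral_smul₀ hfm]
  refine integral_congr_ae (ae_of_all _ fun x => ?_)
  have := congrFun hgf x
  change _ = B (Y x) (f x)
  conv_rhs => rw [← this]
  simp [NNReal.smul_def]

omit [CompleteSpace V] in
theorem restrict_withDensityV {m : Measure X} {f : X → V}
    (hf : Integrable f m) {A : Set X} (hA : MeasurableSet A) :
    (m.withDensityᵥ f).restrict A = (m.restrict A).withDensityᵥ f := by
  ext s hs
  rw [VectorMeasure.restrict_apply _ hA hs, withDensityᵥ_apply hf (hs.inter hA),
    withDensityᵥ_apply hf.restrict hs, Measure.restrict_restrict hs]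

end General

/-! ### Bounded densities with respect to a dominating measure. -/

section Euclidean

variable {X : Type*} [MeasurableSpace X]

theorem norm_density_le_one {V : Type*} [NormedAddCommGroup V] [NormedSpace ℝ V] [CompleteSpace V]
    {m : Measure X} [IsFiniteMeasure m] {f : X → V} (hf : Integrable f m)
    (h : (m.withDensityᵥ f).variation ≤ m) : ∀ᵐ x ∂m, ‖f x‖ ≤ 1 := by
  have h1 : (fun x => ‖f x‖ₑ) ≤ᵐ[m] fun _ => 1 := by
    refine ae_le_of_forall_setLIntegral_le_of_sigmaFinite₀ hf.aestronglyMeasurable.enorm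
      fun s hs _ => ?_
    rw [Measure.variation_withDensityᵥ hf] at h
    have := h s
    rw [withDensity_apply _ hs] at this
    simpa using this
  filter_upwards [h1] with x hx
  rw [← ofReal_norm] at hx
  exact ENNReal.ofReal_le_one.1 hx

theorem exists_density_signed (μ : SignedMeasure X) {m : Measure X} [IsFiniteMeasure m]
    (h : μ.variation ≤ m) :
    ∃ s : X → ℝ, Measurable s ∧ (∀ x, ‖s x‖ ≤ 1) ∧ μ = m.withDensityᵥ s := by
  have h0 : m.withDensityᵥ (μ.rnDeriv m) = μ := by
    rw [SignedMeasure.withDensityᵥ_rnDeriv_eq]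
    intro s hs
    by_cases hm : MeasurableSet s
    · rw [← enorm_eq_zero, ← le_zero_iff]
      refine (VectorMeasure.enorm_measure_le_variation μ s).trans ((h s).trans ?_)
      rw [Measure.toENNRealVectorMeasure_apply_measurable hm] at hs
      exact hs.le
    · exact μ.not_measurable hm
  have hb := norm_density_le_one (SignedMeasure.integrable_rnDeriv μ m) (by rwa [h0])
  -- The Radon-Nikodym derivative is bounded by one only almost everywhere; setting it to zero
  -- elsewhere gives the bound at every point.
  refine ⟨{x | ‖μ.rnDeriv m x‖ ≤ 1}.indicator (μ.rnDeriv m), ?_, ?_, ?_⟩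
  · have := SignedMeasure.measurable_rnDeriv μ m
    exact this.indicator (measurableSet_le this.norm measurable_const)
  · intro x
    by_cases hx : ‖μ.rnDeriv m x‖ ≤ 1
    · rwa [indicator_of_mem (by exact hx)]
    · rw [indicator_of_notMem (by exact hx)]
      simp
  · rw [← h0]
    refine WithDensityᵥEq.congr_ae ?_
    rw [h0]
    filter_upwards [hb] with x hx
    rw [indicator_of_mem (by exact hx)]

end Euclidean

section Coordinates

variable {X : Type*} [MeasurableSpace X] {n : ℕ}

/-- The `i`-th coordinate of an `ℝⁿ`-valued measure. -/
def coordMeasure (F : VectorMeasure X (Euc n)) (i : Fin n) : SignedMeasure X :=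
  F.mapRange (EuclideanSpace.proj (𝕜 := ℝ) i).toAddMonoidHom (EuclideanSpace.proj i).continuous

theorem coordMeasure_apply (F : VectorMeasure X (Euc n)) (i : Fin n) (s : Set X) :
    coordMeasure F i s = F s i := rfl

instance isFiniteMeasure_variation_signed (μ : SignedMeasure X) : IsFiniteMeasure μ.variation := by
  rw [← SignedMeasure.totalVariation_eq_variation, SignedMeasure.totalVariation]
  infer_instance

instance isFiniteMeasure_variation_euclidean (F : VectorMeasure X (Euc n)) :
    IsFiniteMeasure F.variation := by
  refine isFiniteMeasure_of_le (∑ i, (coordMeasure F i).variation) ?_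
  refine VectorMeasure.variation_le_of_forall_enorm_le fun s hs => ?_
  rw [Measure.finsetSum_apply]
  have : F s = ∑ i, EuclideanSpace.single i (F s i) := by
    ext j
    simp
  rw [this]
  refine (enorm_sum_le _ _).trans (Finset.sum_le_sum fun i _ => ?_)
  refine le_trans (le_of_eq ?_) (VectorMeasure.enorm_measure_le_variation _ s)
  rw [coordMeasure_apply, ← ofReal_norm, ← ofReal_norm]
  simp

theorem exists_density_euclidean (F : VectorMeasure X (Euc n)) {m : Measure X} [IsFiniteMeasure m]
    (h : F.variation ≤ m) :
    ∃ f : X → Euc n, Measurable f ∧ (∀ x, ‖f x‖ ≤ 1) ∧ F = m.withDensityᵥ f := by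
  have hc : ∀ i, (coordMeasure F i).variation ≤ m := fun i => by
    refine le_trans ?_ h
    refine VectorMeasure.variation_le_of_forall_enorm_le fun s hs => ?_
    refine le_trans ?_ (VectorMeasure.enorm_measure_le_variation _ s)
    rw [coordMeasure_apply, ← ofReal_norm, ← ofReal_norm]
    exact ENNReal.ofReal_le_ofReal (PiLp.norm_apply_le _ _)
  choose a ha hb hd using fun i => exists_density_signed (coordMeasure F i) (hc i)
  set f : X → Euc n := fun x => WithLp.toLp 2 fun i => a i x
  have hfm : Measurable f := by
    refine (PiLp.continuous_toLp 2 _).measurable.comp (measurable_pi_lambda _ ha)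
  have hai : ∀ i, Integrable (a i) m := fun i =>
    Integrable.of_bound (ha i).aestronglyMeasurable 1 (ae_of_all _ (hb i))
  have hfi : Integrable f m := by
    -- The coordinatewise bound √n serves only integrability; the sharp bound one comes from the
    -- domination of the variation by m.
    refine Integrable.of_bound hfm.aestronglyMeasurable (√(∑ _i : Fin n, 1 ^ 2))
      (ae_of_all _ fun x => ?_)
    rw [EuclideanSpace.norm_eq]
    refine Real.sqrt_le_sqrt (Finset.sum_le_sum fun i _ => ?_)
    exact pow_le_pow_left₀ (norm_nonneg _) (hb i x) 2
  have h0 : m.withDensityᵥ f = F := by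
    ext s hs i
    rw [withDensityᵥ_apply hfi hs]
    have := (EuclideanSpace.proj (𝕜 := ℝ) i).integral_comp_comm (hfi.integrableOn (s := s))
    change ∫ x in s, a i x ∂m = (∫ x in s, f x ∂m) i at this
    rw [← this, ← coordMeasure_apply, hd i, withDensityᵥ_apply (hai i) hs]
  have hb := norm_density_le_one hfi (by rwa [h0])
  refine ⟨{x | ‖f x‖ ≤ 1}.indicator f, ?_, ?_, ?_⟩
  · exact hfm.indicator (measurableSet_le hfm.norm measurable_const)
  · intro x
    by_cases hx : ‖f x‖ ≤ 1 <;> simp [indicator, hx]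
  · rw [← h0]
    refine WithDensityᵥEq.congr_ae ?_
    filter_upwards [hb] with x hx
    rw [indicator_of_mem (by exact hx)]

end Coordinates

end DivMeas

end

noncomputable section

namespace DivMeas

open scoped ENNReal NNReal BoundedContinuousFunction CompactlySupported

/-! ### Functionals bounded by a seminorm, and L² densities. -/

section Extension

/-- A linear functional on `V` which is bounded with respect to the seminorm `‖ι ·‖` factors
through a continuous linear functional on the target of `ι`. -/
theorem exists_continuous_factor {V H : Type*} [AddCommGroup V] [Module ℝ V]
    [NormedAddCommGroup H] [NormedSpace ℝ H] (ι : V →ₗ[ℝ] H) (L : V →ₗ[ℝ] ℝ) (C : ℝ)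
    (hL : ∀ v, |L v| ≤ C * ‖ι v‖) : ∃ ℓ : StrongDual ℝ H, ∀ v, L v = ℓ (ι v) := by
  have hker : LinearMap.ker ι ≤ LinearMap.ker L := fun v hv => by
    have := hL v
    rw [LinearMap.mem_ker.1 hv, norm_zero, mul_zero] at this
    exact LinearMap.mem_ker.2 (abs_nonpos_iff.1 this)
  set L' : LinearMap.range ι →ₗ[ℝ] ℝ :=
    ((LinearMap.ker ι).liftQ L hker).comp ι.quotKerEquivRange.symm.toLinearMap with hL'
  have hLv : ∀ v, L' ⟨ι v, LinearMap.mem_range_self ι v⟩ = L v := fun v => by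
    have : ι.quotKerEquivRange.symm ⟨ι v, LinearMap.mem_range_self ι v⟩ =
        (LinearMap.ker ι).mkQ v := by
      rw [LinearEquiv.symm_apply_eq]
      rfl
    simp [hL', this]
  obtain ⟨ℓ, hℓ, -⟩ := exists_extension_norm_eq (LinearMap.range ι) (L'.mkContinuous C (by
    rintro ⟨_, v, rfl⟩
    rw [hLv]
    exact hL v))
  exact ⟨ℓ, fun v => by rw [← hLv v]; exact (hℓ ⟨ι v, LinearMap.mem_range_self ι v⟩).symm⟩

/-- A functional dominated by the `L¹`-norm of a finite measure has a square integrable density. -/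
theorem exists_density_of_le_integral_abs {X V : Type*} [MeasurableSpace X] [AddCommGroup V]
    [Module ℝ V] (m : Measure X) [IsFiniteMeasure m] (ev : V →ₗ[ℝ] X → ℝ)
    (hev : ∀ v, MemLp (ev v) 2 m) (L : V →ₗ[ℝ] ℝ) (C : ℝ) (hC : 0 ≤ C)
    (hL : ∀ v, |L v| ≤ C * ∫ x, |ev v x| ∂m) :
    ∃ g : X → ℝ, StronglyMeasurable g ∧ MemLp g 2 m ∧ ∀ v, L v = ∫ x, ev v x * g x ∂m := by
  set ι : V →ₗ[ℝ] Lp ℝ 2 m :=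
    { toFun := fun v => (hev v).toLp (ev v)
      map_add' := fun v w => by
        rw [← MemLp.toLp_add (hev v) (hev w)]
        congr 1
        simp
      map_smul' := fun c v => by
        rw [RingHom.id_apply, ← MemLp.toLp_const_smul c (hev v)]
        congr 1
        simp }
  -- On a finite measure space the L¹ norm is controlled by the L² norm, so the Hilbert space
  -- representation can be used instead of the duality of L¹ and L^∞.
  have hι : ∀ v, |L v| ≤ (C * (m univ).toReal ^ (1 / 2 : ℝ)) * ‖ι v‖ := fun v => by
    refine (hL v).trans ?_
    rw [mul_assoc]
    refine mul_le_mul_of_nonneg_left ?_ hC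
    have h1 := eLpNorm_le_eLpNorm_mul_rpow_measure_univ (p := 1) (q := 2) (by norm_num)
      (hev v).aestronglyMeasurable
    have h2 : (∫ x, |ev v x| ∂m) = (eLpNorm (ev v) 1 m).toReal := by
      rw [eLpNorm_one_eq_lintegral_enorm, ← integral_norm_eq_lintegral_enorm
        (hev v).aestronglyMeasurable]
      rfl
    have h3 : ‖ι v‖ = (eLpNorm (ev v) 2 m).toReal := Lp.norm_toLp _ (hev v)
    rw [h2, h3, mul_comm, ENNReal.toReal_rpow, ← ENNReal.toReal_mul]
    refine ENNReal.toReal_mono ?_ (h1.trans_eq ?_)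
    · exact ENNReal.mul_ne_top (hev v).2.ne (ENNReal.rpow_ne_top_of_nonneg (by norm_num)
        (measure_ne_top _ _))
    · norm_num
  obtain ⟨ℓ, hℓ⟩ := exists_continuous_factor ι L _ hι
  set G : Lp ℝ 2 m := (InnerProductSpace.toDual ℝ (Lp ℝ 2 m)).symm ℓ
  refine ⟨G, Lp.stronglyMeasurable G, Lp.memLp G, fun v => ?_⟩
  rw [hℓ v, ← InnerProductSpace.toDual_symm_apply, L2.inner_def]
  refine integral_congr_ae ?_
  filter_upwards [(hev v).coeFn_toLp] with x hx
  change inner ℝ (G x) (((hev v).toLp (ev v)) x) = _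
  rw [hx]
  simp [G]

end Extension

/-! ### Riesz representation of bounded functionals through their variation. -/

section Riesz

variable {E : Type*} [TopologicalSpace E]

/-- The values of a functional `ℓ` at the functions dominated by `φ`. -/
def dominatedValues (ℓ : StrongDual ℝ (E →ᵇ ℝ)) (φ : E → ℝ) : Set ℝ :=
  {r | ∃ ψ : E →ᵇ ℝ, (∀ x, |ψ x| ≤ φ x) ∧ ℓ ψ = r}

/-- The variation of a functional `ℓ`. -/
def dualVariation (ℓ : StrongDual ℝ (E →ᵇ ℝ)) (φ : E → ℝ) : ℝ := sSup (dominatedValues ℓ φ)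

variable (ℓ : StrongDual ℝ (E →ᵇ ℝ)) {φ φ₁ φ₂ : E → ℝ}

theorem dominatedValues_le {C : ℝ} (hC : 0 ≤ C) (hφ : ∀ x, φ x ≤ C) {r : ℝ}
    (hr : r ∈ dominatedValues ℓ φ) : r ≤ ‖ℓ‖ * C := by
  obtain ⟨ψ, hψ, rfl⟩ := hr
  refine (le_abs_self _).trans ((ℓ.le_opNorm ψ).trans ?_)
  gcongr
  exact (BoundedContinuousFunction.norm_le hC).2 fun x => (hψ x).trans (hφ x)

theorem zero_mem_dominatedValues (hφ : ∀ x, 0 ≤ φ x) : 0 ∈ dominatedValues ℓ φ :=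
  ⟨0, by simpa using hφ, by simp⟩

theorem dualVariation_nonneg (hφ : ∀ x, 0 ≤ φ x) : 0 ≤ dualVariation ℓ φ :=
  Real.sSup_nonneg' ⟨0, zero_mem_dominatedValues ℓ hφ, le_rfl⟩

theorem dualVariation_le {C : ℝ} (hC : 0 ≤ C) (hφ0 : ∀ x, 0 ≤ φ x) (hφ : ∀ x, φ x ≤ C) :
    dualVariation ℓ φ ≤ ‖ℓ‖ * C :=
  csSup_le ⟨0, zero_mem_dominatedValues ℓ hφ0⟩ fun _ hr => dominatedValues_le ℓ hC hφ hr

theorem le_dualVariation {C : ℝ} (hφ : ∀ x, φ x ≤ C) {ψ : E →ᵇ ℝ} (hψ : ∀ x, |ψ x| ≤ φ x) :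
    ℓ ψ ≤ dualVariation ℓ φ :=
  le_csSup ⟨‖ℓ‖ * max C 0, fun _ hr =>
    dominatedValues_le ℓ (le_max_right _ _) (fun x => (hφ x).trans (le_max_left _ _)) hr⟩
    ⟨ψ, hψ, rfl⟩

/-- Additivity is what makes the variation a positive linear functional. For "≤", a function
dominated by φ₁ + φ₂ is split into its truncation to [-φ₁, φ₁] and a remainder dominated by φ₂; for
"≥", dominated functions are added. -/
theorem dualVariation_add (h1 : Continuous φ₁) (h10 : ∀ x, 0 ≤ φ₁ x) {C₁ : ℝ}
    (hC1 : ∀ x, φ₁ x ≤ C₁) (h20 : ∀ x, 0 ≤ φ₂ x) {C₂ : ℝ} (hC2 : ∀ x, φ₂ x ≤ C₂) :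
    dualVariation ℓ (fun x => φ₁ x + φ₂ x) = dualVariation ℓ φ₁ + dualVariation ℓ φ₂ := by
  apply le_antisymm
  · refine csSup_le ⟨0, zero_mem_dominatedValues ℓ fun x => add_nonneg (h10 x) (h20 x)⟩ ?_
    rintro _ ⟨ψ, hψ, rfl⟩
    have hb : ∀ x, |max (-φ₁ x) (min (φ₁ x) (ψ x))| ≤ φ₁ x := fun x => by
      rw [abs_le]
      exact ⟨le_max_left _ _, max_le (by linarith [h10 x]) (min_le_left _ _)⟩
    set ψ₁ : E →ᵇ ℝ := BoundedContinuousFunction.ofNormedAddCommGroup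
      (fun x => max (-φ₁ x) (min (φ₁ x) (ψ x))) (by fun_prop) C₁ fun x => (hb x).trans (hC1 x)
    have : ψ = ψ₁ + (ψ - ψ₁) := by abel
    rw [this, map_add]
    refine add_le_add (le_dualVariation ℓ hC1 hb) (le_dualVariation ℓ hC2 fun x => ?_)
    change |ψ x - max (-φ₁ x) (min (φ₁ x) (ψ x))| ≤ φ₂ x
    have := abs_le.1 (hψ x)
    rw [abs_le]
    rcases le_total (φ₁ x) (ψ x) with h | h
    · rw [min_eq_left h, max_eq_right (by linarith [h10 x])]
      constructor <;> linarith [h10 x, h20 x]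
    · rw [min_eq_right h]
      rcases le_total (-φ₁ x) (ψ x) with h' | h'
      · rw [max_eq_right h']
        constructor <;> linarith [h20 x]
      · rw [max_eq_left h']
        constructor <;> linarith [h20 x]
  · rw [← le_sub_iff_add_le]
    refine csSup_le ⟨0, zero_mem_dominatedValues ℓ h10⟩ ?_
    rintro _ ⟨ψ₁, hψ₁, rfl⟩
    rw [le_sub_comm]
    refine csSup_le ⟨0, zero_mem_dominatedValues ℓ h20⟩ ?_
    rintro _ ⟨ψ₂, hψ₂, rfl⟩
    rw [le_sub_iff_add_le', ← map_add]
    refine le_dualVariation ℓ (fun x => add_le_add (hC1 x) (hC2 x)) fun x => ?_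
    exact (abs_add_le _ _).trans (add_le_add (hψ₁ x) (hψ₂ x))

theorem dualVariation_smul_le (h0 : ∀ x, 0 ≤ φ x) {C : ℝ} (hC : ∀ x, φ x ≤ C) {c : ℝ}
    (hc : 0 ≤ c) : c * dualVariation ℓ φ ≤ dualVariation ℓ (fun x => c * φ x) := by
  rcases hc.eq_or_lt with rfl | hc
  · rw [zero_mul]
    exact dualVariation_nonneg ℓ fun x => by simp
  rw [← le_div_iff₀' hc]
  refine csSup_le ⟨0, zero_mem_dominatedValues ℓ h0⟩ ?_
  rintro _ ⟨ψ, hψ, rfl⟩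
  rw [le_div_iff₀' hc, ← smul_eq_mul, ← map_smul]
  refine le_dualVariation ℓ (C := c * C) (fun x => by gcongr; exact hC x) fun x => ?_
  simp only [BoundedContinuousFunction.coe_smul, smul_eq_mul, abs_mul, abs_of_pos hc]
  gcongr
  exact hψ x

theorem dualVariation_smul (h0 : ∀ x, 0 ≤ φ x) {C : ℝ} (hC : ∀ x, φ x ≤ C) {c : ℝ}
    (hc : 0 ≤ c) : dualVariation ℓ (fun x => c * φ x) = c * dualVariation ℓ φ := by
  refine le_antisymm ?_ (dualVariation_smul_le ℓ h0 hC hc)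
  rcases hc.eq_or_lt with rfl | hc
  · have := dualVariation_le ℓ (φ := fun x => 0 * φ x) le_rfl (by simp) (by simp)
    simpa using this
  -- The opposite inequality is the one already known, applied to c φ with the factor c⁻¹.
  have := dualVariation_smul_le ℓ (φ := fun x => c * φ x) (C := c * C)
    (fun x => mul_nonneg hc.le (h0 x)) (fun x => by gcongr; exact hC x) (inv_nonneg.2 hc.le)
  rw [inv_mul_le_iff₀ hc] at this
  simpa [← mul_assoc, inv_mul_cancel₀ hc.ne'] using this

theorem exists_bound_nnreal (φ : C_c(E, ℝ≥0)) : ∃ C : ℝ, ∀ x, (φ x : ℝ) ≤ C := by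
  have h1 : HasCompactSupport fun x => (φ x : ℝ) := φ.hasCompactSupport.comp_left rfl
  obtain ⟨C, hC⟩ := h1.exists_bound_of_continuous (by fun_prop)
  exact ⟨C, fun x => (le_abs_self _).trans (hC x)⟩

/-- The variation of `ℓ` as a positive functional on `C_c`. -/
def variationFunctional : C_c(E, ℝ≥0) →ₗ[ℝ≥0] ℝ≥0 where
  toFun φ := ⟨dualVariation ℓ fun x => φ x, dualVariation_nonneg ℓ fun x => (φ x).2⟩
  map_add' φ₁ φ₂ := by
    obtain ⟨C₁, h1⟩ := exists_bound_nnreal φ₁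
    obtain ⟨C₂, h2⟩ := exists_bound_nnreal φ₂
    apply NNReal.eq
    exact dualVariation_add ℓ (by fun_prop) (fun x => (φ₁ x).2) h1 (fun x => (φ₂ x).2) h2
  map_smul' c φ := by
    obtain ⟨C, h⟩ := exists_bound_nnreal φ
    apply NNReal.eq
    exact dualVariation_smul ℓ (fun x => (φ x).2) h c.2

variable [T2Space E] [LocallyCompactSpace E] [SigmaCompactSpace E] [MeasurableSpace E]
  [BorelSpace E]

/-- By inner regularity the total mass is a supremum over compact sets, each of which is tested with
a cut-off function between 0 and 1; this bounds the mass by ‖ℓ‖. -/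
theorem isFiniteMeasure_rieszMeasure_variation :
    IsFiniteMeasure (NNRealRMK.rieszMeasure (variationFunctional ℓ)) := by
  set M := NNRealRMK.rieszMeasure (variationFunctional ℓ)
  constructor
  rw [isOpen_univ.measure_eq_iSup_isCompact]
  refine lt_of_le_of_lt (b := ENNReal.ofReal ‖ℓ‖) ?_ ENNReal.ofReal_lt_top
  refine iSup₂_le fun K _ => iSup_le fun hK => ?_
  obtain ⟨f, hf1, -, hfc, hf⟩ := exists_continuous_one_zero_of_isCompact hK isClosed_empty
    (disjoint_empty K)
  have hfc' : HasCompactSupport fun x => (f x).toNNReal :=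
    HasCompactSupport.comp_left (g := Real.toNNReal) hfc (by simp)
  set φ : C_c(E, ℝ≥0) := ⟨⟨fun x => (f x).toNNReal, by fun_prop⟩, hfc'⟩
  have h1 : M K ≤ ∫⁻ x, φ x ∂M := by
    rw [← setLIntegral_one]
    refine (setLIntegral_mono' hK.measurableSet (g := fun x => (φ x : ℝ≥0∞)) fun x hx => ?_).trans
      (setLIntegral_le_lintegral _ _)
    have : φ x = 1 := by
      change (f x).toNNReal = 1
      rw [hf1 hx]; simp
    rw [this]; simp
  refine h1.trans ?_
  rw [NNRealRMK.lintegral_rieszMeasure, ENNReal.coe_le_iff]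
  intro p hp
  rw [← NNReal.coe_le_coe]
  have h2 : (variationFunctional ℓ φ : ℝ) ≤ ‖ℓ‖ * 1 := by
    refine dualVariation_le ℓ zero_le_one (fun x => (φ x).2) fun x => ?_
    change ((f x).toNNReal : ℝ) ≤ 1
    rw [Real.coe_toNNReal _ (hf x).1]
    exact (hf x).2
  rw [mul_one] at h2
  have h3 : ‖ℓ‖ = p := by
    have := congrArg ENNReal.toReal hp
    exact (ENNReal.toReal_ofReal (norm_nonneg ℓ)).symm.trans this
  exact h2.trans h3.le

/-- Riesz representation of a bounded functional by a finite measure with a density. -/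
theorem exists_measure_density_of_dual :
    ∃ (τ : Measure E) (_ : IsFiniteMeasure τ) (s : E → ℝ), Integrable s τ ∧
      ∀ ψ : E →ᵇ ℝ, HasCompactSupport ψ → ℓ ψ = ∫ x, ψ x * s x ∂τ := by
  set M := NNRealRMK.rieszMeasure (variationFunctional ℓ)
  have hM : IsFiniteMeasure M := isFiniteMeasure_rieszMeasure_variation ℓ
  let V : Submodule ℝ (E →ᵇ ℝ) :=
    { carrier := {ψ | HasCompactSupport ψ}
      add_mem' := fun {a b} ha hb => HasCompactSupport.add ha hb
      zero_mem' := HasCompactSupport.zero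
      smul_mem' := fun c a ha => HasCompactSupport.smul_left (f := fun _ => c) ha }
  let ev : V →ₗ[ℝ] E → ℝ :=
    { toFun := fun v => v.1
      map_add' := fun _ _ => rfl
      map_smul' := fun _ _ => rfl }
  obtain ⟨g, -, hg, h⟩ := exists_density_of_le_integral_abs (V := V) M ev
    (fun v => v.1.continuous.memLp_of_hasCompactSupport v.2)
    (ℓ.toLinearMap.comp V.subtype) 1 zero_le_one (by
      rintro ⟨ψ, hψ⟩
      have hψ' : HasCompactSupport fun x => (⟨|ψ x|, abs_nonneg _⟩ : ℝ≥0) :=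
        HasCompactSupport.comp_left (g := fun r : ℝ => (⟨|r|, abs_nonneg r⟩ : ℝ≥0)) hψ
          (by ext; simp)
      set φ : C_c(E, ℝ≥0) := ⟨⟨fun x => ⟨|ψ x|, abs_nonneg _⟩, by fun_prop⟩, hψ'⟩
      have h1 : ∫ x, |ψ x| ∂M = variationFunctional ℓ φ :=
        NNRealRMK.integral_rieszMeasure (variationFunctional ℓ) φ
      obtain ⟨C, hC⟩ := exists_bound_nnreal φ
      change |ℓ ψ| ≤ 1 * ∫ x, |ψ x| ∂M
      rw [one_mul, h1]
      -- Both ψ and -ψ are dominated by |ψ|, so ℓ is bounded by the L¹ norm of its variation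
      -- measure.
      refine abs_le'.2 ⟨le_dualVariation ℓ hC fun x => le_rfl, ?_⟩
      rw [← map_neg]
      exact le_dualVariation ℓ hC fun x => (abs_neg (ψ x)).le)
  exact ⟨M, hM, g, hg.integrable one_le_two, fun ψ hψ => h ⟨ψ, hψ⟩⟩

end Riesz

variable {n : ℕ}

open scoped Convolution
open ContinuousLinearMap (lsmul)

/-! ### Mollification. -/

section Mollifier

/-- The rescaled mollifier `ρ_δ`. -/
def scaled (ρ : Euc n → ℝ) (δ : ℝ) (x : Euc n) : ℝ := (δ ^ n)⁻¹ * ρ (δ⁻¹ • x)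

variable {ρ : Euc n → ℝ} {δ : ℝ}

theorem contDiff_scaled (hρ : IsStdMollifier ρ) (δ : ℝ) : ContDiff ℝ ∞ (scaled ρ δ) :=
  contDiff_const.mul (hρ.1.comp (contDiff_const_smul _))

theorem scaled_nonneg (hρ : IsStdMollifier ρ) (hδ : 0 < δ) (x : Euc n) : 0 ≤ scaled ρ δ x :=
  mul_nonneg (by positivity) (hρ.2.1 _)

theorem scaled_eq_zero (hρ : IsStdMollifier ρ) (hδ : 0 < δ) {x : Euc n} (hx : δ < ‖x‖) :
    scaled ρ δ x = 0 := by
  have : δ⁻¹ • x ∉ tsupport ρ := fun h => by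
    have h1 := hρ.2.2.1 h
    rw [mem_closedBall_zero_iff, norm_smul, norm_inv, Real.norm_of_nonneg hδ.le,
      inv_mul_le_iff₀ hδ, mul_one] at h1
    exact absurd h1 (not_le.2 hx)
  rw [scaled, image_eq_zero_of_notMem_tsupport this, mul_zero]

theorem tsupport_scaled (hρ : IsStdMollifier ρ) (hδ : 0 < δ) :
    tsupport (scaled ρ δ) ⊆ Metric.closedBall 0 δ := by
  refine closure_minimal (fun x hx => ?_) Metric.isClosed_closedBall
  rw [mem_closedBall_zero_iff]
  by_contra h
  exact hx (scaled_eq_zero hρ hδ (not_le.1 h))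

theorem hasCompactSupport_scaled (hρ : IsStdMollifier ρ) (hδ : 0 < δ) :
    HasCompactSupport (scaled ρ δ) :=
  HasCompactSupport.of_support_subset_isCompact (isCompact_closedBall 0 δ)
    ((subset_tsupport _).trans (tsupport_scaled hρ hδ))

theorem integral_scaled (hρ : IsStdMollifier ρ) (hδ : 0 < δ) : ∫ x, scaled ρ δ x = 1 := by
  simp only [scaled]
  rw [integral_const_mul, Measure.integral_comp_inv_smul_of_nonneg _ _ hδ.le, hρ.2.2.2,
    finrank_euclideanSpace_fin]
  simp [(pow_pos hδ n).ne']

theorem integrable_scaled (hρ : IsStdMollifier ρ) (hδ : 0 < δ) : Integrable (scaled ρ δ) :=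
  (contDiff_scaled hρ δ).continuous.integrable_of_hasCompactSupport (hasCompactSupport_scaled hρ hδ)

theorem exists_isStdMollifier (n : ℕ) : ∃ ρ : Euc n → ℝ, IsStdMollifier ρ := by
  let b : ContDiffBump (0 : Euc n) := ⟨1 / 2, 1, by norm_num, by norm_num⟩
  refine ⟨b.normed volume, b.contDiff_normed, b.nonneg_normed, ?_, b.integral_normed⟩
  rw [b.tsupport_normed_eq]

theorem mollify_eq_convolution (Ω : Set (Euc n)) (hΩ : MeasurableSet Ω) (ρ : Euc n → ℝ) (δ : ℝ)
    (φ : Euc n → ℝ) :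
    mollify Ω ρ δ φ = (scaled ρ δ ⋆[lsmul ℝ ℝ, volume] Ω.indicator φ) := by
  ext x
  rw [convolution_lsmul_swap, mollify, ← integral_indicator hΩ]
  refine integral_congr_ae (ae_of_all _ fun y => ?_)
  by_cases hy : y ∈ Ω <;> simp [hy, scaled]

theorem contDiff_mollify {Ω : Set (Euc n)} (hΩ : MeasurableSet Ω) (hρ : IsStdMollifier ρ)
    (hδ : 0 < δ) {φ : Euc n → ℝ} (hφ : LocallyIntegrable (Ω.indicator φ)) :
    ContDiff ℝ ∞ (mollify Ω ρ δ φ) := by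
  rw [mollify_eq_convolution Ω hΩ]
  exact (hasCompactSupport_scaled hρ hδ).contDiff_convolution_left _ (contDiff_scaled hρ δ) hφ

theorem dist_mollify_le {Ω : Set (Euc n)} (hΩ : MeasurableSet Ω) (hρ : IsStdMollifier ρ)
    (hδ : 0 < δ) {φ : Euc n → ℝ} (hφ : LocallyIntegrable (Ω.indicator φ)) {x : Euc n} {r ε : ℝ}
    (hr : δ < r) (hε : 0 ≤ ε) (hx : Metric.ball x r ⊆ Ω)
    (h : ∀ y ∈ Metric.ball x r, dist (φ y) (φ x) ≤ ε) : dist (mollify Ω ρ δ φ x) (φ x) ≤ ε := by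
  rw [mollify_eq_convolution Ω hΩ]
  refine dist_convolution_le (R := r) hε (fun y hy => ?_) (scaled_nonneg hρ hδ)
    (integral_scaled hρ hδ) hφ.aestronglyMeasurable fun y hy => ?_
  · have := tsupport_scaled hρ hδ (subset_tsupport _ hy)
    rw [mem_closedBall_zero_iff] at this
    rw [mem_ball_zero_iff]
    linarith
  · rw [indicator_of_mem (hx hy)]
    exact h y hy

theorem tendstoUniformlyOn_mollify {Ω : Set (Euc n)} (hΩ : IsOpen Ω) (hρ : IsStdMollifier ρ)
    {φ : Euc n → ℝ} (hφ : LocallyIntegrable (Ω.indicator φ)) (hc : ContinuousOn φ Ω)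
    {K : Set (Euc n)} (hK : IsCompact K) (hKΩ : K ⊆ Ω) :
    TendstoUniformlyOn (fun δ => mollify Ω ρ δ φ) φ (𝓝[>] 0) K := by
  obtain ⟨r, hr, hrΩ⟩ := hK.exists_cthickening_subset_open hΩ hKΩ
  have hK' : IsCompact (Metric.cthickening r K) := hK.cthickening
  have huc := hK'.uniformContinuousOn_of_continuous (hc.mono hrΩ)
  rw [Metric.tendstoUniformlyOn_iff]
  intro ε hε
  rw [Metric.uniformContinuousOn_iff] at huc
  obtain ⟨η, hη, h⟩ := huc (ε / 2) (half_pos hε)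
  have hr' : 0 < min r η := lt_min hr hη
  filter_upwards [Ioo_mem_nhdsGT hr'] with δ hδ x hx
  have hb : Metric.ball x (min r η) ⊆ Metric.cthickening r K := fun y hy => by
    refine Metric.mem_cthickening_of_dist_le y x r K hx ?_
    exact (Metric.mem_ball.1 hy).le.trans (min_le_left _ _)
  rw [dist_comm]
  refine lt_of_le_of_lt (dist_mollify_le hΩ.measurableSet hρ hδ.1 hφ hδ.2 (half_pos hε).le
    (hb.trans hrΩ) fun y hy => ?_) (half_lt_self hε)
  exact (h y (hb hy) x (Metric.self_subset_cthickening K hx)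
    ((Metric.mem_ball.1 hy).trans_le (min_le_right _ _))).le

theorem norm_gradient (v : Euc n → ℝ) (x : Euc n) : ‖gradient v x‖ = ‖fderiv ℝ v x‖ :=
  LinearIsometryEquiv.norm_map _ _

/-- The identification of the dual space with `ℝⁿ`, as a linear isometry. -/
def dualIsometry (n : ℕ) : StrongDual ℝ (Euc n) →ₗᵢ[ℝ] Euc n where
  toFun := (InnerProductSpace.toDual ℝ (Euc n)).symm
  map_add' := map_add _
  map_smul' c a := by simp
  norm_map' := LinearIsometryEquiv.norm_map _

theorem gradient_mollify {Ω : Set (Euc n)} (hΩ : MeasurableSet Ω) (hρ : IsStdMollifier ρ)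
    (hδ : 0 < δ) {φ : Euc n → ℝ} (hφ : LocallyIntegrable (Ω.indicator φ)) (x : Euc n) :
    gradient (mollify Ω ρ δ φ) x = ∫ y in Ω, φ y • gradient (scaled ρ δ) (x - y) := by
  have h1 := (hasCompactSupport_scaled hρ hδ).hasFDerivAt_convolution_left (lsmul ℝ ℝ)
    ((contDiff_scaled hρ δ).of_le (by simp)) hφ x
  rw [← mollify_eq_convolution Ω hΩ] at h1
  change dualIsometry n (fderiv ℝ (mollify Ω ρ δ φ) x) = _
  rw [h1.fderiv, convolution_eq_swap, ← LinearIsometry.integral_comp_comm, ← integral_indicator hΩ]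
  refine integral_congr_ae (ae_of_all _ fun y => ?_)
  have : (ContinuousLinearMap.precompL (Euc n) (lsmul ℝ ℝ) (fderiv ℝ (scaled ρ δ) (x - y)))
      (Ω.indicator φ y) = Ω.indicator φ y • fderiv ℝ (scaled ρ δ) (x - y) := by
    ext e
    simp [mul_comm]
  simp only
  rw [this]
  by_cases hy : y ∈ Ω
  · rw [indicator_of_mem hy, indicator_of_mem hy, map_smul]
    rfl
  · simp [hy]

theorem isCinfc_scaled_sub {Ω : Set (Euc n)} (hρ : IsStdMollifier ρ) (hδ : 0 < δ) {x : Euc n}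
    (hx : Metric.closedBall x δ ⊆ Ω) : IsCinfc Ω fun y => scaled ρ δ (x - y) := by
  have hs : tsupport (fun y => scaled ρ δ (x - y)) ⊆ Metric.closedBall x δ := by
    refine closure_minimal (fun y hy => ?_) Metric.isClosed_closedBall
    have := tsupport_scaled hρ hδ (subset_tsupport _ hy)
    rwa [mem_closedBall_zero_iff, ← dist_eq_norm, dist_comm] at this
  refine ⟨(contDiff_scaled hρ δ).comp (contDiff_const.sub contDiff_id), ?_, hs.trans hx⟩
  exact HasCompactSupport.of_support_subset_isCompact (isCompact_closedBall x δ)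
    ((subset_tsupport _).trans hs)

theorem gradient_comp_const_sub {v : Euc n → ℝ} (hv : Differentiable ℝ v) (x y : Euc n) :
    gradient (fun z => v (x - z)) y = - gradient v (x - y) := by
  have h1 : HasFDerivAt (fun z => v (x - z)) (-fderiv ℝ v (x - y)) y := by
    have := (hv (x - y)).hasFDerivAt.comp y ((hasFDerivAt_id y).const_sub x)
    refine this.congr_fderiv ?_
    ext e
    simp
  rw [gradient, gradient, h1.fderiv, map_neg]

/-- When the closed δ-ball around x lies in Ω, the translated kernel is an admissible test function,
so the gradient of the mollification is an average of the weak gradient. -/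
theorem norm_gradient_mollify_le_of_hasWeakGradient {Ω : Set (Euc n)} (hΩ : MeasurableSet Ω)
    (hρ : IsStdMollifier ρ) (hδ : 0 < δ) {φ : Euc n → ℝ} (hφ : LocallyIntegrable (Ω.indicator φ))
    {g : Euc n → Euc n} (hg : HasWeakGradient Ω φ g) {C : ℝ}
    (hC : ∀ᵐ y ∂volume.restrict Ω, ‖g y‖ ≤ C) {x : Euc n} (hx : Metric.closedBall x δ ⊆ Ω) :
    ‖gradient (mollify Ω ρ δ φ) x‖ ≤ C := by
  have h1 := hg _ (isCinfc_scaled_sub hρ hδ hx)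
  simp only [gradient_comp_const_sub ((contDiff_scaled hρ δ).differentiable (by simp)),
    smul_neg] at h1
  rw [integral_neg, neg_inj] at h1
  rw [gradient_mollify hΩ hρ hδ hφ, h1]
  have hi : Integrable fun y => scaled ρ δ (x - y) := (integrable_scaled hρ hδ).comp_sub_left x
  calc ‖∫ y in Ω, scaled ρ δ (x - y) • g y‖ ≤ ∫ y in Ω, scaled ρ δ (x - y) * C := by
        refine norm_integral_le_of_norm_le (hi.mul_const C).integrableOn ?_
        filter_upwards [hC] with y hy
        rw [norm_smul, Real.norm_of_nonneg (scaled_nonneg hρ hδ _)]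
        exact mul_le_mul_of_nonneg_left hy (scaled_nonneg hρ hδ _)
    _ = ∫ y, scaled ρ δ (x - y) * C := by
        refine setIntegral_eq_integral_of_forall_compl_eq_zero fun y hy => ?_
        rw [scaled_eq_zero hρ hδ, zero_mul]
        by_contra h
        refine hy (hx ?_)
        rw [Metric.mem_closedBall, dist_comm, dist_eq_norm]
        exact not_lt.1 h
    _ = C := by
        rw [integral_mul_const, integral_sub_left_eq_self (scaled ρ δ), integral_scaled hρ hδ,
          one_mul]

theorem lipschitzWith_mollify (hρ : IsStdMollifier ρ) (hδ : 0 < δ) {φ : Euc n → ℝ} {C : NNReal}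
    (hφ : LipschitzWith C φ) : LipschitzWith C (mollify univ ρ δ φ) := by
  have hint : ∀ x, Integrable fun t => scaled ρ δ t * φ (x - t) := fun x =>
    Continuous.integrable_of_hasCompactSupport
      ((contDiff_scaled hρ δ).continuous.mul (hφ.continuous.comp (continuous_const.sub continuous_id)))
      ((hasCompactSupport_scaled hρ hδ).mul_right)
  refine LipschitzWith.of_dist_le_mul fun x y => ?_
  rw [mollify_eq_convolution _ MeasurableSet.univ, indicator_univ, dist_eq_norm]
  simp only [convolution_def, ContinuousLinearMap.lsmul_apply, smul_eq_mul]
  rw [← integral_sub (hint x) (hint y)]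
  calc ‖∫ t, scaled ρ δ t * φ (x - t) - scaled ρ δ t * φ (y - t)‖
      ≤ ∫ t, scaled ρ δ t * (C * dist x y) := by
        refine norm_integral_le_of_norm_le ((integrable_scaled hρ hδ).mul_const _)
          (ae_of_all _ fun t => ?_)
        rw [← mul_sub, norm_mul, Real.norm_of_nonneg (scaled_nonneg hρ hδ _), ← dist_eq_norm]
        refine mul_le_mul_of_nonneg_left ?_ (scaled_nonneg hρ hδ _)
        simpa using hφ.dist_le_mul (x - t) (y - t)
    _ = C * dist x y := by rw [integral_mul_const, integral_scaled hρ hδ, one_mul]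

theorem mollify_eq_mollify_univ (hρ : IsStdMollifier ρ) (hδ : 0 < δ) {Ω : Set (Euc n)}
    (φ : Euc n → ℝ) {x : Euc n} (hx : Metric.closedBall x δ ⊆ Ω) :
    mollify Ω ρ δ φ x = mollify univ ρ δ φ x := by
  rw [mollify, mollify, Measure.restrict_univ]
  refine setIntegral_eq_integral_of_forall_compl_eq_zero fun y hy => ?_
  have : scaled ρ δ (x - y) = 0 := by
    refine scaled_eq_zero hρ hδ ?_
    by_contra h
    refine hy (hx ?_)
    rw [Metric.mem_closedBall, dist_comm, dist_eq_norm]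
    exact not_lt.1 h
  change scaled ρ δ (x - y) * φ y = 0
  rw [this, zero_mul]

end Mollifier

/-! ### Locally uniform approximation with bounded gradients. -/

section Approximation

/-- The family `v` of `C¹` functions approximates `φ` locally uniformly in `Ω` with bounded
gradients. -/
structure IsApprox (Ω : Set (Euc n)) (φ : Euc n → ℝ) (v : ℝ → Euc n → ℝ) : Prop where
  contDiff : ∀ δ, 0 < δ → ContDiff ℝ 1 (v δ)
  tendsto : ∀ K, IsCompact K → K ⊆ Ω → TendstoUniformlyOn v φ (𝓝[>] 0) K
  bound : ∃ C, 0 ≤ C ∧ ∀ K, IsCompact K → K ⊆ Ω →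
    ∀ᶠ δ in 𝓝[>] 0, ∀ x ∈ K, ‖gradient (v δ) x‖ ≤ C

variable {Ω : Set (Euc n)} {ρ : Euc n → ℝ} {φ : Euc n → ℝ}

theorem eventually_closedBall_subset (hΩ : IsOpen Ω) {K : Set (Euc n)} (hK : IsCompact K)
    (hKΩ : K ⊆ Ω) : ∀ᶠ δ in 𝓝[>] (0 : ℝ), ∀ x ∈ K, Metric.closedBall x δ ⊆ Ω := by
  obtain ⟨r, hr, hrΩ⟩ := hK.exists_cthickening_subset_open hΩ hKΩ
  filter_upwards [Ioo_mem_nhdsGT hr] with δ hδ x hx y hy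
  exact hrΩ (Metric.mem_cthickening_of_dist_le y x r K hx
    ((Metric.mem_closedBall.1 hy).trans hδ.2.le))

theorem IsW1inf.locallyIntegrable (hΩ : IsOpen Ω) (h : IsW1inf Ω φ) :
    LocallyIntegrable (Ω.indicator φ) :=
  ((memLp_indicator_iff_restrict hΩ.measurableSet).2 h.2.1).locallyIntegrable le_top

/-- The set where a continuous function exceeds its essential bound is open and null, hence empty.
-/
theorem IsW1inf.exists_bound (hΩ : IsOpen Ω) (h : IsW1inf Ω φ) : ∃ C, ∀ x ∈ Ω, |φ x| ≤ C := by
  set C := (eLpNorm φ ⊤ (volume.restrict Ω)).toReal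
  refine ⟨C, fun x hx => ?_⟩
  have hae : ∀ᵐ y ∂volume.restrict Ω, |φ y| ≤ C := by
    have := ae_le_eLpNormEssSup (f := φ) (μ := volume.restrict Ω)
    filter_upwards [this] with y hy
    have h2 := ENNReal.toReal_mono h.2.1.2.ne hy
    rwa [toReal_enorm, Real.norm_eq_abs] at h2
  by_contra hlt
  have hopen : IsOpen (Ω ∩ {y | C < |φ y|}) :=
    (h.1.abs).isOpen_inter_preimage hΩ isOpen_Ioi
  have hpos := hopen.measure_pos volume ⟨x, hx, not_le.1 hlt⟩
  rw [ae_restrict_iff' hΩ.measurableSet] at hae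
  refine hpos.ne' (measure_mono_null (fun y hy => ?_) hae)
  simp only [mem_compl_iff, mem_ofPred_eq, not_forall, exists_prop, not_le]
  exact ⟨hy.1, hy.2⟩

theorem isApprox_mollify_of_isW1inf (hΩ : IsOpen Ω) (hρ : IsStdMollifier ρ) (h : IsW1inf Ω φ) :
    IsApprox Ω φ fun δ => mollify Ω ρ δ φ := by
  have hli := h.locallyIntegrable hΩ
  refine ⟨fun δ hδ => (contDiff_mollify hΩ.measurableSet hρ hδ hli).of_le (by simp),
    fun K hK hKΩ => tendstoUniformlyOn_mollify hΩ hρ hli h.1 hK hKΩ, ?_⟩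
  obtain ⟨g, hg, hw⟩ := h.2.2
  have hae : ∀ᵐ y ∂volume.restrict Ω, ‖g y‖ ≤ (eLpNorm g ⊤ (volume.restrict Ω)).toReal := by
    have := ae_le_eLpNormEssSup (f := g) (μ := volume.restrict Ω)
    filter_upwards [this] with y hy
    simpa using ENNReal.toReal_mono hg.2.ne hy
  refine ⟨(eLpNorm g ⊤ (volume.restrict Ω)).toReal, ENNReal.toReal_nonneg, fun K hK hKΩ => ?_⟩
  filter_upwards [eventually_closedBall_subset hΩ hK hKΩ, self_mem_nhdsWithin] with δ h1 hδ x hx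
  exact norm_gradient_mollify_le_of_hasWeakGradient hΩ.measurableSet hρ hδ hli hw hae (h1 x hx)

theorem norm_gradient_mollify_univ_le (hρ : IsStdMollifier ρ) {δ : ℝ} (hδ : 0 < δ) {C : NNReal}
    (hφ : LipschitzWith C φ) (x : Euc n) : ‖gradient (mollify univ ρ δ φ) x‖ ≤ C := by
  rw [norm_gradient]
  exact norm_fderiv_le_of_lipschitz ℝ (lipschitzWith_mollify hρ hδ hφ)

/-- Needed for the distance functions, which may be unbounded and so outside W^{1,∞}(Ω). Near a
compact subset of Ω and for small δ, mollifying over Ω agrees with mollifying over the whole space,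
which preserves the Lipschitz constant. -/
theorem isApprox_mollify_of_lipschitzWith (hΩ : IsOpen Ω) (hρ : IsStdMollifier ρ) {C : NNReal}
    (hφ : LipschitzWith C φ) : IsApprox Ω φ fun δ => mollify Ω ρ δ φ := by
  have hli : LocallyIntegrable (Ω.indicator φ) :=
    hφ.continuous.locallyIntegrable.indicator hΩ.measurableSet
  refine ⟨fun δ hδ => (contDiff_mollify hΩ.measurableSet hρ hδ hli).of_le (by simp),
    fun K hK hKΩ => tendstoUniformlyOn_mollify hΩ hρ hli hφ.continuous.continuousOn hK hKΩ,
    C, C.2, fun K hK hKΩ => ?_⟩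
  obtain ⟨r, hr, hrΩ⟩ := hK.exists_cthickening_subset_open hΩ hKΩ
  filter_upwards [eventually_closedBall_subset hΩ hK.cthickening hrΩ, self_mem_nhdsWithin]
    with δ h1 hδ x hx
  have hev : mollify Ω ρ δ φ =ᶠ[𝓝 x] mollify univ ρ δ φ := by
    filter_upwards [Metric.closedBall_mem_nhds x hr] with y hy
    exact mollify_eq_mollify_univ hρ hδ φ (h1 y (Metric.mem_cthickening_of_dist_le y x r K hx hy))
  rw [gradient, hev.fderiv_eq]
  exact norm_gradient_mollify_univ_le hρ hδ hφ x

end Approximation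

/-! ### Calculus of gradients and of test functions. -/

section Gradient

theorem gradient_mul {a b : Euc n → ℝ} {x : Euc n} (ha : DifferentiableAt ℝ a x)
    (hb : DifferentiableAt ℝ b x) :
    gradient (fun y => a y * b y) x = a x • gradient b x + b x • gradient a x := by
  simp only [gradient]
  rw [fderiv_fun_mul ha hb, map_add]
  simp

theorem gradient_comp {h : ℝ → ℝ} {v : Euc n → ℝ} {x : Euc n} {h' : ℝ}
    (hh : HasDerivAt h h' (v x)) (hv : DifferentiableAt ℝ v x) :
    gradient (fun y => h (v y)) x = h' • gradient v x := by
  simp only [gradient]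
  have h1 : HasFDerivAt (fun y => h (v y)) (h' • fderiv ℝ v x) x :=
    hh.comp_hasFDerivAt x hv.hasFDerivAt
  rw [h1.fderiv]
  simp

theorem gradient_add {a b : Euc n → ℝ} {x : Euc n} (ha : DifferentiableAt ℝ a x)
    (hb : DifferentiableAt ℝ b x) :
    gradient (fun y => a y + b y) x = gradient a x + gradient b x := by
  simp only [gradient]
  rw [fderiv_fun_add ha hb, map_add]

theorem gradient_const_mul (c : ℝ) {b : Euc n → ℝ} {x : Euc n} (hb : DifferentiableAt ℝ b x) :
    gradient (fun y => c * b y) x = c • gradient b x := by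
  simp only [gradient]
  rw [fderiv_const_mul hb]
  simp

theorem gradient_eq_zero_of_eventually_const {b : Euc n → ℝ} {x : Euc n} {c : ℝ}
    (h : b =ᶠ[𝓝 x] fun _ => c) : gradient b x = 0 := by
  simp only [gradient]
  rw [h.fderiv_eq]
  simp

theorem gradient_eq_zero_of_notMem_tsupport {b : Euc n → ℝ} {x : Euc n} (h : x ∉ tsupport b) :
    gradient b x = 0 := by
  refine gradient_eq_zero_of_eventually_const (c := 0) ?_
  rw [notMem_tsupport_iff_eventuallyEq] at h
  exact h

theorem continuous_gradient {v : Euc n → ℝ} (hv : ContDiff ℝ 1 v) : Continuous (gradient v) :=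
  (LinearIsometryEquiv.continuous _).comp (hv.continuous_fderiv one_ne_zero)

theorem IsC1c.exists_bound {Ω : Set (Euc n)} {ψ : Euc n → ℝ} (h : IsC1c Ω ψ) :
    ∃ C, ∀ x, |ψ x| ≤ C :=
  h.2.1.exists_bound_of_continuous h.1.continuous

theorem IsC1c.exists_bound_gradient {Ω : Set (Euc n)} {ψ : Euc n → ℝ} (h : IsC1c Ω ψ) :
    ∃ C, ∀ x, ‖gradient ψ x‖ ≤ C := by
  have h1 : HasCompactSupport (gradient ψ) :=
    HasCompactSupport.intro h.2.1 fun x hx => gradient_eq_zero_of_notMem_tsupport hx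
  exact h1.exists_bound_of_continuous (continuous_gradient h.1)

theorem IsCinfc.isC1c {Ω : Set (Euc n)} {ψ : Euc n → ℝ} (h : IsCinfc Ω ψ) : IsC1c Ω ψ :=
  ⟨h.1.of_le (by simp), h.2⟩

theorem IsC1c.isCc {Ω : Set (Euc n)} {ψ : Euc n → ℝ} (h : IsC1c Ω ψ) : IsCc Ω ψ :=
  ⟨h.1.continuous, h.2⟩

theorem IsC1c.mul {Ω : Set (Euc n)} {ψ v : Euc n → ℝ} (h : IsC1c Ω ψ) (hv : ContDiff ℝ 1 v) :
    IsC1c Ω fun x => ψ x * v x :=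
  ⟨h.1.mul hv, h.2.1.mul_right, (tsupport_mul_subset_left).trans h.2.2⟩

theorem IsC1c.add {Ω : Set (Euc n)} {ψ v : Euc n → ℝ} (h : IsC1c Ω ψ) (hv : IsC1c Ω v) :
    IsC1c Ω fun x => ψ x + v x :=
  ⟨h.1.add hv.1, h.2.1.add hv.2.1, (tsupport_add ψ v).trans (union_subset h.2.2 hv.2.2)⟩

theorem IsC1c.const_mul {Ω : Set (Euc n)} {ψ : Euc n → ℝ} (h : IsC1c Ω ψ) (c : ℝ) :
    IsC1c Ω fun x => c * ψ x :=
  ⟨contDiff_const.mul h.1, h.2.1.mul_left, (tsupport_mul_subset_right).trans h.2.2⟩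

theorem continuous_mul_of_tsupport_subset {Ω : Set (Euc n)} (hΩ : IsOpen Ω) {η φ : Euc n → ℝ}
    (hη : Continuous η) (hs : tsupport η ⊆ Ω) (hφ : ContinuousOn φ Ω) :
    Continuous fun x => η x * φ x := by
  rw [continuous_iff_continuousAt]
  intro x
  by_cases hx : x ∈ tsupport η
  · exact hη.continuousAt.mul (hφ.continuousAt (hΩ.mem_nhds (hs hx)))
  · rw [notMem_tsupport_iff_eventuallyEq] at hx
    have : (fun x => η x * φ x) =ᶠ[𝓝 x] fun _ => 0 := by
      filter_upwards [hx] with y hy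
      simp [hy]
    exact continuousAt_const.congr this.symm

/-- Compactly supported continuous functions are uniform limits of smooth ones with supports
in a fixed compact set. -/
theorem IsCc.exists_approx {Ω : Set (Euc n)} (hΩ : IsOpen Ω) {ψ : Euc n → ℝ} (h : IsCc Ω ψ) :
    ∃ K, IsCompact K ∧ K ⊆ Ω ∧ tsupport ψ ⊆ K ∧ ∀ ε, 0 < ε → ∃ η, IsCinfc Ω η ∧ tsupport η ⊆ K ∧
      ∀ x, |η x - ψ x| ≤ ε := by
  obtain ⟨r, hr, hrΩ⟩ := h.2.1.isCompact.exists_cthickening_subset_open hΩ h.2.2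
  have hK : IsCompact (Metric.cthickening r (tsupport ψ)) := h.2.1.isCompact.cthickening
  refine ⟨_, hK, hrΩ, Metric.self_subset_cthickening _, fun ε hε => ?_⟩
  have huc := h.2.1.uniformContinuous_of_continuous h.1
  rw [Metric.uniformContinuous_iff] at huc
  obtain ⟨θ, hθ, huc⟩ := huc ε hε
  obtain ⟨ρ, hρ⟩ := exists_isStdMollifier n
  set δ := min r θ / 2 with hδ'
  have hm : 0 < min r θ := lt_min hr hθ
  have hδ : 0 < δ := half_pos hm
  have hli : LocallyIntegrable ((univ : Set (Euc n)).indicator ψ) := by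
    rw [indicator_univ]
    exact h.1.locallyIntegrable
  have hsupp : tsupport (mollify univ ρ δ ψ) ⊆ Metric.cthickening r (tsupport ψ) := by
    refine closure_minimal (fun x hx => ?_) Metric.isClosed_cthickening
    by_contra hxK
    refine hx ?_
    rw [mollify, Measure.restrict_univ]
    refine integral_eq_zero_of_ae (ae_of_all _ fun y => ?_)
    change scaled ρ δ (x - y) * ψ y = 0
    by_cases hy : y ∈ tsupport ψ
    · rw [scaled_eq_zero hρ hδ, zero_mul]
      by_contra hlt
      refine hxK (Metric.mem_cthickening_of_dist_le x y r _ hy ?_)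
      rw [dist_eq_norm]
      have := min_le_left r θ
      linarith [not_lt.1 hlt]
    · rw [image_eq_zero_of_notMem_tsupport hy, mul_zero]
  refine ⟨mollify univ ρ δ ψ, ⟨contDiff_mollify MeasurableSet.univ hρ hδ hli,
    hK.of_isClosed_subset (isClosed_tsupport _) hsupp, hsupp.trans hrΩ⟩, hsupp, fun x => ?_⟩
  rw [← Real.dist_eq]
  refine dist_mollify_le (r := min r θ) MeasurableSet.univ hρ hδ hli (half_lt_self hm) hε.le
    (subset_univ _) fun y hy => ?_
  exact (huc ((Metric.mem_ball.1 hy).trans_le (min_le_right _ _))).le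

end Gradient

/-- The measures `f m` and `s m` on the open set `Ω` are a vector field and its divergence. -/
structure DivField (Ω : Set (Euc n)) (m : Measure (Euc n)) (f : Euc n → Euc n)
    (s : Euc n → ℝ) : Prop where
  isOpen : IsOpen Ω
  null : m Ωᶜ = 0
  meas_f : Measurable f
  f_le : ∀ x, ‖f x‖ ≤ 1
  meas_s : Measurable s
  s_le : ∀ x, |s x| ≤ 1
  div : ∀ ψ, IsC1c Ω ψ → ∫ x, ψ x * s x ∂m = - ∫ x, inner ℝ (gradient ψ x) (f x) ∂m

/-- The measure `g m` is the derivative of `φ` along the field `f m`, in the sense of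
distributions. -/
def HasDerivAlong (Ω : Set (Euc n)) (m : Measure (Euc n)) (f : Euc n → Euc n) (s : Euc n → ℝ)
    (φ g : Euc n → ℝ) : Prop :=
  Integrable g m ∧ ∀ ψ, IsC1c Ω ψ → ∫ x, ψ x * g x ∂m =
    - ∫ x, ψ x * φ x * s x ∂m - ∫ x, φ x * inner ℝ (gradient ψ x) (f x) ∂m

/-! ### Derivatives along a divergence-measure field. -/

section Along

variable {Ω : Set (Euc n)} {m : Measure (Euc n)} {f : Euc n → Euc n} {s : Euc n → ℝ}

theorem DivField.ae_mem (D : DivField Ω m f s) : ∀ᵐ x ∂m, x ∈ Ω := by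
  rw [ae_iff]
  exact D.null

theorem DivField.restrict_eq (D : DivField Ω m f s) : m.restrict Ω = m :=
  Measure.restrict_eq_self_of_ae_mem D.ae_mem

theorem DivField.aestronglyMeasurable (D : DivField Ω m f s) {φ : Euc n → ℝ}
    (hφ : ContinuousOn φ Ω) : AEStronglyMeasurable φ m := by
  rw [← D.restrict_eq]
  exact hφ.aestronglyMeasurable D.isOpen.measurableSet

theorem DivField.aestronglyMeasurable_inner (D : DivField Ω m f s) {X : Euc n → Euc n}
    (hX : Continuous X) : AEStronglyMeasurable (fun x => inner ℝ (X x) (f x)) m :=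
  hX.aestronglyMeasurable.inner D.meas_f.aestronglyMeasurable

theorem DivField.abs_inner_le (D : DivField Ω m f s) (X : Euc n) (x : Euc n) :
    |inner ℝ X (f x)| ≤ ‖X‖ := by
  refine (abs_real_inner_le_norm _ _).trans ?_
  have := mul_le_mul_of_nonneg_left (D.f_le x) (norm_nonneg X)
  simpa using this

variable [IsFiniteMeasure m]

theorem integrable_mul_of_support {K : Set (Euc n)} {η φ : Euc n → ℝ} {C M : ℝ}
    (hη : AEStronglyMeasurable η m) (hC : ∀ x, |η x| ≤ C) (hηK : ∀ x, x ∉ K → η x = 0)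
    (hφ : AEStronglyMeasurable φ m) (hM : ∀ x ∈ K, |φ x| ≤ M) :
    Integrable (fun x => η x * φ x) m := by
  refine Integrable.of_bound (hη.mul hφ) (C * max M 0) (ae_of_all _ fun x => ?_)
  have hC0 : 0 ≤ C := (abs_nonneg _).trans (hC x)
  rw [Real.norm_eq_abs, abs_mul]
  by_cases hx : x ∈ K
  · exact mul_le_mul (hC x) ((hM x hx).trans (le_max_left _ _)) (abs_nonneg _) hC0
  · rw [hηK x hx]
    simp only [abs_zero, zero_mul]
    positivity

theorem DivField.integrable_mul (D : DivField Ω m f s) {K : Set (Euc n)} (hK : IsCompact K)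
    (hKΩ : K ⊆ Ω) {η φ : Euc n → ℝ} {C : ℝ}
    (hη : AEStronglyMeasurable η m) (hC : ∀ x, |η x| ≤ C) (hηK : ∀ x, x ∉ K → η x = 0)
    (hφ : ContinuousOn φ Ω) : Integrable (fun x => η x * φ x) m := by
  obtain ⟨M, hM⟩ := hK.exists_bound_of_continuousOn (hφ.mono hKΩ)
  exact integrable_mul_of_support hη hC hηK (D.aestronglyMeasurable hφ) hM

theorem tendsto_integral_mul_of_uniform {K : Set (Euc n)} {η φ : Euc n → ℝ} {v : ℝ → Euc n → ℝ}
    {C M : ℝ} {l : Filter ℝ} [l.IsCountablyGenerated]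
    (hη : AEStronglyMeasurable η m) (hC : ∀ x, |η x| ≤ C) (hηK : ∀ x, x ∉ K → η x = 0)
    (hM : ∀ x ∈ K, |φ x| ≤ M) (hv : ∀ᶠ δ in l, AEStronglyMeasurable (v δ) m)
    (h : TendstoUniformlyOn v φ l K) :
    Tendsto (fun δ => ∫ x, η x * v δ x ∂m) l (𝓝 (∫ x, η x * φ x ∂m)) := by
  refine tendsto_integral_filter_of_dominated_convergence (fun _ => C * max (M + 1) 0) ?_ ?_
    (integrable_const _) (ae_of_all _ fun x => ?_)
  · filter_upwards [hv] with δ hδ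
    exact hη.mul hδ
  · have := Metric.tendstoUniformlyOn_iff.1 h 1 one_pos
    filter_upwards [this] with δ hδ
    refine ae_of_all _ fun x => ?_
    have hC0 : 0 ≤ C := (abs_nonneg _).trans (hC x)
    rw [Real.norm_eq_abs, abs_mul]
    by_cases hx : x ∈ K
    · refine mul_le_mul (hC x) (le_trans ?_ (le_max_left _ _)) (abs_nonneg _) hC0
      have h1 := hδ x hx
      rw [dist_comm, Real.dist_eq] at h1
      have h2 := abs_sub_abs_le_abs_sub (v δ x) (φ x)
      linarith [hM x hx]
    · rw [hηK x hx]
      simp only [abs_zero, zero_mul]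
      positivity
  · by_cases hx : x ∈ K
    · exact (h.tendsto_at hx).const_mul _
    · simp only [hηK x hx, zero_mul]
      exact tendsto_const_nhds

/-- The divergence equation is tested with ψ v. Only ψ has to be supported in Ω. -/
theorem DivField.integral_gradient_mul (D : DivField Ω m f s) {ψ v : Euc n → ℝ} (hψ : IsC1c Ω ψ)
    (hv : ContDiff ℝ 1 v) : ∫ x, ψ x * inner ℝ (gradient v x) (f x) ∂m =
      - ∫ x, (ψ x * s x) * v x ∂m - ∫ x, inner ℝ (gradient ψ x) (f x) * v x ∂m := by
  have h1 := D.div _ (hψ.mul hv)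
  obtain ⟨C, hC⟩ := hψ.exists_bound
  obtain ⟨C', hC'⟩ := hψ.exists_bound_gradient
  have hi1 : Integrable (fun x => ψ x * inner ℝ (gradient v x) (f x)) m := by
    obtain ⟨M, hM⟩ := hψ.2.1.isCompact.exists_bound_of_continuousOn
      (continuous_gradient hv).continuousOn
    exact integrable_mul_of_support hψ.1.continuous.aestronglyMeasurable hC
      (fun x => image_eq_zero_of_notMem_tsupport) (D.aestronglyMeasurable_inner
        (continuous_gradient hv)) fun x hx => (D.abs_inner_le _ x).trans (hM x hx)
  have hi2 : Integrable (fun x => inner ℝ (gradient ψ x) (f x) * v x) m := by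
    refine D.integrable_mul hψ.2.1.isCompact hψ.2.2 (D.aestronglyMeasurable_inner
        (continuous_gradient hψ.1)) (fun x => (D.abs_inner_le _ x).trans (hC' x)) ?_
        hv.continuous.continuousOn
    intro x hx
    rw [gradient_eq_zero_of_notMem_tsupport hx, inner_zero_left]
  have h2 : ∀ x, inner ℝ (gradient (fun y => ψ y * v y) x) (f x) =
      ψ x * inner ℝ (gradient v x) (f x) + inner ℝ (gradient ψ x) (f x) * v x := fun x => by
    rw [gradient_mul ((hψ.1.differentiable one_ne_zero) x) ((hv.differentiable one_ne_zero) x),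
      inner_add_left, real_inner_smul_left, real_inner_smul_left, mul_comm (v x)]
  simp only [h2] at h1
  rw [integral_add hi1 hi2] at h1
  have h3 : ∫ x, ψ x * v x * s x ∂m = ∫ x, ψ x * s x * v x ∂m := by
    congr 1; ext x; ring
  rw [h3] at h1
  linarith

/-- Once the derivative has been moved from v onto ψ, uniform convergence of v on the support of ψ
is enough. -/
theorem DivField.tendsto_of_isC1c (D : DivField Ω m f s) {φ : Euc n → ℝ} (hφ : ContinuousOn φ Ω)
    {v : ℝ → Euc n → ℝ} (hv : IsApprox Ω φ v) {ψ : Euc n → ℝ} (hψ : IsC1c Ω ψ) :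
    Tendsto (fun δ => ∫ x, ψ x * inner ℝ (gradient (v δ) x) (f x) ∂m) (𝓝[>] 0)
      (𝓝 (- ∫ x, ψ x * φ x * s x ∂m - ∫ x, φ x * inner ℝ (gradient ψ x) (f x) ∂m)) := by
  obtain ⟨C, hC⟩ := hψ.exists_bound
  obtain ⟨C', hC'⟩ := hψ.exists_bound_gradient
  obtain ⟨M, hM⟩ := hψ.2.1.isCompact.exists_bound_of_continuousOn (hφ.mono hψ.2.2)
  have hvm : ∀ᶠ δ in 𝓝[>] 0, AEStronglyMeasurable (v δ) m := by
    filter_upwards [self_mem_nhdsWithin] with δ hδ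
    exact (hv.contDiff δ hδ).continuous.aestronglyMeasurable
  have hu := hv.tendsto _ hψ.2.1.isCompact hψ.2.2
  have h1 := tendsto_integral_mul_of_uniform (m := m) (η := fun x => ψ x * s x) (C := C)
    (hψ.1.continuous.aestronglyMeasurable.mul D.meas_s.aestronglyMeasurable)
    (fun x => by
      rw [abs_mul]
      exact (mul_le_mul (hC x) (D.s_le x) (abs_nonneg _) ((abs_nonneg _).trans (hC x))).trans_eq
        (mul_one C))
    (fun x hx => by rw [image_eq_zero_of_notMem_tsupport hx, zero_mul]) hM hvm hu
  have h2 := tendsto_integral_mul_of_uniform (m := m)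
    (η := fun x => inner ℝ (gradient ψ x) (f x)) (C := C')
    (D.aestronglyMeasurable_inner (continuous_gradient hψ.1))
    (fun x => (D.abs_inner_le _ x).trans (hC' x))
    (fun x hx => by rw [gradient_eq_zero_of_notMem_tsupport hx, inner_zero_left]) hM hvm hu
  have h3 := h1.neg.sub h2
  have e1 : ∫ x, ψ x * φ x * s x ∂m = ∫ x, ψ x * s x * φ x ∂m := by
    congr 1; ext x; ring
  have e2 : ∫ x, φ x * inner ℝ (gradient ψ x) (f x) ∂m =
      ∫ x, inner ℝ (gradient ψ x) (f x) * φ x ∂m := by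
    congr 1; ext x; ring
  rw [e1, e2]
  refine h3.congr' ?_
  filter_upwards [self_mem_nhdsWithin] with δ hδ
  rw [D.integral_gradient_mul hψ (hv.contDiff δ hδ)]

/-- Weak convergence of the derivatives of approximations along the field. -/
theorem DivField.tendsto_of_isCc (D : DivField Ω m f s) {φ g : Euc n → ℝ} (hφ : ContinuousOn φ Ω)
    (hg : HasDerivAlong Ω m f s φ g) {v : ℝ → Euc n → ℝ} (hv : IsApprox Ω φ v) {ψ : Euc n → ℝ}
    (hψ : IsCc Ω ψ) :
    Tendsto (fun δ => ∫ x, ψ x * inner ℝ (gradient (v δ) x) (f x) ∂m) (𝓝[>] 0)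
      (𝓝 (∫ x, ψ x * g x ∂m)) := by
  obtain ⟨K, hK, hKΩ, hψK, happ⟩ := hψ.exists_approx D.isOpen
  obtain ⟨C, hC0, hC⟩ := hv.bound
  rw [Metric.tendsto_nhds]
  intro ε hε
  -- Replacing ψ by a smooth η with |η - ψ| ≤ κ costs at most κ C m(ℝⁿ) on the approximating side
  -- and κ ∫ |g| dm in the limit, together κ A. With κ = ε / (2 (A + 1)) this stays below ε / 2.
  set A : ℝ := C * m.real univ + ∫ x, |g x| ∂m with hA
  have hA0 : 0 ≤ A := by positivity
  obtain ⟨η, hη, hηK, hd⟩ := happ (ε / (2 * (A + 1))) (by positivity)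
  have hlim := D.tendsto_of_isC1c hφ hv hη.isC1c
  rw [← hg.2 η hη.isC1c, Metric.tendsto_nhds] at hlim
  filter_upwards [hlim (ε / 2) (half_pos hε), hC K hK hKΩ, self_mem_nhdsWithin] with δ h1 h2 hδ
  set κ := ε / (2 * (A + 1)) with hκ
  have hκ0 : 0 < κ := by positivity
  set w : Euc n → ℝ := fun x => inner ℝ (gradient (v δ) x) (f x)
  have hwm : AEStronglyMeasurable w m :=
    D.aestronglyMeasurable_inner (continuous_gradient (hv.contDiff δ hδ))
  have hwK : ∀ x ∈ K, |w x| ≤ C := fun x hx => (D.abs_inner_le _ x).trans (h2 x hx)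
  obtain ⟨B, hB⟩ := hη.isC1c.exists_bound
  obtain ⟨B', hB'⟩ := hψ.2.1.exists_bound_of_continuous hψ.1
  have hηz : ∀ x, x ∉ K → η x = 0 := fun x hx =>
    image_eq_zero_of_notMem_tsupport fun h => hx (hηK h)
  have hψz : ∀ x, x ∉ K → ψ x = 0 := fun x hx =>
    image_eq_zero_of_notMem_tsupport fun h => hx (hψK h)
  have i1 : Integrable (fun x => η x * w x) m := integrable_mul_of_support
    hη.1.continuous.aestronglyMeasurable hB hηz hwm hwK
  have i2 : Integrable (fun x => ψ x * w x) m := integrable_mul_of_support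
    hψ.1.aestronglyMeasurable hB' hψz hwm hwK
  have i3 : Integrable (fun x => η x * g x) m :=
    hg.1.bdd_mul hη.1.continuous.aestronglyMeasurable (ae_of_all _ hB)
  have i4 : Integrable (fun x => ψ x * g x) m :=
    hg.1.bdd_mul hψ.1.aestronglyMeasurable (ae_of_all _ hB')
  have d1 : |∫ x, η x * w x ∂m - ∫ x, ψ x * w x ∂m| ≤ κ * (C * m.real univ) := by
    rw [← integral_sub i1 i2, ← Real.norm_eq_abs]
    refine (norm_integral_le_of_norm_le_const (μ := m) (C := κ * C) (ae_of_all _ fun x => ?_)).trans_eq ?_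
    · rw [← sub_mul, norm_mul]
      by_cases hx : x ∈ K
      · exact mul_le_mul (hd x) (hwK x hx) (norm_nonneg _) hκ0.le
      · rw [hηz x hx, hψz x hx, sub_zero, norm_zero, zero_mul]
        positivity
    · ring
  have d2 : |∫ x, η x * g x ∂m - ∫ x, ψ x * g x ∂m| ≤ κ * ∫ x, |g x| ∂m := by
    rw [← integral_sub i3 i4, ← integral_const_mul, ← Real.norm_eq_abs]
    refine norm_integral_le_of_norm_le (hg.1.abs.const_mul κ) (ae_of_all _ fun x => ?_)
    rw [← sub_mul, norm_mul]
    exact mul_le_mul_of_nonneg_right (hd x) (norm_nonneg _)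
  rw [Real.dist_eq] at h1 ⊢
  have hκA : κ * (C * m.real univ) + κ * ∫ x, |g x| ∂m < ε / 2 := by
    rw [← mul_add, ← hA, hκ, div_mul_eq_mul_div, div_lt_div_iff₀ (by positivity) two_pos]
    nlinarith
  have t1 := abs_le.1 d1
  have t2 := abs_le.1 d2
  have t3 := abs_lt.1 h1
  rw [abs_lt]
  constructor <;> linarith [t1.1, t1.2, t2.1, t2.2, t3.1, t3.2]

/-- The space `C¹_c(Ω)`. -/
def c1cSubmodule (Ω : Set (Euc n)) : Submodule ℝ (Euc n → ℝ) where
  carrier := {ψ | IsC1c Ω ψ}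
  add_mem' ha hb := ha.add hb
  zero_mem' := ⟨contDiff_const, HasCompactSupport.zero, by simp⟩
  smul_mem' c _ ha := ha.const_mul c

/-- The defining functional is the limit of ψ ↦ ∫ ψ ∇v_δ · f dm. The uniform gradient bound C passes
to the limit as a bound by C ∫ |ψ| dm, which produces a density. Thus the pairing is absolutely
continuous with respect to m. -/
theorem DivField.exists_hasDerivAlong (D : DivField Ω m f s) {φ : Euc n → ℝ}
    (hφ : ContinuousOn φ Ω) {v : ℝ → Euc n → ℝ} (hv : IsApprox Ω φ v) :
    ∃ g, StronglyMeasurable g ∧ HasDerivAlong Ω m f s φ g := by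
  obtain ⟨C, hC0, hC⟩ := hv.bound
  have hi1 : ∀ ψ, IsC1c Ω ψ → Integrable (fun x => ψ x * φ x * s x) m := fun ψ hψ => by
    obtain ⟨B, hB⟩ := hψ.exists_bound
    exact (D.integrable_mul hψ.2.1.isCompact hψ.2.2 hψ.1.continuous.aestronglyMeasurable hB
      (fun x => image_eq_zero_of_notMem_tsupport) hφ).mul_bdd (c := 1)
      D.meas_s.aestronglyMeasurable (ae_of_all _ D.s_le)
  have hi2 : ∀ ψ, IsC1c Ω ψ → Integrable (fun x => φ x * inner ℝ (gradient ψ x) (f x)) m :=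
    fun ψ hψ => by
    obtain ⟨B, hB⟩ := hψ.exists_bound_gradient
    simp_rw [mul_comm (φ _)]
    exact D.integrable_mul hψ.2.1.isCompact hψ.2.2
      (D.aestronglyMeasurable_inner (continuous_gradient hψ.1))
      (fun x => (D.abs_inner_le _ x).trans (hB x))
      (fun x hx => by rw [gradient_eq_zero_of_notMem_tsupport hx, inner_zero_left]) hφ
  let ev : c1cSubmodule Ω →ₗ[ℝ] Euc n → ℝ := (c1cSubmodule Ω).subtype
  let L : c1cSubmodule Ω →ₗ[ℝ] ℝ :=
    { toFun := fun ψ => - ∫ x, ψ.1 x * φ x * s x ∂m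
        - ∫ x, φ x * inner ℝ (gradient ψ.1 x) (f x) ∂m
      map_add' := by
        rintro ⟨a, ha⟩ ⟨b, hb⟩
        have e1 : ∀ x, (a + b) x * φ x * s x = a x * φ x * s x + b x * φ x * s x := fun x => by
          simp only [Pi.add_apply]; ring
        have e2 : ∀ x, φ x * inner ℝ (gradient (a + b) x) (f x) =
            φ x * inner ℝ (gradient a x) (f x) + φ x * inner ℝ (gradient b x) (f x) := fun x => by
          have := gradient_add ((ha.1.differentiable one_ne_zero) x)
            ((hb.1.differentiable one_ne_zero) x)
          change φ x * inner ℝ (gradient (fun y => a y + b y) x) (f x) = _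
          rw [this, inner_add_left, mul_add]
        simp only [Submodule.coe_add, e1, e2]
        rw [integral_add (hi1 a ha) (hi1 b hb), integral_add (hi2 a ha) (hi2 b hb)]
        ring
      map_smul' := by
        rintro c ⟨a, ha⟩
        have e1 : ∀ x, (c • a) x * φ x * s x = c * (a x * φ x * s x) := fun x => by
          simp only [Pi.smul_apply, smul_eq_mul]; ring
        have e2 : ∀ x, φ x * inner ℝ (gradient (c • a) x) (f x) =
            c * (φ x * inner ℝ (gradient a x) (f x)) := fun x => by
          have := gradient_const_mul c ((ha.1.differentiable one_ne_zero) x)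
          change φ x * inner ℝ (gradient (fun y => c * a y) x) (f x) = _
          rw [this, real_inner_smul_left]
          ring
        simp only [Submodule.coe_smul, e1, e2]
        rw [integral_const_mul, integral_const_mul]
        simp only [RingHom.id_apply, smul_eq_mul]
        ring }
  have hL : ∀ ψ : c1cSubmodule Ω, |L ψ| ≤ C * ∫ x, |ev ψ x| ∂m := by
    rintro ⟨ψ, hψ⟩
    have hlim := (D.tendsto_of_isC1c hφ hv hψ).abs
    refine le_of_tendsto hlim ?_
    filter_upwards [hC _ hψ.2.1.isCompact hψ.2.2] with δ hδ
    rw [← integral_const_mul, ← Real.norm_eq_abs]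
    refine norm_integral_le_of_norm_le (μ := m)
      ((hψ.1.continuous.integrable_of_hasCompactSupport hψ.2.1).abs.const_mul C)
      (ae_of_all _ fun x => ?_)
    change ‖ψ x * _‖ ≤ C * |ψ x|
    rw [norm_mul, mul_comm, Real.norm_eq_abs (ψ x)]
    by_cases hx : x ∈ tsupport ψ
    · exact mul_le_mul_of_nonneg_right ((D.abs_inner_le _ x).trans (hδ x hx)) (abs_nonneg _)
    · simp [image_eq_zero_of_notMem_tsupport hx]
  obtain ⟨g, hgm, hg2, hg⟩ := exists_density_of_le_integral_abs m ev (fun ψ =>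
    ψ.2.1.continuous.memLp_of_hasCompactSupport ψ.2.2.1) L C hC0 hL
  exact ⟨g, hgm, hg2.integrable one_le_two, fun ψ hψ => (hg ⟨ψ, hψ⟩).symm⟩

/-- Leibniz rule for the product with a compactly supported `C¹` function. -/
theorem DivField.hasDerivAlong_mul (D : DivField Ω m f s) {φ g χ : Euc n → ℝ}
    (hφ : ContinuousOn φ Ω) (hg : HasDerivAlong Ω m f s φ g) (hχ : IsC1c Ω χ) :
    HasDerivAlong Ω m f s (fun x => χ x * φ x)
      (fun x => χ x * g x + φ x * inner ℝ (gradient χ x) (f x)) := by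
  obtain ⟨B, hB⟩ := hχ.exists_bound
  obtain ⟨B', hB'⟩ := hχ.exists_bound_gradient
  have i1 : Integrable (fun x => χ x * g x) m :=
    hg.1.bdd_mul hχ.1.continuous.aestronglyMeasurable (ae_of_all _ hB)
  have i2 : Integrable (fun x => φ x * inner ℝ (gradient χ x) (f x)) m := by
    simp_rw [mul_comm (φ _)]
    exact D.integrable_mul hχ.2.1.isCompact hχ.2.2
      (D.aestronglyMeasurable_inner (continuous_gradient hχ.1))
      (fun x => (D.abs_inner_le _ x).trans (hB' x))
      (fun x hx => by rw [gradient_eq_zero_of_notMem_tsupport hx, inner_zero_left]) hφ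
  refine ⟨i1.add i2, fun ψ hψ => ?_⟩
  obtain ⟨A, hA⟩ := hψ.exists_bound
  obtain ⟨A', hA'⟩ := hψ.exists_bound_gradient
  have h1 := hg.2 _ (hχ.mul hψ.1)
  have i3 : Integrable (fun x => χ x * (φ x * inner ℝ (gradient ψ x) (f x))) m := by
    refine Integrable.bdd_mul (c := B) ?_ hχ.1.continuous.aestronglyMeasurable (ae_of_all _ hB)
    simp_rw [mul_comm (φ _)]
    exact D.integrable_mul hψ.2.1.isCompact hψ.2.2
      (D.aestronglyMeasurable_inner (continuous_gradient hψ.1))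
      (fun x => (D.abs_inner_le _ x).trans (hA' x))
      (fun x hx => by rw [gradient_eq_zero_of_notMem_tsupport hx, inner_zero_left]) hφ
  have i4 : Integrable (fun x => ψ x * (φ x * inner ℝ (gradient χ x) (f x))) m :=
    i2.bdd_mul hψ.1.continuous.aestronglyMeasurable (ae_of_all _ hA)
  have i5 : Integrable (fun x => ψ x * (χ x * g x)) m :=
    i1.bdd_mul hψ.1.continuous.aestronglyMeasurable (ae_of_all _ hA)
  have e1 : ∀ x, φ x * inner ℝ (gradient (fun y => χ y * ψ y) x) (f x) =
      χ x * (φ x * inner ℝ (gradient ψ x) (f x)) + ψ x * (φ x * inner ℝ (gradient χ x) (f x)) := by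
    intro x
    rw [gradient_mul ((hχ.1.differentiable one_ne_zero) x) ((hψ.1.differentiable one_ne_zero) x),
      inner_add_left, real_inner_smul_left, real_inner_smul_left]
    ring
  simp only [e1] at h1
  rw [integral_add i3 i4] at h1
  simp only [mul_add]
  rw [integral_add i5 i4]
  have e2 : ∫ x, χ x * ψ x * g x ∂m = ∫ x, ψ x * (χ x * g x) ∂m := by congr 1; ext x; ring
  have e3 : ∫ x, χ x * ψ x * φ x * s x ∂m = ∫ x, ψ x * (χ x * φ x) * s x ∂m := by
    congr 1; ext x; ring
  have e4 : ∫ x, χ x * (φ x * inner ℝ (gradient ψ x) (f x)) ∂m =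
      ∫ x, χ x * φ x * inner ℝ (gradient ψ x) (f x) ∂m := by congr 1; ext x; ring
  rw [e2, e3, e4] at h1
  linarith

theorem DivField.hasDerivAlong_of_isC1c (D : DivField Ω m f s) {φ : Euc n → ℝ} (hφ : IsC1c Ω φ) :
    HasDerivAlong Ω m f s φ fun x => inner ℝ (gradient φ x) (f x) := by
  obtain ⟨B', hB'⟩ := hφ.exists_bound_gradient
  refine ⟨Integrable.of_bound (D.aestronglyMeasurable_inner (continuous_gradient hφ.1)) B'
    (ae_of_all _ fun x => (D.abs_inner_le _ x).trans (hB' x)), fun ψ hψ => ?_⟩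
  rw [D.integral_gradient_mul hψ hφ.1]
  congr 2
  · congr 1; ext x; ring
  · ext x; ring

theorem HasDerivAlong.sub {φ φ' g g' : Euc n → ℝ} (D : DivField Ω m f s)
    (hφ : ContinuousOn φ Ω) (hφ' : ContinuousOn φ' Ω)
    (h : HasDerivAlong Ω m f s φ g) (h' : HasDerivAlong Ω m f s φ' g') :
    HasDerivAlong Ω m f s (fun x => φ x - φ' x) (fun x => g x - g' x) := by
  refine ⟨h.1.sub h'.1, fun ψ hψ => ?_⟩
  obtain ⟨A, hA⟩ := hψ.exists_bound
  obtain ⟨A', hA'⟩ := hψ.exists_bound_gradient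
  have hi1 : ∀ φ, ContinuousOn φ Ω → Integrable (fun x => ψ x * φ x * s x) m := fun φ hφ =>
    (D.integrable_mul hψ.2.1.isCompact hψ.2.2 hψ.1.continuous.aestronglyMeasurable hA
      (fun x => image_eq_zero_of_notMem_tsupport) hφ).mul_bdd (c := 1)
      D.meas_s.aestronglyMeasurable (ae_of_all _ D.s_le)
  have hi2 : ∀ φ, ContinuousOn φ Ω →
      Integrable (fun x => φ x * inner ℝ (gradient ψ x) (f x)) m := fun φ hφ => by
    simp_rw [mul_comm (φ _)]
    exact D.integrable_mul hψ.2.1.isCompact hψ.2.2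
      (D.aestronglyMeasurable_inner (continuous_gradient hψ.1))
      (fun x => (D.abs_inner_le _ x).trans (hA' x))
      (fun x hx => by rw [gradient_eq_zero_of_notMem_tsupport hx, inner_zero_left]) hφ
  have hi3 : ∀ g, Integrable g m → Integrable (fun x => ψ x * g x) m := fun g hg =>
    hg.bdd_mul hψ.1.continuous.aestronglyMeasurable (ae_of_all _ hA)
  simp only [mul_sub, sub_mul]
  rw [integral_sub (hi3 g h.1) (hi3 g' h'.1), integral_sub (hi1 φ hφ) (hi1 φ' hφ'),
    integral_sub (hi2 φ hφ) (hi2 φ' hφ'), h.2 ψ hψ, h'.2 ψ hψ]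
  ring

omit [IsFiniteMeasure m] in
/-- Locality of the derivative along the field. -/
theorem HasDerivAlong.ae_eq {φ φ' g g' : Euc n → ℝ} {U : Set (Euc n)} (hU : IsOpen U)
    (hUΩ : U ⊆ Ω) (h : HasDerivAlong Ω m f s φ g) (h' : HasDerivAlong Ω m f s φ' g')
    (he : EqOn φ φ' U) : ∀ᵐ x ∂m, x ∈ U → g x = g' x := by
  have := hU.ae_eq_zero_of_integral_contDiff_smul_eq_zero (μ := m) (f := fun x => g x - g' x)
    ((h.1.sub h'.1).locallyIntegrable.locallyIntegrableOn U) fun ψ h1 h2 h3 => ?_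
  · filter_upwards [this] with x hx hxU
    exact sub_eq_zero.1 (hx hxU)
  · have hψ : IsC1c Ω ψ := ⟨h1.of_le (by simp), h2, h3.trans hUΩ⟩
    obtain ⟨A, hA⟩ := hψ.exists_bound
    have hi : ∀ g, Integrable g m → Integrable (fun x => ψ x * g x) m := fun g hg =>
      hg.bdd_mul hψ.1.continuous.aestronglyMeasurable (ae_of_all _ hA)
    have e1 : ∀ x, ψ x * φ x * s x = ψ x * φ' x * s x := fun x => by
      by_cases hx : x ∈ tsupport ψ
      · rw [he (h3 hx)]
      · simp [image_eq_zero_of_notMem_tsupport hx]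
    have e2 : ∀ x, φ x * inner ℝ (gradient ψ x) (f x) = φ' x * inner ℝ (gradient ψ x) (f x) :=
      fun x => by
      by_cases hx : x ∈ tsupport ψ
      · rw [he (h3 hx)]
      · simp [gradient_eq_zero_of_notMem_tsupport hx]
    simp only [smul_eq_mul, mul_sub]
    rw [integral_sub (hi g h.1) (hi g' h'.1), h.2 ψ hψ, h'.2 ψ hψ]
    simp only [e1, e2, sub_self]

end Along

/-- Cut-off functions exhausting the whole space. -/
theorem exists_cutoff (n : ℕ) : ∃ χ : ℕ → Euc n → ℝ, (∀ j, IsCinfc univ (χ j)) ∧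
    (∀ j x, |χ j x| ≤ 1) ∧ (∃ C, ∀ j x, ‖gradient (χ j) x‖ ≤ C) ∧
    ∀ x, ∀ᶠ j in atTop, χ j x = 1 ∧ gradient (χ j) x = 0 := by
  -- The cut-off functions are dilations of one bump by the factor j + 1 ≥ 1, so its gradient bound
  -- serves for all of them.
  let b : ContDiffBump (0 : Euc n) := ⟨1, 2, by norm_num, by norm_num⟩
  have hbs : IsC1c univ (b : Euc n → ℝ) := ⟨b.contDiff, b.hasCompactSupport, subset_univ _⟩
  obtain ⟨C, hC⟩ := hbs.exists_bound_gradient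
  have hr : ∀ j : ℕ, ((j : ℝ) + 1)⁻¹ ≠ 0 := fun j => by positivity
  refine ⟨fun j x => b (((j : ℝ) + 1)⁻¹ • x), fun j => ⟨?_, ?_, subset_univ _⟩, fun j x => ?_,
    ⟨C, fun j x => ?_⟩, fun x => ?_⟩
  · exact b.contDiff.comp (contDiff_const_smul _)
  · exact b.hasCompactSupport.comp_homeomorph (Homeomorph.smulOfNeZero _ (hr j))
  · rw [abs_of_nonneg b.nonneg]
    exact b.le_one
  · rw [norm_gradient]
    have h1 : HasFDerivAt (fun x : Euc n => b (((j : ℝ) + 1)⁻¹ • x))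
        ((fderiv ℝ b (((j : ℝ) + 1)⁻¹ • x)).comp
          (((j : ℝ) + 1)⁻¹ • ContinuousLinearMap.id ℝ (Euc n))) x :=
      ((hbs.1.differentiable one_ne_zero) _).hasFDerivAt.comp x
        ((hasFDerivAt_id x).const_smul (((j : ℝ) + 1)⁻¹))
    rw [h1.fderiv, ContinuousLinearMap.comp_smul, ContinuousLinearMap.comp_id, norm_smul]
    have h2 := hC (((j : ℝ) + 1)⁻¹ • x)
    rw [norm_gradient] at h2
    have h3 : ‖((j : ℝ) + 1)⁻¹‖ ≤ 1 := by
      rw [norm_inv, Real.norm_of_nonneg (by positivity)]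
      exact inv_le_one_of_one_le₀ (by linarith [(Nat.cast_nonneg j : (0 : ℝ) ≤ j)])
    calc _ ≤ 1 * C := mul_le_mul h3 h2 (norm_nonneg _) zero_le_one
      _ = C := one_mul C
  · obtain ⟨N, hN⟩ := exists_nat_gt ‖x‖
    filter_upwards [eventually_ge_atTop N] with j hj
    have hlt : ‖((j : ℝ) + 1)⁻¹ • x‖ < 1 := by
      rw [norm_smul, norm_inv, Real.norm_of_nonneg (by positivity), inv_mul_lt_iff₀ (by positivity)]
      have : (N : ℝ) ≤ j := by exact_mod_cast hj
      linarith
    have hev : (fun x : Euc n => b (((j : ℝ) + 1)⁻¹ • x)) =ᶠ[𝓝 x] fun _ => 1 := by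
      have : ∀ᶠ y in 𝓝 x, ‖((j : ℝ) + 1)⁻¹ • y‖ < 1 :=
        (by fun_prop : Continuous fun y : Euc n => ‖((j : ℝ) + 1)⁻¹ • y‖).continuousAt.eventually
          (gt_mem_nhds hlt)
      filter_upwards [this] with y hy
      refine b.one_of_mem_closedBall ?_
      rw [mem_closedBall_zero_iff]
      exact hy.le
    exact ⟨hev.eq_of_nhds, gradient_eq_zero_of_eventually_const hev⟩

/-! ### The chain rule along the field: an identity for functions of u. -/

section Level

variable {Ω : Set (Euc n)} {m : Measure (Euc n)} {f : Euc n → Euc n} {s : Euc n → ℝ}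
  {u gu φ g : Euc n → ℝ}

theorem isApprox_mollify_univ (Ω : Set (Euc n)) {ρ : Euc n → ℝ} (hρ : IsStdMollifier ρ)
    (hu : LipschitzWith 1 u) : IsApprox Ω u fun δ => mollify univ ρ δ u := by
  have hli : LocallyIntegrable ((univ : Set (Euc n)).indicator u) := by
    rw [indicator_univ]
    exact hu.continuous.locallyIntegrable
  refine ⟨fun δ hδ => (contDiff_mollify MeasurableSet.univ hρ hδ hli).of_le (by simp),
    fun K hK _ => tendstoUniformlyOn_mollify isOpen_univ hρ hli hu.continuous.continuousOn hK
      (subset_univ _), 1, zero_le_one, fun K hK _ => ?_⟩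
  filter_upwards [self_mem_nhdsWithin] with δ hδ x _
  exact norm_gradient_mollify_univ_le hρ hδ hu x

theorem abs_mollify_univ_sub_le {ρ : Euc n → ℝ} (hρ : IsStdMollifier ρ)
    (hu : LipschitzWith 1 u) {δ : ℝ} (hδ : 0 < δ) (x : Euc n) :
    |mollify univ ρ δ u x - u x| ≤ 2 * δ := by
  have hli : LocallyIntegrable ((univ : Set (Euc n)).indicator u) := by
    rw [indicator_univ]
    exact hu.continuous.locallyIntegrable
  rw [← Real.dist_eq]
  -- The radius has to exceed δ strictly; the resulting constant 2 is harmless.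
  refine dist_mollify_le (r := 2 * δ) MeasurableSet.univ hρ hδ hli (by linarith) (by linarith)
    (subset_univ _) fun y hy => ?_
  have := hu.dist_le_mul y x
  rw [NNReal.coe_one, one_mul] at this
  exact this.trans (Metric.mem_ball.1 hy).le

variable [IsFiniteMeasure m]

/-- The equation of g is tested with χ h(v), where v is a mollification of u. The chain rule turns
∇(h(v)) into k(v) ∇v, and as δ → 0 the measures ∇v · F converge weakly to gu m. -/
theorem DivField.level_identity_cutoff (D : DivField Ω m f s) (hu : LipschitzWith 1 u)
    (hU : {x | 0 < u x} ⊆ Ω) (hgu : HasDerivAlong Ω m f s u gu) (hφ : ContinuousOn φ Ω)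
    {M : ℝ} (hM : ∀ x ∈ Ω, |φ x| ≤ M) (hg : HasDerivAlong Ω m f s φ g)
    {k h : ℝ → ℝ} {ε Ck Ch : ℝ} (hε : 0 < ε) (hk : Continuous k) (hkb : ∀ t, |k t| ≤ Ck)
    (hk0 : ∀ t ≤ ε, k t = 0) (hh : ∀ t, HasDerivAt h (k t) t) (hhb : ∀ t, |h t| ≤ Ch)
    (hh0 : ∀ t ≤ ε, h t = 0) {χ : Euc n → ℝ} (hχ : IsC1c univ χ) :
    ∫ x, χ x * h (u x) * g x ∂m = - ∫ x, χ x * h (u x) * φ x * s x ∂m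
      - ∫ x, φ x * (h (u x) * inner ℝ (gradient χ x) (f x)) ∂m
      - ∫ x, χ x * k (u x) * φ x * gu x ∂m := by
  obtain ⟨ρ, hρ⟩ := exists_isStdMollifier n
  set v : ℝ → Euc n → ℝ := fun δ => mollify univ ρ δ u with hvdef
  have hv : IsApprox Ω u v := isApprox_mollify_univ Ω hρ hu
  obtain ⟨B, hB⟩ := hχ.exists_bound
  obtain ⟨B', hB'⟩ := hχ.exists_bound_gradient
  have hB0 : 0 ≤ B := (abs_nonneg _).trans (hB 0)
  have hB'0 : 0 ≤ B' := (norm_nonneg _).trans (hB' 0)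
  have hCh0 : 0 ≤ Ch := (abs_nonneg _).trans (hhb 0)
  have hCk0 : 0 ≤ Ck := (abs_nonneg _).trans (hkb 0)
  have hhd : Differentiable ℝ h := fun t => (hh t).differentiableAt
  have hhc : Continuous h := hhd.continuous
  have hh1 : ContDiff ℝ 1 h := by
    rw [contDiff_one_iff_deriv]
    refine ⟨hhd, ?_⟩
    have : deriv h = k := funext fun t => (hh t).deriv
    rwa [this]
  have hφm : AEStronglyMeasurable φ m := D.aestronglyMeasurable hφ
  have hφM : ∀ᵐ x ∂m, |φ x| ≤ M := D.ae_mem.mono fun x hx => hM x hx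
  have hlev : ∀ c, 0 < c → {x | c ≤ u x} ⊆ Ω := fun c hc x hx => hU (lt_of_lt_of_le hc hx)
  have hclosed : ∀ c, IsClosed {x | c ≤ u x} := fun c => isClosed_le continuous_const hu.continuous
  have hpt : ∀ x, Tendsto (fun δ => v δ x) (𝓝[>] 0) (𝓝 (u x)) := fun x => by
    rw [tendsto_iff_norm_sub_tendsto_zero]
    have h0 : Tendsto (fun δ : ℝ => 2 * δ) (𝓝[>] 0) (𝓝 0) := by
      have : Tendsto (fun δ : ℝ => 2 * δ) (𝓝 0) (𝓝 (2 * 0)) := tendsto_id.const_mul 2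
      rw [mul_zero] at this
      exact this.mono_left nhdsWithin_le_nhds
    refine squeeze_zero' (Eventually.of_forall fun _ => norm_nonneg _) ?_ h0
    filter_upwards [self_mem_nhdsWithin] with δ hδ
    exact abs_mollify_univ_sub_le hρ hu hδ x
  have hvc : ∀ δ, 0 < δ → ContDiff ℝ 1 (v δ) := hv.contDiff
  have hgr : ∀ δ, 0 < δ → ∀ x, ‖gradient (v δ) x‖ ≤ 1 := fun δ hδ x => by
    simpa using norm_gradient_mollify_univ_le hρ hδ hu x
  -- the test functions
  have hψ : ∀ᶠ δ in 𝓝[>] 0, IsC1c Ω fun x => χ x * h (v δ x) := by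
    -- For δ < ε / 4 the error |v δ - u| ≤ 2 δ is below ε / 2, so h(v δ) vanishes where u < ε / 2
    -- and the support stays inside Ω.
    filter_upwards [Ioo_mem_nhdsGT (show (0 : ℝ) < ε / 4 by linarith)] with δ hδ
    refine ⟨hχ.1.mul (hh1.comp (hvc δ hδ.1)), hχ.2.1.mul_right, ?_⟩
    refine (closure_minimal (fun x hx => ?_) (hclosed (ε / 2))).trans (hlev _ (half_pos hε))
    have h1 := abs_le.1 (abs_mollify_univ_sub_le hρ hu hδ.1 x)
    by_contra hlt
    refine hx ?_
    change χ x * h (v δ x) = 0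
    rw [hh0 (v δ x), mul_zero]
    have h2 : u x < ε / 2 := not_le.1 hlt
    simp only [hvdef]
    linarith [h1.2, hδ.2]
  -- the limits of the four terms
  have T1 : Tendsto (fun δ => ∫ x, χ x * h (v δ x) * g x ∂m) (𝓝[>] 0)
      (𝓝 (∫ x, χ x * h (u x) * g x ∂m)) := by
    refine tendsto_integral_filter_of_dominated_convergence (fun x => B * Ch * |g x|) ?_ ?_
      (hg.1.abs.const_mul _) (ae_of_all _ fun x => ?_)
    · filter_upwards [self_mem_nhdsWithin] with δ hδ
      exact (hχ.1.continuous.mul (hhc.comp (hvc δ hδ).continuous)).aestronglyMeasurable.mul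
        hg.1.aestronglyMeasurable
    · refine Eventually.of_forall fun δ => ae_of_all _ fun x => ?_
      rw [norm_mul, norm_mul]
      exact mul_le_mul_of_nonneg_right (mul_le_mul (hB x) (hhb _) (norm_nonneg _) hB0)
        (norm_nonneg _)
    · exact (((hhc.tendsto _).comp (hpt x)).const_mul _).mul_const _
  have T2 : Tendsto (fun δ => ∫ x, χ x * h (v δ x) * φ x * s x ∂m) (𝓝[>] 0)
      (𝓝 (∫ x, χ x * h (u x) * φ x * s x ∂m)) := by
    refine tendsto_integral_filter_of_dominated_convergence (fun x => B * Ch * M * 1) ?_ ?_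
      (integrable_const _) (ae_of_all _ fun x => ?_)
    · filter_upwards [self_mem_nhdsWithin] with δ hδ
      exact ((hχ.1.continuous.mul (hhc.comp (hvc δ hδ).continuous)).aestronglyMeasurable.mul
        hφm).mul D.meas_s.aestronglyMeasurable
    · refine Eventually.of_forall fun δ => ?_
      filter_upwards [hφM] with x hx
      rw [norm_mul, norm_mul, norm_mul]
      have hM0 : 0 ≤ M := (abs_nonneg _).trans hx
      exact mul_le_mul (mul_le_mul (mul_le_mul (hB x) (hhb _) (norm_nonneg _) hB0) hx
        (norm_nonneg _) (by positivity)) (D.s_le x) (norm_nonneg _) (by positivity)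
    · exact ((((hhc.tendsto _).comp (hpt x)).const_mul _).mul_const _).mul_const _
  have T3 : Tendsto (fun δ => ∫ x, φ x * (h (v δ x) * inner ℝ (gradient χ x) (f x)) ∂m) (𝓝[>] 0)
      (𝓝 (∫ x, φ x * (h (u x) * inner ℝ (gradient χ x) (f x)) ∂m)) := by
    refine tendsto_integral_filter_of_dominated_convergence (fun x => M * (Ch * B')) ?_ ?_
      (integrable_const _) (ae_of_all _ fun x => ?_)
    · filter_upwards [self_mem_nhdsWithin] with δ hδ
      exact hφm.mul ((hhc.comp (hvc δ hδ).continuous).aestronglyMeasurable.mul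
        (D.aestronglyMeasurable_inner (continuous_gradient hχ.1)))
    · refine Eventually.of_forall fun δ => ?_
      filter_upwards [hφM] with x hx
      rw [norm_mul, norm_mul]
      have hM0 : 0 ≤ M := (abs_nonneg _).trans hx
      exact mul_le_mul hx (mul_le_mul (hhb _) ((D.abs_inner_le _ x).trans (hB' x)) (norm_nonneg _)
        hCh0) (by positivity) hM0
    · exact (((hhc.tendsto _).comp (hpt x)).mul_const _).const_mul _
  have hη : IsCc Ω fun x => (χ x * k (u x)) * φ x := by
    have hs : tsupport (fun x => χ x * k (u x)) ⊆ {x | ε ≤ u x} := by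
      refine closure_minimal (fun x hx => ?_) (hclosed ε)
      by_contra hlt
      refine hx ?_
      change χ x * k (u x) = 0
      rw [hk0 _ (not_le.1 hlt).le, mul_zero]
    have hc : Continuous fun x => χ x * k (u x) := hχ.1.continuous.mul (hk.comp hu.continuous)
    refine ⟨continuous_mul_of_tsupport_subset D.isOpen hc (hs.trans (hlev ε hε)) hφ,
      (hχ.2.1.mul_right).mul_right, ?_⟩
    exact (tsupport_mul_subset_left).trans (hs.trans (hlev ε hε))
  -- Weak convergence requires a test function independent of δ, so k(v δ) is replaced by k(u); the
  -- difference, treated next, tends to zero by dominated convergence since |∇v δ| ≤ 1.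
  have T4 := D.tendsto_of_isCc hu.continuous.continuousOn hgu hv hη
  have T5 : Tendsto (fun δ => ∫ x, (χ x * (k (v δ x) - k (u x)) * φ x) *
      inner ℝ (gradient (v δ) x) (f x) ∂m) (𝓝[>] 0) (𝓝 (∫ _x, (0 : ℝ) ∂m)) := by
    refine tendsto_integral_filter_of_dominated_convergence (fun x => B * (Ck + Ck) * M * 1) ?_ ?_
      (integrable_const _) ?_
    · filter_upwards [self_mem_nhdsWithin] with δ hδ
      exact ((hχ.1.continuous.mul ((hk.comp (hvc δ hδ).continuous).sub
        (hk.comp hu.continuous))).aestronglyMeasurable.mul hφm).mul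
        (D.aestronglyMeasurable_inner (continuous_gradient (hvc δ hδ)))
    · filter_upwards [self_mem_nhdsWithin] with δ hδ
      filter_upwards [hφM] with x hx
      rw [norm_mul, norm_mul, norm_mul]
      have hM0 : 0 ≤ M := (abs_nonneg _).trans hx
      exact mul_le_mul (mul_le_mul (mul_le_mul (hB x) ((norm_sub_le _ _).trans
        (add_le_add (hkb _) (hkb _))) (norm_nonneg _) hB0) hx (norm_nonneg _) (by positivity))
        ((D.abs_inner_le _ x).trans (hgr δ hδ x)) (norm_nonneg _) (by positivity)
    · filter_upwards [hφM] with x hx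
      have h1 : Tendsto (fun δ => B * |k (v δ x) - k (u x)| * M * 1) (𝓝[>] 0) (𝓝 0) := by
        have h2 := ((((hk.tendsto _).comp (hpt x)).sub_const (k (u x))).abs.const_mul B).mul_const M
        rw [sub_self, abs_zero, mul_zero, zero_mul] at h2
        simpa using h2
      refine squeeze_zero_norm' ?_ h1
      filter_upwards [self_mem_nhdsWithin] with δ hδ
      rw [norm_mul, norm_mul, norm_mul]
      have hM0 : 0 ≤ M := (abs_nonneg _).trans hx
      exact mul_le_mul (mul_le_mul (mul_le_mul_of_nonneg_right (hB x) (norm_nonneg _)) hx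
        (norm_nonneg _) (by positivity))
        ((D.abs_inner_le _ x).trans (hgr δ hδ x)) (norm_nonneg _) (by positivity)
  rw [integral_zero] at T5
  have hkey : ∀ᶠ δ in 𝓝[>] 0, ∫ x, χ x * h (v δ x) * g x ∂m =
      - ∫ x, χ x * h (v δ x) * φ x * s x ∂m
      - ∫ x, φ x * (h (v δ x) * inner ℝ (gradient χ x) (f x)) ∂m
      - (∫ x, (χ x * k (u x) * φ x) * inner ℝ (gradient (v δ) x) (f x) ∂m
        + ∫ x, (χ x * (k (v δ x) - k (u x)) * φ x) * inner ℝ (gradient (v δ) x) (f x) ∂m) := by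
    filter_upwards [hψ, self_mem_nhdsWithin] with δ h1 hδ
    have h2 := hg.2 _ h1
    have e1 : ∀ x, φ x * inner ℝ (gradient (fun y => χ y * h (v δ y)) x) (f x) =
        φ x * (h (v δ x) * inner ℝ (gradient χ x) (f x)) +
        ((χ x * k (u x) * φ x) * inner ℝ (gradient (v δ) x) (f x) +
        (χ x * (k (v δ x) - k (u x)) * φ x) * inner ℝ (gradient (v δ) x) (f x)) := fun x => by
      have hvd : DifferentiableAt ℝ (v δ) x := (hvc δ hδ).differentiable one_ne_zero x
      have hcd : DifferentiableAt ℝ (fun y => h (v δ y)) x := (hhd _).comp x hvd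
      rw [gradient_mul ((hχ.1.differentiable one_ne_zero) x) hcd,
        gradient_comp (hh _) hvd, inner_add_left, real_inner_smul_left, real_inner_smul_left,
        real_inner_smul_left]
      ring
    have hwm := D.aestronglyMeasurable_inner (continuous_gradient (hvc δ hδ))
    have hwb : ∀ x, |inner ℝ (gradient (v δ) x) (f x)| ≤ 1 := fun x =>
      (D.abs_inner_le _ x).trans (hgr δ hδ x)
    have i1 : Integrable (fun x => φ x * (h (v δ x) * inner ℝ (gradient χ x) (f x))) m := by
      refine Integrable.of_bound (hφm.mul ((hhc.comp (hvc δ hδ).continuous).aestronglyMeasurable.mul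
        (D.aestronglyMeasurable_inner (continuous_gradient hχ.1)))) (M * (Ch * B')) ?_
      filter_upwards [hφM] with x hx
      rw [norm_mul, norm_mul]
      have hM0 : 0 ≤ M := (abs_nonneg _).trans hx
      exact mul_le_mul hx (mul_le_mul (hhb _) ((D.abs_inner_le _ x).trans (hB' x)) (norm_nonneg _)
        hCh0) (by positivity) hM0
    have i2 : Integrable (fun x => (χ x * k (u x) * φ x) * inner ℝ (gradient (v δ) x) (f x)) m :=
      (hη.1.integrable_of_hasCompactSupport hη.2.1).mul_bdd (c := 1) hwm (ae_of_all _ hwb)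
    have i3 : Integrable (fun x => (χ x * (k (v δ x) - k (u x)) * φ x) *
        inner ℝ (gradient (v δ) x) (f x)) m := by
      refine Integrable.mul_bdd (c := 1) ?_ hwm (ae_of_all _ hwb)
      refine Integrable.of_bound ((hχ.1.continuous.mul ((hk.comp (hvc δ hδ).continuous).sub
        (hk.comp hu.continuous))).aestronglyMeasurable.mul hφm) (B * (Ck + Ck) * M) ?_
      filter_upwards [hφM] with x hx
      rw [norm_mul, norm_mul]
      exact mul_le_mul (mul_le_mul (hB x) ((norm_sub_le _ _).trans
        (add_le_add (hkb _) (hkb _))) (norm_nonneg _) hB0) hx (norm_nonneg _) (by positivity)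
    have i23 : Integrable (fun x => (χ x * k (u x) * φ x) * inner ℝ (gradient (v δ) x) (f x) +
        (χ x * (k (v δ x) - k (u x)) * φ x) * inner ℝ (gradient (v δ) x) (f x)) m := i2.add i3
    simp only [e1] at h2
    rw [integral_add i1 i23, integral_add i2 i3] at h2
    linarith
  have hR := (T2.neg.sub T3).sub (T4.add T5)
  rw [add_zero] at hR
  exact tendsto_nhds_unique T1 (hR.congr' (hkey.mono fun _ h => h.symm))

/-- The spatial cut-off is removed by dominated convergence: the gradients of the cut-off functions
are uniformly bounded and eventually vanish at each point, and m is finite. No compactness of U is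
needed. -/
theorem DivField.level_identity (D : DivField Ω m f s) (hu : LipschitzWith 1 u)
    (hU : {x | 0 < u x} ⊆ Ω) (hgu : HasDerivAlong Ω m f s u gu) (hφ : ContinuousOn φ Ω)
    {M : ℝ} (hM : ∀ x ∈ Ω, |φ x| ≤ M) (hg : HasDerivAlong Ω m f s φ g)
    {k h : ℝ → ℝ} {ε Ck Ch : ℝ} (hε : 0 < ε) (hk : Continuous k) (hkb : ∀ t, |k t| ≤ Ck)
    (hk0 : ∀ t ≤ ε, k t = 0) (hh : ∀ t, HasDerivAt h (k t) t) (hhb : ∀ t, |h t| ≤ Ch)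
    (hh0 : ∀ t ≤ ε, h t = 0) :
    ∫ x, h (u x) * g x ∂m = - ∫ x, h (u x) * φ x * s x ∂m - ∫ x, k (u x) * φ x * gu x ∂m := by
  obtain ⟨χ, hχ, hχ1, ⟨C, hC⟩, hχe⟩ := exists_cutoff n
  have hhc : Continuous h := continuous_iff_continuousAt.2 fun t => (hh t).continuousAt
  have hφm : AEStronglyMeasurable φ m := D.aestronglyMeasurable hφ
  have hφM : ∀ᵐ x ∂m, |φ x| ≤ M := D.ae_mem.mono fun x hx => hM x hx
  have hCh0 : 0 ≤ Ch := (abs_nonneg _).trans (hhb 0)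
  have hCk0 : 0 ≤ Ck := (abs_nonneg _).trans (hkb 0)
  have hC0 : 0 ≤ C := (norm_nonneg _).trans (hC 0 0)
  have hlim : ∀ w : Euc n → ℝ, Integrable w m →
      Tendsto (fun j => ∫ x, χ j x * w x ∂m) atTop (𝓝 (∫ x, w x ∂m)) := fun w hw => by
    refine tendsto_integral_of_dominated_convergence (fun x => |w x|) (fun j => ?_) hw.abs
      (fun j => ae_of_all _ fun x => ?_) (ae_of_all _ fun x => ?_)
    · exact (hχ j).1.continuous.aestronglyMeasurable.mul hw.aestronglyMeasurable
    · rw [norm_mul]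
      exact mul_le_of_le_one_left (norm_nonneg _) (hχ1 j x)
    · refine tendsto_const_nhds.congr' ?_
      filter_upwards [hχe x] with j hj
      rw [hj.1, one_mul]
  have T1 := hlim (fun x => h (u x) * g x) (hg.1.bdd_mul
    (hhc.comp hu.continuous).aestronglyMeasurable (ae_of_all _ fun x => hhb (u x)))
  have i2 : Integrable (fun x => h (u x) * φ x * s x) m := by
    refine Integrable.of_bound (((hhc.comp hu.continuous).aestronglyMeasurable.mul hφm).mul
      D.meas_s.aestronglyMeasurable) (Ch * M * 1) ?_
    filter_upwards [hφM] with x hx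
    rw [norm_mul, norm_mul]
    have hM0 : 0 ≤ M := (abs_nonneg _).trans hx
    exact mul_le_mul (mul_le_mul (hhb _) hx (norm_nonneg _) hCh0) (D.s_le x) (norm_nonneg _)
      (by positivity)
  have T2 := hlim _ i2
  have i3 : Integrable (fun x => k (u x) * φ x * gu x) m := by
    refine hgu.1.bdd_mul (c := Ck * M) ((hk.comp hu.continuous).aestronglyMeasurable.mul hφm) ?_
    filter_upwards [hφM] with x hx
    rw [norm_mul]
    exact mul_le_mul (hkb _) hx (norm_nonneg _) hCk0
  have T3 := hlim _ i3
  have T4 : Tendsto (fun j => ∫ x, φ x * (h (u x) * inner ℝ (gradient (χ j) x) (f x)) ∂m) atTop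
      (𝓝 (∫ _x, (0 : ℝ) ∂m)) := by
    refine tendsto_integral_of_dominated_convergence (fun x => M * (Ch * C)) (fun j => ?_)
      (integrable_const _) (fun j => ?_) (ae_of_all _ fun x => ?_)
    · exact hφm.mul ((hhc.comp hu.continuous).aestronglyMeasurable.mul
        (D.aestronglyMeasurable_inner (continuous_gradient (hχ j).isC1c.1)))
    · filter_upwards [hφM] with x hx
      rw [norm_mul, norm_mul]
      have hM0 : 0 ≤ M := (abs_nonneg _).trans hx
      exact mul_le_mul hx (mul_le_mul (hhb _) ((D.abs_inner_le _ x).trans (hC j x)) (norm_nonneg _)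
        hCh0) (by positivity) hM0
    · refine tendsto_const_nhds.congr' ?_
      filter_upwards [hχe x] with j hj
      rw [hj.2, inner_zero_left, mul_zero, mul_zero]
  rw [integral_zero] at T4
  have hR := (T2.neg.sub T4).sub T3
  rw [sub_zero] at hR
  refine tendsto_nhds_unique T1 (hR.congr fun j => ?_)
  have := D.level_identity_cutoff hu hU hgu hφ hM hg hε hk hkb hk0 hh hhb hh0 (hχ j).isC1c
  simp only [← mul_assoc] at this ⊢
  exact this.symm

end Level

/-! ### Integrals over superlevel sets. -/

section Superlevel

variable {m : Measure (Euc n)} {u w p : Euc n → ℝ}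

/-- The integral of `w` over the superlevel set `{u > t}`. -/
def superInt (m : Measure (Euc n)) (u w : Euc n → ℝ) (t : ℝ) : ℝ :=
  ∫ x in {x | t < u x}, w x ∂m

theorem measurableSet_super (hu : Continuous u) (t : ℝ) : MeasurableSet {x | t < u x} :=
  (isOpen_lt continuous_const hu).measurableSet

theorem abs_superInt_le (hw : Integrable w m) (t : ℝ) : |superInt m u w t| ≤ ∫ x, |w x| ∂m :=
  (norm_integral_le_integral_norm _).trans
    (setIntegral_le_integral hw.norm (ae_of_all _ fun _ => norm_nonneg _))

theorem antitone_superInt (hw : Integrable w m) (h0 : ∀ x, 0 ≤ w x) :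
    Antitone (superInt m u w) := fun _ _ hab =>
  setIntegral_mono_set hw.integrableOn (ae_of_all _ h0)
    (Eventually.of_forall fun _ hx => lt_of_le_of_lt hab hx)

theorem measurable_superInt (hw : Integrable w m) :
    Measurable (superInt m u w) := by
  have h : superInt m u w = fun t => superInt m u (fun x => max (w x) 0) t -
      superInt m u (fun x => max (-w x) 0) t := by
    funext t
    unfold superInt
    rw [← integral_sub hw.pos_part.integrableOn hw.neg_part.integrableOn]
    refine integral_congr_ae (ae_of_all _ fun x => ?_)
    rcases le_total 0 (w x) with h | h
    · simp [h]
    · simp [h]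
  rw [h]
  exact (antitone_superInt hw.pos_part fun _ => le_max_right _ _).measurable.sub
    (antitone_superInt hw.neg_part fun _ => le_max_right _ _).measurable

/-- The strict superlevel sets {u > t} increase to {u > t₀} as t decreases to t₀. Continuity from
the left would fail if {u = t₀} were charged. -/
theorem tendsto_superInt (hu : Continuous u) (hw : Integrable w m) (t₀ : ℝ) :
    Tendsto (superInt m u w) (𝓝[>] t₀) (𝓝 (superInt m u w t₀)) := by
  have h : ∀ t, superInt m u w t = ∫ x, {x | t < u x}.indicator w x ∂m := fun t =>
    (integral_indicator (measurableSet_super hu t)).symm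
  rw [h t₀, show superInt m u w = _ from funext h]
  refine tendsto_integral_filter_of_dominated_convergence (fun x => |w x|)
    (Eventually.of_forall fun t =>
      hw.aestronglyMeasurable.indicator (measurableSet_super hu t))
    (Eventually.of_forall fun t => ae_of_all _ fun x => norm_indicator_le_norm_self _ _)
    hw.abs (ae_of_all _ fun x => tendsto_const_nhds.congr' ?_)
  by_cases hx : t₀ < u x
  · filter_upwards [Ioo_mem_nhdsGT hx] with t ht
    rw [indicator_of_mem (show x ∈ {x | t < u x} from ht.2),
      indicator_of_mem (show x ∈ {x | t₀ < u x} from hx)]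
  · filter_upwards [self_mem_nhdsWithin] with t ht
    rw [indicator_of_notMem (show x ∉ {x | t < u x} from fun h => hx (lt_trans ht h)),
      indicator_of_notMem (show x ∉ {x | t₀ < u x} from hx)]

theorem integrableOn_superInt (hw : Integrable w m) {A : Set ℝ}
    (hA : volume A ≠ ⊤) : IntegrableOn (superInt m u w) A :=
  Measure.integrableOn_of_bounded (M := ∫ x, |w x| ∂m) hA
    (measurable_superInt hw).aestronglyMeasurable
    (ae_of_all _ fun t => abs_superInt_le hw t)

/-- Right continuity at t₀ makes the primitive differentiable from the right there, so this holds at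
every t₀ and not only almost everywhere. -/
theorem tendsto_average_superInt (hu : Continuous u) (hw : Integrable w m) (t₀ : ℝ) :
    Tendsto (fun h => 1 / h * ∫ t in Ioo t₀ (t₀ + h), superInt m u w t) (𝓝[>] 0)
      (𝓝 (superInt m u w t₀)) := by
  have hd : HasDerivWithinAt (fun b => ∫ t in t₀..b, superInt m u w t) (superInt m u w t₀)
      (Ici t₀) t₀ := by
    refine intervalIntegral.integral_hasDerivWithinAt_right (t := Ioi t₀) (by simp)
      ⟨univ, univ_mem, (measurable_superInt hw).aestronglyMeasurable⟩ ?_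
    exact tendsto_superInt hu hw t₀
  have h1 := (hasDerivWithinAt_iff_tendsto_slope.1 hd)
  rw [Ici_sdiff_left] at h1
  have h2 : Tendsto (fun h : ℝ => t₀ + h) (𝓝[>] 0) (𝓝[>] t₀) := by
    refine tendsto_nhdsWithin_iff.2 ⟨?_, ?_⟩
    · have : Tendsto (fun h : ℝ => t₀ + h) (𝓝 0) (𝓝 (t₀ + 0)) := tendsto_id.const_add t₀
      rw [add_zero] at this
      exact this.mono_left nhdsWithin_le_nhds
    · filter_upwards [self_mem_nhdsWithin] with h hh
      exact lt_add_of_pos_right t₀ hh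
  refine (h1.comp h2).congr' ?_
  filter_upwards [self_mem_nhdsWithin] with h hh
  have hh' : (0 : ℝ) < h := hh
  rw [Function.comp_apply, slope_def_field, intervalIntegral.integral_same, sub_zero,
    add_sub_cancel_left, intervalIntegral.integral_of_le (by linarith),
    integral_Ioc_eq_integral_Ioo, one_div, div_eq_inv_mul]

variable [IsFiniteMeasure m]

/-- Layer-cake formula: Fubini for k(t) w(x) on the region {t < u(x)}. -/
theorem integral_primitive_comp (hu : Continuous u) (hw : Integrable w m) {k : ℝ → ℝ}
    (hk : Continuous k) (hkc : HasCompactSupport k) (hk0 : ∀ t ≤ 0, k t = 0) :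
    ∫ x, (∫ t in (0 : ℝ)..u x, k t) * w x ∂m = ∫ t in Ioi (0 : ℝ), k t * superInt m u w t := by
  have hki : Integrable k (volume.restrict (Ioi 0)) :=
    (hk.integrable_of_hasCompactSupport hkc).restrict
  have hS : MeasurableSet {q : ℝ × Euc n | q.1 < u q.2} :=
    (isOpen_lt continuous_fst (hu.comp continuous_snd)).measurableSet
  have hint : Integrable (fun q : ℝ × Euc n =>
      {q : ℝ × Euc n | q.1 < u q.2}.indicator (fun q => k q.1 * w q.2) q)
      ((volume.restrict (Ioi 0)).prod m) := (hki.mul_prod hw).indicator hS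
  have hsw := integral_integral_swap (f := fun t x =>
    {q : ℝ × Euc n | q.1 < u q.2}.indicator (fun q => k q.1 * w q.2) (t, x)) hint
  have e1 : ∀ t, ∫ x, {q : ℝ × Euc n | q.1 < u q.2}.indicator (fun q => k q.1 * w q.2) (t, x) ∂m
      = k t * superInt m u w t := fun t => by
    unfold superInt
    rw [← integral_const_mul, ← integral_indicator (measurableSet_super hu t)]
    rfl
  have e2 : ∀ x, ∫ t in Ioi (0 : ℝ),
      {q : ℝ × Euc n | q.1 < u q.2}.indicator (fun q => k q.1 * w q.2) (t, x)
      = (∫ t in (0 : ℝ)..u x, k t) * w x := fun x => by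
    have : (fun t : ℝ => {q : ℝ × Euc n | q.1 < u q.2}.indicator (fun q => k q.1 * w q.2) (t, x))
        = (Iio (u x)).indicator fun t => k t * w x := by
      funext t
      rfl
    rw [this, setIntegral_indicator measurableSet_Iio, Ioi_inter_Iio, integral_mul_const]
    congr 1
    -- Where u ≤ 0 both sides are zero, because k vanishes on the negative axis.
    rcases le_total 0 (u x) with h | h
    · rw [intervalIntegral.integral_of_le h, integral_Ioc_eq_integral_Ioo]
    · rw [Ioo_eq_empty (not_lt.2 h), setIntegral_empty, intervalIntegral.integral_of_ge h,
        setIntegral_eq_zero_of_forall_eq_zero (fun t ht => hk0 t ht.2), neg_zero]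
  simp only [e1, e2] at hsw
  exact hsw.symm

omit [IsFiniteMeasure m] in
/-- Passing from continuous to Borel functions of `u` in a coarea-type identity. -/
theorem setIntegral_preimage_Ioo (hu : Continuous u) (hp : Integrable p m) {G : ℝ → ℝ}
    (hG : ∀ R, IntegrableOn G (Ioo 0 R))
    (hk : ∀ k : ℝ → ℝ, Continuous k → HasCompactSupport k → (∃ ε > 0, ∀ t ≤ ε, k t = 0) →
      ∫ x, k (u x) * p x ∂m = ∫ t in Ioi (0 : ℝ), k t * G t) {a b : ℝ} (ha : 0 ≤ a) :
    ∫ x in u ⁻¹' Ioo a b, p x ∂m = ∫ t in Ioo a b, G t := by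
  -- Continuous trapezoids tending pointwise to the indicator of (a, b). The shift by 1 / (j + 1) at
  -- the left end makes them vanish near 0 even when a = 0.
  set k : ℕ → ℝ → ℝ := fun j t =>
    max 0 (min 1 (((j : ℝ) + 1) * min (t - a - ((j : ℝ) + 1)⁻¹) (b - t))) with hkdef
  have hkc : ∀ j, Continuous (k j) := fun j => by fun_prop
  have hj : ∀ j : ℕ, (0 : ℝ) < (j : ℝ) + 1 := fun j => by positivity
  have hk1 : ∀ j t, |k j t| ≤ 1 := fun j t => by
    rw [abs_of_nonneg (le_max_left _ _)]
    exact max_le zero_le_one (min_le_left _ _)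
  have hkl : ∀ (j : ℕ) t, t ≤ a + ((j : ℝ) + 1)⁻¹ → k j t = 0 := fun j t ht => by
    refine max_eq_left ((min_le_right _ _).trans ?_)
    exact mul_nonpos_of_nonneg_of_nonpos (hj j).le ((min_le_left _ _).trans (by linarith))
  have hkr : ∀ (j : ℕ) t, b ≤ t → k j t = 0 := fun j t ht => by
    refine max_eq_left ((min_le_right _ _).trans ?_)
    exact mul_nonpos_of_nonneg_of_nonpos (hj j).le ((min_le_right _ _).trans (by linarith))
  have hks : ∀ j, HasCompactSupport (k j) := fun j =>
    HasCompactSupport.of_support_subset_isCompact (isCompact_Icc (a := a) (b := b)) fun t ht => by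
      constructor
      · by_contra h
        exact ht (hkl j t (by linarith [not_le.1 h, inv_pos.2 (hj j)]))
      · by_contra h
        exact ht (hkr j t (not_le.1 h).le)
  have hlim : ∀ t, Tendsto (fun j => k j t) atTop (𝓝 ((Ioo a b).indicator 1 t)) := fun t => by
    refine tendsto_const_nhds.congr' ?_
    by_cases ht : t ∈ Ioo a b
    · rw [indicator_of_mem ht, Pi.one_apply]
      have hd : 0 < min ((t - a) / 2) (b - t) :=
        lt_min (by linarith [ht.1]) (by linarith [ht.2])
      obtain ⟨N, hN⟩ := exists_nat_gt (min ((t - a) / 2) (b - t))⁻¹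
      filter_upwards [eventually_ge_atTop N] with j hjN
      have h1 : (min ((t - a) / 2) (b - t))⁻¹ < (j : ℝ) + 1 := by
        have : (N : ℝ) ≤ j := by exact_mod_cast hjN
        linarith
      have h2 : ((j : ℝ) + 1)⁻¹ < min ((t - a) / 2) (b - t) := inv_lt_of_inv_lt₀ hd h1
      have h3 : ((j : ℝ) + 1)⁻¹ ≤ min (t - a - ((j : ℝ) + 1)⁻¹) (b - t) := by
        refine le_min ?_ ?_
        · linarith [lt_of_lt_of_le h2 (min_le_left _ _)]
        · linarith [lt_of_lt_of_le h2 (min_le_right _ _)]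
      have h4 : 1 ≤ ((j : ℝ) + 1) * min (t - a - ((j : ℝ) + 1)⁻¹) (b - t) := by
        have := mul_le_mul_of_nonneg_left h3 (hj j).le
        rwa [mul_inv_cancel₀ (hj j).ne'] at this
      simp only [hkdef]
      rw [min_eq_left h4, max_eq_right zero_le_one]
    · rw [indicator_of_notMem ht]
      refine Eventually.of_forall fun j => ?_
      by_cases h : t ≤ a
      · exact (hkl j t (by linarith [inv_pos.2 (hj j)])).symm
      · exact (hkr j t (not_lt.1 fun h' => ht ⟨not_le.1 h, h'⟩)).symm
  have L1 : Tendsto (fun j => ∫ x, k j (u x) * p x ∂m) atTop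
      (𝓝 (∫ x, (Ioo a b).indicator 1 (u x) * p x ∂m)) := by
    refine tendsto_integral_of_dominated_convergence (fun x => |p x|) (fun j => ?_) hp.abs
      (fun j => ae_of_all _ fun x => ?_) (ae_of_all _ fun x => (hlim _).mul_const _)
    · exact ((hkc j).comp hu).aestronglyMeasurable.mul hp.aestronglyMeasurable
    · rw [norm_mul]
      exact mul_le_of_le_one_left (norm_nonneg _) (hk1 j _)
  have hGI : IntegrableOn G (Ioo a b) := (hG b).mono_set (Ioo_subset_Ioo_left ha)
  have hkG : ∀ j, ∫ t in Ioi (0 : ℝ), k j t * G t = ∫ t in Ioo a b, k j t * G t := fun j => by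
    refine setIntegral_eq_of_subset_of_forall_sdiff_eq_zero measurableSet_Ioi
      (fun t ht => lt_of_le_of_lt ha ht.1) fun t ht => ?_
    rcases le_or_gt t a with h | h
    · rw [hkl j t (by linarith [inv_pos.2 (hj j)]), zero_mul]
    · rw [hkr j t (not_lt.1 fun h' => ht.2 ⟨h, h'⟩), zero_mul]
  have L2 : Tendsto (fun j => ∫ t in Ioo a b, k j t * G t) atTop
      (𝓝 (∫ t in Ioo a b, (Ioo a b).indicator 1 t * G t)) := by
    refine tendsto_integral_of_dominated_convergence (fun t => |G t|) (fun j => ?_) hGI.abs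
      (fun j => ae_of_all _ fun x => ?_) (ae_of_all _ fun x => (hlim _).mul_const _)
    · exact (hkc j).aestronglyMeasurable.mul hGI.aestronglyMeasurable
    · rw [norm_mul]
      exact mul_le_of_le_one_left (norm_nonneg _) (hk1 j _)
  have L3 := tendsto_nhds_unique L1 (L2.congr fun j => by
    rw [hk (k j) (hkc j) (hks j) ⟨a + ((j : ℝ) + 1)⁻¹, by linarith [inv_pos.2 (hj j)], hkl j⟩,
      hkG j])
  rw [← integral_indicator (hu.measurable measurableSet_Ioo)]
  convert L3 using 1
  · refine integral_congr_ae (ae_of_all _ fun x => ?_)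
    by_cases hx : u x ∈ Ioo a b
    · simp [indicator_of_mem hx, indicator_of_mem (show x ∈ u ⁻¹' Ioo a b from hx)]
    · simp [indicator_of_notMem hx, indicator_of_notMem (show x ∉ u ⁻¹' Ioo a b from hx)]
  · refine setIntegral_congr_fun measurableSet_Ioo fun t ht => ?_
    simp [indicator_of_mem ht]

omit [IsFiniteMeasure m] in
-- A π-λ argument: the half-lines (a, ∞) generate the Borel sets and meet (0, R) in the intervals
-- where the identity is known.
theorem setIntegral_preimage_of_Ioo (hu : Continuous u) (hp : Integrable p m) {G : ℝ → ℝ} {R : ℝ}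
    (hG : IntegrableOn G (Ioo 0 R))
    (h : ∀ a, 0 ≤ a → a < R → ∫ x in u ⁻¹' Ioo a R, p x ∂m = ∫ t in Ioo a R, G t)
    {B : Set ℝ} (hB : MeasurableSet B) :
    ∫ x in u ⁻¹' (B ∩ Ioo 0 R), p x ∂m = ∫ t in B ∩ Ioo 0 R, G t := by
  have hmu : ∀ {A : Set ℝ}, MeasurableSet A → MeasurableSet (u ⁻¹' A) := fun hA =>
    hu.measurable hA
  have hI : MeasurableSet (Ioo (0 : ℝ) R) := measurableSet_Ioo
  have hfull : ∫ x in u ⁻¹' Ioo 0 R, p x ∂m = ∫ t in Ioo 0 R, G t := by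
    rcases lt_or_ge 0 R with hR | hR
    · exact h 0 le_rfl hR
    · simp [Ioo_eq_empty (not_lt.2 hR)]
  induction B, hB using MeasurableSpace.induction_on_inter
    ((BorelSpace.measurable_eq (α := ℝ)).trans (borel_eq_generateFrom_Ioi ℝ)) isPiSystem_Ioi
    with
  | empty => simp
  | basic t ht =>
    obtain ⟨a, rfl⟩ := ht
    have : Ioi a ∩ Ioo 0 R = Ioo (max a 0) R := by
      ext t
      simp only [mem_inter_iff, mem_Ioi, mem_Ioo, max_lt_iff]
      tauto
    rw [this]
    rcases lt_or_ge (max a 0) R with hR | hR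
    · exact h _ (le_max_right _ _) hR
    · simp [Ioo_eq_empty (not_lt.2 hR)]
  | compl t ht ih =>
    have e : tᶜ ∩ Ioo 0 R = Ioo 0 R \ (t ∩ Ioo 0 R) := by
      ext y
      simp only [mem_inter_iff, mem_compl_iff, Set.mem_sdiff]
      tauto
    rw [e, preimage_sdiff, setIntegral_sdiff (hmu (ht.inter hI)) hp.integrableOn
      (preimage_mono inter_subset_right), setIntegral_sdiff (ht.inter hI) hG inter_subset_right,
      ih, hfull]
  | iUnion t hd ht ih =>
    have hd' : Pairwise (Function.onFun Disjoint fun i => t i ∩ Ioo 0 R) := fun i j hij =>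
      (hd hij).mono inter_subset_left inter_subset_left
    rw [iUnion_inter, preimage_iUnion,
      integral_iUnion (fun i => hmu ((ht i).inter hI)) (fun i j hij => (hd' hij).preimage u)
        hp.integrableOn,
      integral_iUnion (fun i => (ht i).inter hI) hd'
        (hG.mono_set (iUnion_subset fun i => inter_subset_right))]
    exact tsum_congr ih

end Superlevel

/-! ### The flux through level sets and the coarea formula. -/

section Flux

variable {Ω : Set (Euc n)} {m : Measure (Euc n)} {f : Euc n → Euc n} {s : Euc n → ℝ}
  {u gu φ g : Euc n → ℝ}

/-- The flux through the boundary of the superlevel set `{u > t}`, tested against `φ`; here `g` is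
the derivative of `φ` along the field. -/
def flux (m : Measure (Euc n)) (s u φ g : Euc n → ℝ) (t : ℝ) : ℝ :=
  superInt m u (fun x => - (g x + φ x * s x)) t

variable [IsFiniteMeasure m]

theorem DivField.integrable_mul_s (D : DivField Ω m f s) (hφ : ContinuousOn φ Ω) {M : ℝ}
    (hM : ∀ x ∈ Ω, |φ x| ≤ M) : Integrable (fun x => φ x * s x) m := by
  refine Integrable.of_bound ((D.aestronglyMeasurable hφ).mul D.meas_s.aestronglyMeasurable)
    (M * 1) ?_
  filter_upwards [D.ae_mem] with x hx
  rw [norm_mul]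
  exact mul_le_mul (hM x hx) (D.s_le x) (norm_nonneg _) ((abs_nonneg _).trans (hM x hx))

omit [IsFiniteMeasure m] in
theorem DivField.integrable_mul_of_bound (D : DivField Ω m f s) (hφ : ContinuousOn φ Ω) {M : ℝ}
    (hM : ∀ x ∈ Ω, |φ x| ≤ M) (hg : Integrable g m) : Integrable (fun x => φ x * g x) m := by
  refine hg.bdd_mul (c := M) (D.aestronglyMeasurable hφ) ?_
  filter_upwards [D.ae_mem] with x hx
  exact hM x hx

theorem DivField.integrable_flux_density (D : DivField Ω m f s) (hφ : ContinuousOn φ Ω) {M : ℝ}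
    (hM : ∀ x ∈ Ω, |φ x| ≤ M) (hg : HasDerivAlong Ω m f s φ g) :
    Integrable (fun x => - (g x + φ x * s x)) m :=
  (hg.1.add (D.integrable_mul_s hφ hM)).neg

/-- The level identity for the primitive of k, combined with the layer-cake formula. -/
theorem DivField.integral_comp_mul (D : DivField Ω m f s) (hu : LipschitzWith 1 u)
    (hU : {x | 0 < u x} ⊆ Ω) (hgu : HasDerivAlong Ω m f s u gu) (hφ : ContinuousOn φ Ω)
    {M : ℝ} (hM : ∀ x ∈ Ω, |φ x| ≤ M) (hg : HasDerivAlong Ω m f s φ g) {k : ℝ → ℝ}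
    (hk : Continuous k) (hkc : HasCompactSupport k) (hk0 : ∃ ε > 0, ∀ t ≤ ε, k t = 0) :
    ∫ x, k (u x) * (φ x * gu x) ∂m = ∫ t in Ioi (0 : ℝ), k t * flux m s u φ g t := by
  obtain ⟨ε, hε, hk0⟩ := hk0
  obtain ⟨Ck, hCk⟩ := hk.bounded_above_of_compact_support hkc
  have hki : Integrable k := hk.integrable_of_hasCompactSupport hkc
  have hfd := D.integrable_flux_density hφ hM hg
  have hz : ∀ t ≤ ε, ∫ r in (0 : ℝ)..t, k r = 0 := fun t ht => by
    rw [intervalIntegral.integral_congr (g := fun _ => (0 : ℝ)), intervalIntegral.integral_zero]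
    intro r hr
    exact hk0 r (hr.2.trans (max_le hε.le ht))
  have hb : ∀ t, |∫ r in (0 : ℝ)..t, k r| ≤ ∫ r, ‖k r‖ := fun t => by
    rw [← Real.norm_eq_abs, intervalIntegral.norm_integral_eq_norm_integral_uIoc]
    exact (norm_integral_le_integral_norm _).trans
      (setIntegral_le_integral hki.norm (ae_of_all _ fun _ => norm_nonneg _))
  have h1 := D.level_identity hu hU hgu hφ hM hg hε hk hCk hk0
    (h := fun t => ∫ r in (0 : ℝ)..t, k r)
    (fun t => intervalIntegral.integral_hasDerivAt_right (hk.intervalIntegrable _ _)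
      (hk.stronglyMeasurableAtFilter _ _) hk.continuousAt) hb hz
  have hhc : Continuous fun t => ∫ r in (0 : ℝ)..t, k r :=
    intervalIntegral.continuous_primitive (fun a b => hk.intervalIntegrable a b) 0
  have h2 := integral_primitive_comp (m := m) hu.continuous hfd hk hkc
    (fun t ht => hk0 t (ht.trans hε.le))
  unfold flux
  rw [← h2]
  have hA : Integrable (fun x => (∫ r in (0 : ℝ)..u x, k r) * g x) m :=
    hg.1.bdd_mul (hhc.comp hu.continuous).aestronglyMeasurable (ae_of_all _ fun x => hb _)
  have hB : Integrable (fun x => (∫ r in (0 : ℝ)..u x, k r) * φ x * s x) m := by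
    simp only [mul_assoc]
    exact (D.integrable_mul_s hφ hM).bdd_mul (hhc.comp hu.continuous).aestronglyMeasurable
      (ae_of_all _ fun x => hb _)
  have e1 : ∫ x, (∫ r in (0 : ℝ)..u x, k r) * -(g x + φ x * s x) ∂m =
      -(∫ x, (∫ r in (0 : ℝ)..u x, k r) * g x ∂m +
        ∫ x, (∫ r in (0 : ℝ)..u x, k r) * φ x * s x ∂m) := by
    rw [← integral_add hA hB, ← integral_neg]
    exact integral_congr_ae (ae_of_all _ fun x => by ring)
  have e2 : ∫ x, k (u x) * (φ x * gu x) ∂m = ∫ x, k (u x) * φ x * gu x ∂m :=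
    integral_congr_ae (ae_of_all _ fun x => by ring)
  rw [e1, e2]
  linarith

/-- The coarea-type formula `∫_{u ∈ B} φ ∇u · dF = ∫_B flux_φ(t) dt`. -/
theorem DivField.setIntegral_preimage (D : DivField Ω m f s) (hu : LipschitzWith 1 u)
    (hU : {x | 0 < u x} ⊆ Ω) (hgu : HasDerivAlong Ω m f s u gu) (hφ : ContinuousOn φ Ω)
    {M : ℝ} (hM : ∀ x ∈ Ω, |φ x| ≤ M) (hg : HasDerivAlong Ω m f s φ g) {B : Set ℝ}
    (hB : MeasurableSet B) {R : ℝ} (hBR : B ⊆ Ioo 0 R) :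
    ∫ x in u ⁻¹' B, φ x * gu x ∂m = ∫ t in B, flux m s u φ g t := by
  have hp := D.integrable_mul_of_bound hφ hM hgu.1
  have hG : ∀ R, IntegrableOn (flux m s u φ g) (Ioo 0 R) := fun R =>
    integrableOn_superInt (D.integrable_flux_density hφ hM hg) (by simp)
  have := setIntegral_preimage_of_Ioo hu.continuous hp (hG R) (fun a ha _ =>
    setIntegral_preimage_Ioo hu.continuous hp hG (fun k h1 h2 h3 =>
      D.integral_comp_mul hu hU hgu hφ hM hg h1 h2 h3) ha) hB
  rwa [inter_eq_left.2 hBR] at this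

/-- `∇u · F` does not charge `{u ∈ N}` for a null set `N ⊆ (0, ∞)`. -/
theorem DivField.ae_eq_zero_of_null (D : DivField Ω m f s) (hu : LipschitzWith 1 u)
    (hU : {x | 0 < u x} ⊆ Ω) (hgu : HasDerivAlong Ω m f s u gu) {N : Set ℝ}
    (hN : MeasurableSet N) (hN0 : volume N = 0) (hNp : N ⊆ Ioi 0) :
    ∀ᵐ x ∂m, u x ∈ N → gu x = 0 := by
  -- The coarea formula is available on bounded sets of levels. There its right side vanishes for
  -- null sets, so the restricted gu is orthogonal to every test function.
  have hR : ∀ R : ℕ, ∀ᵐ x ∂m, u x ∈ N ∩ Ioo (0 : ℝ) R → gu x = 0 := fun R => by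
    have hNR : MeasurableSet (N ∩ Ioo (0 : ℝ) R) := hN.inter measurableSet_Ioo
    have hs : MeasurableSet (u ⁻¹' (N ∩ Ioo (0 : ℝ) R)) := hu.continuous.measurable hNR
    set q : Euc n → ℝ := (u ⁻¹' (N ∩ Ioo (0 : ℝ) R)).indicator gu with hq
    have hqi : Integrable q m := hgu.1.indicator hs
    have h0 : ∀ᵐ x ∂m, x ∈ Ω → q x = 0 := by
      refine D.isOpen.ae_eq_zero_of_integral_contDiff_smul_eq_zero
        (hqi.locallyIntegrable.locallyIntegrableOn _) fun η h1 h2 h3 => ?_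
      have hη : IsC1c Ω η := IsCinfc.isC1c ⟨h1, h2, h3⟩
      obtain ⟨M, hM⟩ := hη.exists_bound
      have := D.setIntegral_preimage hu hU hgu hη.1.continuous.continuousOn (fun x _ => hM x)
        (D.hasDerivAlong_of_isC1c hη) hNR inter_subset_right
      rw [setIntegral_measure_zero _ (measure_mono_null inter_subset_left hN0),
        ← integral_indicator hs] at this
      rw [← this]
      refine integral_congr_ae (ae_of_all _ fun x => ?_)
      change η x * q x = _
      by_cases hx : x ∈ u ⁻¹' (N ∩ Ioo (0 : ℝ) R)
      · rw [hq, indicator_of_mem hx, indicator_of_mem hx]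
      · rw [hq, indicator_of_notMem hx, indicator_of_notMem hx, mul_zero]
    filter_upwards [h0, D.ae_mem] with x hx hxΩ hxN
    have := hx hxΩ
    rwa [hq, indicator_of_mem (show x ∈ u ⁻¹' (N ∩ Ioo (0 : ℝ) R) from hxN)] at this
  filter_upwards [ae_all_iff.2 hR] with x hx hxN
  obtain ⟨R, hR⟩ := exists_nat_gt (u x)
  exact hx R ⟨hxN, hNp hxN, hR⟩

end Flux

/-! ### Disintegration along the level sets of a continuous function. -/

section Disintegration

variable {l : Measure (Euc n)} [IsFiniteMeasure l] {u : Euc n → ℝ}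

/-- The graph measure of `u` over `l`. -/
def graphMeasure (l : Measure (Euc n)) (u : Euc n → ℝ) : Measure (ℝ × Euc n) :=
  l.map fun x => (u x, x)

instance : IsFiniteMeasure (graphMeasure l u) := by
  unfold graphMeasure
  infer_instance

theorem measurable_graph (hu : Continuous u) : Measurable fun x : Euc n => (u x, x) :=
  hu.measurable.prodMk measurable_id

omit [IsFiniteMeasure l] in
theorem fst_graphMeasure (hu : Continuous u) : (graphMeasure l u).fst = l.map u := by
  unfold graphMeasure Measure.fst
  rw [Measure.map_map measurable_fst (measurable_graph hu)]
  rfl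

/-- The disintegration of `l` with respect to the Lebesgue measure, along the level sets of `u`. -/
def levelMeasure (l : Measure (Euc n)) [IsFiniteMeasure l] (u : Euc n → ℝ) (t : ℝ) :
    Measure (Euc n) :=
  ENNReal.ofReal (((graphMeasure l u).fst.rnDeriv volume t).toReal) •
    (graphMeasure l u).condKernel t

instance (t : ℝ) : IsFiniteMeasure (levelMeasure l u t) := by
  unfold levelMeasure
  exact Measure.smul_finite _ ENNReal.ofReal_ne_top

theorem integral_levelMeasure (p : Euc n → ℝ) (t : ℝ) : ∫ x, p x ∂levelMeasure l u t =
    ((graphMeasure l u).fst.rnDeriv volume t).toReal •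
      ∫ x, p x ∂(graphMeasure l u).condKernel t := by
  unfold levelMeasure
  rw [integral_smul_measure, ENNReal.toReal_ofReal ENNReal.toReal_nonneg]

/-- The conditional measures have the property for almost every t with respect to the image of l
under u, that is, for almost every t where its Lebesgue density is nonzero. Elsewhere the level
measure is zero. -/
theorem ae_levelMeasure (hu : Continuous u) (hac : l.map u ≪ volume) {P : ℝ × Euc n → Prop}
    (hP : MeasurableSet {z | P z}) (h : ∀ᵐ x ∂l, P (u x, x)) :
    ∀ᵐ t, ∀ᵐ x ∂levelMeasure l u t, P (t, x) := by
  have h1 : ∀ᵐ z ∂graphMeasure l u, P z :=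
    (ae_map_iff (measurable_graph hu).aemeasurable hP).2 h
  rw [← (graphMeasure l u).disintegrate (graphMeasure l u).condKernel] at h1
  have h2 := Measure.ae_ae_of_ae_compProd h1
  have hac' : (graphMeasure l u).fst ≪ volume := by rwa [fst_graphMeasure hu]
  rw [← Measure.withDensity_rnDeriv_eq _ _ hac',
    ae_withDensity_iff (Measure.measurable_rnDeriv _ _)] at h2
  filter_upwards [h2] with t ht
  by_cases h0 : (graphMeasure l u).fst.rnDeriv volume t = 0
  · simp [levelMeasure, h0]
  · exact Measure.ae_smul_measure (ht h0) _

theorem setIntegral_levelMeasure (hu : Continuous u) (hac : l.map u ≪ volume) {p : Euc n → ℝ}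
    (hp : Integrable p l) {B : Set ℝ} (hB : MeasurableSet B) :
    ∫ t in B, ∫ x, p x ∂levelMeasure l u t = ∫ x in u ⁻¹' B, p x ∂l := by
  have hac' : (graphMeasure l u).fst ≪ volume := by rwa [fst_graphMeasure hu]
  have hpm : AEStronglyMeasurable (fun z : ℝ × Euc n => p z.2) (graphMeasure l u) := by
    refine hp.aestronglyMeasurable.comp_quasiMeasurePreserving ⟨measurable_snd, ?_⟩
    unfold graphMeasure
    rw [Measure.map_map measurable_snd (measurable_graph hu)]
    exact (Measure.map_id (μ := l)).absolutelyContinuous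
  have hpg : Integrable (fun z : ℝ × Euc n => p z.2) (graphMeasure l u) := by
    unfold graphMeasure at hpm ⊢
    exact (integrable_map_measure hpm (measurable_graph hu).aemeasurable).2 hp
  simp only [integral_levelMeasure]
  rw [setIntegral_rnDeriv_smul hac' hB]
  have := Measure.setIntegral_condKernel hB MeasurableSet.univ hpg.integrableOn
  simp only [Measure.restrict_univ] at this
  rw [this]
  unfold graphMeasure at hpm ⊢
  rw [setIntegral_map (hB.prod MeasurableSet.univ) hpm (measurable_graph hu).aemeasurable]
  congr 2
  ext x
  simp

theorem integrable_integral_levelMeasure (hu : Continuous u) (hac : l.map u ≪ volume)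
    {p : Euc n → ℝ} (hp : Integrable p l) :
    Integrable fun t => ∫ x, p x ∂levelMeasure l u t := by
  have hac' : (graphMeasure l u).fst ≪ volume := by rwa [fst_graphMeasure hu]
  have hpm : AEStronglyMeasurable (fun z : ℝ × Euc n => p z.2) (graphMeasure l u) := by
    refine hp.aestronglyMeasurable.comp_quasiMeasurePreserving ⟨measurable_snd, ?_⟩
    unfold graphMeasure
    rw [Measure.map_map measurable_snd (measurable_graph hu)]
    exact (Measure.map_id (μ := l)).absolutelyContinuous
  have hpg : Integrable (fun z : ℝ × Euc n => p z.2) (graphMeasure l u) := by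
    unfold graphMeasure at hpm ⊢
    exact (integrable_map_measure hpm (measurable_graph hu).aemeasurable).2 hp
  simp only [integral_levelMeasure]
  rw [integrable_rnDeriv_smul_iff hac']
  exact hpg.integral_condKernel

end Disintegration

/-! ### Polar decomposition of the pairing on {u > 0}, and dense families of test functions. -/

section Density

variable {m : Measure (Euc n)} {u gu : Euc n → ℝ}

/-- The variation of `gu m` on `{u > 0}`. -/
def posVariation (m : Measure (Euc n)) (u gu : Euc n → ℝ) : Measure (Euc n) :=
  (m.restrict {x | 0 < u x}).withDensity fun x => (‖gu x‖₊ : ENNReal)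

theorem isFiniteMeasure_posVariation (hgu : Integrable gu m) :
    IsFiniteMeasure (posVariation m u gu) :=
  isFiniteMeasure_withDensity (hgu.integrableOn (s := {x | 0 < u x})).2.ne

/-- The sign of a real-valued function. -/
def signFn (gu : Euc n → ℝ) (x : Euc n) : ℝ := gu x / |gu x|

theorem measurable_signFn (h : Measurable gu) : Measurable (signFn gu) := h.div h.norm

theorem abs_signFn_le (gu : Euc n → ℝ) (x : Euc n) : |signFn gu x| ≤ 1 := by
  unfold signFn
  rw [abs_div, abs_abs]
  exact div_self_le_one _

theorem abs_mul_signFn (gu : Euc n → ℝ) (x : Euc n) : |gu x| * signFn gu x = gu x := by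
  unfold signFn
  rcases eq_or_ne (gu x) 0 with h | h
  · simp [h]
  · exact mul_div_cancel₀ _ (abs_ne_zero.2 h)

theorem setIntegral_posVariation (hu : Continuous u) (hg : Measurable gu) (p : Euc n → ℝ)
    {B : Set ℝ} (hB : MeasurableSet B) (hB0 : B ⊆ Ioi 0) :
    ∫ x in u ⁻¹' B, p x * signFn gu x ∂posVariation m u gu =
      ∫ x in u ⁻¹' B, p x * gu x ∂m := by
  unfold posVariation
  rw [setIntegral_withDensity_eq_setIntegral_smul hg.nnnorm _ (hu.measurable hB),
    Measure.restrict_restrict (hu.measurable hB),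
    inter_eq_left.2 (show u ⁻¹' B ⊆ {x | 0 < u x} from fun x hx => hB0 hx)]
  refine integral_congr_ae (ae_of_all _ fun x => ?_)
  change ‖gu x‖ * (p x * signFn gu x) = _
  rw [mul_left_comm, Real.norm_eq_abs, abs_mul_signFn]

end Density

/-- Subsets of the separable space of continuous functions on a closed ball are separable. Density
in the uniform norm alone is enough, since the flux will be bounded without reference to gradients.
-/
theorem exists_countable_dense_isC1c_ball (Ω : Set (Euc n)) (j : ℕ) :
    ∃ c : Set (Euc n → ℝ), c.Countable ∧ (∀ ψ ∈ c, IsC1c Ω ψ) ∧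
      ∀ ψ, IsC1c Ω ψ → (∀ x ∉ Metric.closedBall (0 : Euc n) j, ψ x = 0) → ∀ ε, 0 < ε →
        ∃ ψ' ∈ c, ∀ x, |ψ x - ψ' x| ≤ ε := by
  let X := {ψ : Euc n → ℝ // IsC1c Ω ψ ∧ ∀ x ∉ Metric.closedBall (0 : Euc n) j, ψ x = 0}
  have : CompactSpace (Metric.closedBall (0 : Euc n) j) :=
    isCompact_iff_compactSpace.1 (isCompact_closedBall _ _)
  let r : X → C(Metric.closedBall (0 : Euc n) j, ℝ) := fun ψ =>
    ⟨fun x => ψ.1 x, ψ.2.1.1.continuous.comp continuous_subtype_val⟩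
  obtain ⟨c', hc', hd⟩ := TopologicalSpace.exists_countable_dense (range r)
  refine ⟨(fun y : range r => (y.2.choose : X).1) '' c', hc'.image _, ?_, fun ψ hψ hψ0 ε hε => ?_⟩
  · rintro _ ⟨y, -, rfl⟩
    exact (y.2.choose : X).2.1
  · obtain ⟨y, hy, hlt⟩ := hd.exists_dist_lt ⟨r ⟨ψ, hψ, hψ0⟩, mem_range_self _⟩ hε
    refine ⟨_, mem_image_of_mem _ hy, fun x => ?_⟩
    have hsp : r y.2.choose = y.1 := y.2.choose_spec
    by_cases hx : x ∈ Metric.closedBall (0 : Euc n) j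
    · have h1 := (ContinuousMap.dist_apply_le_dist (f := r ⟨ψ, hψ, hψ0⟩) (g := y.1) ⟨x, hx⟩).trans
        hlt.le
      rw [← hsp] at h1
      exact h1
    · rw [hψ0 x hx, (y.2.choose : X).2.2 x hx, sub_zero, abs_zero]
      exact hε.le

theorem exists_countable_dense_isC1c (Ω : Set (Euc n)) :
    ∃ c : Set (Euc n → ℝ), c.Countable ∧ (∀ ψ ∈ c, IsC1c Ω ψ) ∧
      ∀ ψ, IsC1c Ω ψ → ∀ ε, 0 < ε → ∃ ψ' ∈ c, ∀ x, |ψ x - ψ' x| ≤ ε := by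
  choose c h1 h2 h3 using exists_countable_dense_isC1c_ball Ω
  refine ⟨⋃ j, c j, countable_iUnion h1, fun ψ hψ => ?_, fun ψ hψ ε hε => ?_⟩
  · obtain ⟨j, hj⟩ := mem_iUnion.1 hψ
    exact h2 j ψ hj
  · obtain ⟨R, hR⟩ := hψ.2.1.isCompact.isBounded.subset_closedBall (0 : Euc n)
    obtain ⟨j, hj⟩ := exists_nat_ge R
    obtain ⟨ψ', h, h'⟩ := h3 j ψ hψ (fun x hx => by
      by_contra h0
      exact hx (Metric.closedBall_subset_closedBall hj (hR (subset_tsupport _ h0)))) ε hε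
    exact ⟨ψ', mem_iUnion.2 ⟨j, h⟩, h'⟩

/-- This cut-off moves the support of a test function into {u > 0} without affecting its flux at
level t. -/
theorem exists_smooth_superlevel {u : Euc n → ℝ} (hu : Continuous u) {t : ℝ} (ht : 0 < t) :
    ∃ w : Euc n → ℝ, ContDiff ℝ ∞ w ∧ (∀ x, |w x| ≤ 1) ∧ (∀ x, t ≤ u x → w x = 1) ∧
      (∀ x, t < u x → w =ᶠ[𝓝 x] fun _ => 1) ∧ tsupport w ⊆ {x | t / 2 ≤ u x} := by
  have hdisj : Disjoint {x | u x ≤ t / 2} {x | t ≤ u x} := by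
    rw [Set.disjoint_left]
    intro x hx hx'
    have h1 : u x ≤ t / 2 := hx
    have h2 : t ≤ u x := hx'
    linarith
  obtain ⟨w, h0, h1, h2⟩ := exists_contMDiffMap_zero_one_of_isClosed (n := (⊤ : ℕ∞))
    (modelWithCornersSelf ℝ (Euc n)) (isClosed_le hu continuous_const)
    (isClosed_le continuous_const hu) hdisj
  refine ⟨w, w.contMDiff.contDiff, fun x => ?_, fun x hx => h1 hx, fun x hx => ?_, ?_⟩
  · rw [abs_of_nonneg (h2 x).1]
    exact (h2 x).2
  · filter_upwards [(isOpen_lt continuous_const hu).mem_nhds hx] with y hy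
    exact h1 (le_of_lt hy)
  · refine closure_minimal (fun x hx => ?_) (isClosed_le continuous_const hu)
    by_contra hlt
    have hlt' : u x ≤ t / 2 := (not_le.1 hlt).le
    exact hx (h0 hlt')

/-! ### Representation of the flux by measures on almost every level set. -/

section LevelTrace

variable {Ω : Set (Euc n)} {m : Measure (Euc n)} {f : Euc n → Euc n} {s : Euc n → ℝ}
  {u gu φ g : Euc n → ℝ} [IsFiniteMeasure m]

/-- The density gu vanishes almost everywhere on the preimage of a null set of positive levels. -/
theorem DivField.map_posVariation_absolutelyContinuous (D : DivField Ω m f s)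
    (hu : LipschitzWith 1 u) (hU : {x | 0 < u x} ⊆ Ω) (hgu : HasDerivAlong Ω m f s u gu) :
    (posVariation m u gu).map u ≪ volume := by
  refine Measure.AbsolutelyContinuous.mk fun N hN hN0 => ?_
  have h := D.ae_eq_zero_of_null hu hU hgu (hN.inter measurableSet_Ioi)
    (measure_mono_null inter_subset_left hN0) inter_subset_right
  have hm := hu.continuous.measurable hN
  rw [Measure.map_apply hu.continuous.measurable hN]
  unfold posVariation
  rw [withDensity_apply _ hm, Measure.restrict_restrict hm]
  refine (lintegral_congr_ae ?_).trans lintegral_zero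
  filter_upwards [ae_restrict_of_ae h,
    ae_restrict_mem (hm.inter (measurableSet_super hu.continuous 0))] with x hx hx'
  rw [hx ⟨hx'.1, hx'.2⟩]
  simp

/-- Disintegration of `∇u · F` along the level sets of `u`. -/
theorem DivField.exists_disintegration (D : DivField Ω m f s) (hu : LipschitzWith 1 u)
    (hU : {x | 0 < u x} ⊆ Ω) (hgu : HasDerivAlong Ω m f s u gu) (hgm : Measurable gu) :
    ∃ L : ℝ → Measure (Euc n), (∀ t, IsFiniteMeasure (L t)) ∧ (∀ᵐ t, ∀ᵐ x ∂L t, u x = t) ∧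
      (∀ᵐ t, ∀ᵐ x ∂L t, x ∈ Ω) ∧ ∀ p : Euc n → ℝ, Measurable p → ∀ C, (∀ x, |p x| ≤ C) →
        Integrable (fun t => ∫ x, p x * signFn gu x ∂L t) ∧
        ∀ B, MeasurableSet B → B ⊆ Ioi 0 → ∫ t in B, ∫ x, p x * signFn gu x ∂L t =
          ∫ x in u ⁻¹' B, p x * gu x ∂m := by
  have := isFiniteMeasure_posVariation (u := u) hgu.1
  have hac := D.map_posVariation_absolutelyContinuous hu hU hgu
  have huc := hu.continuous
  refine ⟨levelMeasure (posVariation m u gu) u, fun t => inferInstance, ?_, ?_,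
    fun p hp C hC => ?_⟩
  · refine ae_levelMeasure huc hac (P := fun z => u z.2 = z.1) ?_ (ae_of_all _ fun x => rfl)
    exact measurableSet_eq_fun (huc.measurable.comp measurable_snd) measurable_fst
  · refine ae_levelMeasure huc hac (P := fun z => z.2 ∈ Ω)
      (measurable_snd D.isOpen.measurableSet) ?_
    have : posVariation m u gu ≪ m :=
      (withDensity_absolutelyContinuous _ _).trans Measure.restrict_le_self.absolutelyContinuous
    exact this.ae_le D.ae_mem
  · have hi : Integrable (fun x => p x * signFn gu x) (posVariation m u gu) := by
      refine Integrable.of_bound (hp.mul (measurable_signFn hgm)).aestronglyMeasurable (C * 1)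
        (ae_of_all _ fun x => ?_)
      rw [norm_mul]
      exact mul_le_mul (hC x) (abs_signFn_le gu x) (norm_nonneg _) ((abs_nonneg _).trans (hC x))
    refine ⟨integrable_integral_levelMeasure huc hac hi, fun B hB hB0 => ?_⟩
    rw [setIntegral_levelMeasure huc hac hi hB, setIntegral_posVariation huc hgm p hB hB0]

theorem DivField.flux_sub (D : DivField Ω m f s) {φ' g' : Euc n → ℝ} (hφ : ContinuousOn φ Ω)
    {M : ℝ} (hM : ∀ x ∈ Ω, |φ x| ≤ M) (hg : HasDerivAlong Ω m f s φ g) (hφ' : ContinuousOn φ' Ω)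
    {M' : ℝ} (hM' : ∀ x ∈ Ω, |φ' x| ≤ M') (hg' : HasDerivAlong Ω m f s φ' g') (t : ℝ) :
    flux m s u (fun x => φ x - φ' x) (fun x => g x - g' x) t =
      flux m s u φ g t - flux m s u φ' g' t := by
  unfold flux superInt
  rw [← integral_sub (D.integrable_flux_density hφ hM hg).integrableOn
    (D.integrable_flux_density hφ' hM' hg').integrableOn]
  exact integral_congr_ae (ae_of_all _ fun x => by ring)

/-- At a point t > 0 of differentiability of G(t) = ∫_{u ≤ t} |gu| dm one takes K = G'(t). By the
coarea formula the average of the flux over (t, t + h) is at most A (G(t + h) - G(t)) / h, and it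
tends to the flux at t by right continuity. The exceptional set depends on G only, hence not on φ.
-/
theorem DivField.ae_flux_le (D : DivField Ω m f s) (hu : LipschitzWith 1 u)
    (hU : {x | 0 < u x} ⊆ Ω) (hgu : HasDerivAlong Ω m f s u gu) :
    ∀ᵐ t : ℝ, 0 < t → ∃ K, 0 ≤ K ∧ ∀ φ g : Euc n → ℝ, ∀ M A : ℝ, ContinuousOn φ Ω →
      (∀ x ∈ Ω, |φ x| ≤ M) → HasDerivAlong Ω m f s φ g → (∀ x ∈ Ω, t < u x → |φ x| ≤ A) →
        0 ≤ A → |flux m s u φ g t| ≤ K * A := by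
  set G : ℝ → ℝ := fun t => ∫ x in {x | u x ≤ t}, |gu x| ∂m with hG
  have hms : ∀ t, MeasurableSet {x | u x ≤ t} := fun t =>
    (isClosed_le hu.continuous continuous_const).measurableSet
  have hmono : Monotone G := fun a b hab =>
    setIntegral_mono_set hgu.1.abs.integrableOn (ae_of_all _ fun _ => abs_nonneg _)
      (Eventually.of_forall fun x (hx : u x ≤ a) => hx.trans hab)
  filter_upwards [hmono.ae_differentiableAt] with t ht ht0
  have hsl : Tendsto (fun h => h⁻¹ * (G (t + h) - G t)) (𝓝[>] 0) (𝓝 (deriv G t)) := by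
    have := hasDerivAt_iff_tendsto_slope_zero.1 ht.hasDerivAt
    exact this.mono_left (nhdsWithin_mono _ fun x hx => ne_of_gt hx)
  have hK : 0 ≤ deriv G t := hmono.deriv_nonneg
  refine ⟨deriv G t, hK, fun φ g M A hφ hM hg hA hA0 => ?_⟩
  have h1 := (tendsto_average_superInt hu.continuous (D.integrable_flux_density hφ hM hg) t).abs
  refine le_of_tendsto_of_tendsto h1 (hsl.mul_const A) ?_
  filter_upwards [self_mem_nhdsWithin] with h hh
  have hh0 : (0 : ℝ) < h := hh
  have h2 := D.setIntegral_preimage hu hU hgu hφ hM hg (measurableSet_Ioo (a := t) (b := t + h))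
    (Ioo_subset_Ioo_left ht0.le)
  unfold flux at h2
  rw [← h2, abs_mul, abs_of_pos (one_div_pos.2 hh0), one_div, mul_assoc]
  refine mul_le_mul_of_nonneg_left ?_ (inv_pos.2 hh0).le
  have hGd : G (t + h) - G t = ∫ x in {x | u x ≤ t + h} \ {x | u x ≤ t}, |gu x| ∂m := by
    have hsub : {x | u x ≤ t} ⊆ {x | u x ≤ t + h} := fun x (hx : u x ≤ t) =>
      hx.trans (le_add_of_nonneg_right hh0.le)
    rw [setIntegral_sdiff (hms t) hgu.1.abs.integrableOn hsub]
  rw [hGd, mul_comm _ A, ← integral_const_mul]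
  have hsub : u ⁻¹' Ioo t (t + h) ⊆ {x | u x ≤ t + h} \ {x | u x ≤ t} := fun x hx =>
    ⟨hx.2.le, not_le.2 hx.1⟩
  rw [← Real.norm_eq_abs]
  refine (norm_integral_le_integral_norm _).trans ?_
  refine (setIntegral_mono_on_ae (g := fun x => A * |gu x|)
    (D.integrable_mul_of_bound hφ hM hgu.1).norm.integrableOn
    (hgu.1.abs.const_mul A).integrableOn (hu.continuous.measurable measurableSet_Ioo) ?_).trans
    (setIntegral_mono_set (hgu.1.abs.const_mul A).integrableOn
      (ae_of_all _ fun x => mul_nonneg hA0 (abs_nonneg _)) (Eventually.of_forall hsub))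
  filter_upwards [D.ae_mem] with x hx hxI
  rw [norm_mul]
  exact mul_le_mul_of_nonneg_right (hA x hx hxI.1) (norm_nonneg _)

theorem integrable_mul_signFn_of_ae_mem {l : Measure (Euc n)} [IsFiniteMeasure l]
    (hΩ : IsOpen Ω) (hl : ∀ᵐ x ∂l, x ∈ Ω) (hgm : Measurable gu) (hφ : ContinuousOn φ Ω) {M : ℝ}
    (hM : ∀ x ∈ Ω, |φ x| ≤ M) : Integrable (fun x => φ x * signFn gu x) l := by
  have hφl : AEStronglyMeasurable φ l := by
    rw [← Measure.restrict_eq_self_of_ae_mem hl]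
    exact hφ.aestronglyMeasurable hΩ.measurableSet
  refine Integrable.of_bound (hφl.mul (measurable_signFn hgm).aestronglyMeasurable) (M * 1) ?_
  filter_upwards [hl] with x hx
  rw [norm_mul]
  exact mul_le_mul (hM x hx) (abs_signFn_le gu x) (norm_nonneg _) ((abs_nonneg _).trans (hM x hx))

/-- Both sides are continuous in φ for the uniform norm, so the identity passes to uniform limits
whatever the gradients of the approximants do. -/
theorem DivField.flux_eq_of_approx (D : DivField Ω m f s) (hgm : Measurable gu) {t K : ℝ}
    {l : Measure (Euc n)} [IsFiniteMeasure l] (hl : ∀ᵐ x ∂l, x ∈ Ω)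
    (hK0 : 0 ≤ K) (hK : ∀ φ g : Euc n → ℝ, ∀ M A : ℝ, ContinuousOn φ Ω →
      (∀ x ∈ Ω, |φ x| ≤ M) → HasDerivAlong Ω m f s φ g → (∀ x ∈ Ω, t < u x → |φ x| ≤ A) →
        0 ≤ A → |flux m s u φ g t| ≤ K * A)
    (hφ : ContinuousOn φ Ω) {M : ℝ} (hM : ∀ x ∈ Ω, |φ x| ≤ M) (hg : HasDerivAlong Ω m f s φ g)
    (h : ∀ ε, 0 < ε → ∃ ψ, IsC1c Ω ψ ∧ (∀ x, |φ x - ψ x| ≤ ε) ∧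
      flux m s u ψ (fun x => inner ℝ (gradient ψ x) (f x)) t = ∫ x, ψ x * signFn gu x ∂l) :
    flux m s u φ g t = ∫ x, φ x * signFn gu x ∂l := by
  have hC : 0 ≤ K + l.real univ := add_nonneg hK0 measureReal_nonneg
  refine eq_of_abs_sub_le_all fun ε hε => ?_
  -- The flux changes by at most K times the uniform error and the integral by at most the mass of l
  -- times it; the summand 1 keeps the divisor positive.
  obtain ⟨ψ, hψ, hψφ, he⟩ := h (ε / (K + l.real univ + 1)) (by positivity)
  set η := ε / (K + l.real univ + 1) with hη
  have hη0 : 0 ≤ η := by positivity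
  obtain ⟨B, hB⟩ := hψ.exists_bound
  have hgψ := D.hasDerivAlong_of_isC1c hψ
  have hsub := D.flux_sub (u := u) hφ hM hg hψ.1.continuous.continuousOn (fun x _ => hB x) hgψ t
  have hb1 := hK (fun x => φ x - ψ x) _ (M + B) η (hφ.sub hψ.1.continuous.continuousOn)
    (fun x hx => (abs_sub _ _).trans (add_le_add (hM x hx) (hB x)))
    (hg.sub D hφ hψ.1.continuous.continuousOn hgψ) (fun x _ _ => hψφ x) hη0
  have i1 := integrable_mul_signFn_of_ae_mem D.isOpen hl hgm hφ hM
  have i2 := integrable_mul_signFn_of_ae_mem D.isOpen hl hgm hψ.1.continuous.continuousOn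
    (fun x _ => hB x)
  have hb2 : |∫ x, (φ x * signFn gu x - ψ x * signFn gu x) ∂l| ≤ η * l.real univ := by
    rw [← Real.norm_eq_abs]
    refine norm_integral_le_of_norm_le_const (ae_of_all _ fun x => ?_)
    rw [← sub_mul, norm_mul]
    calc _ ≤ η * 1 := mul_le_mul (hψφ x) (abs_signFn_le gu x) (abs_nonneg _) hη0
      _ = η := mul_one η
  rw [integral_sub i1 i2, ← he] at hb2
  rw [hsub] at hb1
  have h3 : flux m s u φ g t - ∫ x, φ x * signFn gu x ∂l =
      (flux m s u φ g t - flux m s u ψ (fun x => inner ℝ (gradient ψ x) (f x)) t) -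
      (∫ x, φ x * signFn gu x ∂l - flux m s u ψ (fun x => inner ℝ (gradient ψ x) (f x)) t) := by
    ring
  rw [h3]
  refine (abs_sub _ _).trans ((add_le_add hb1 hb2).trans ?_)
  have : K * η + η * l.real univ = (K + l.real univ) * η := by ring
  rw [this, hη, mul_div_assoc', div_le_iff₀ (by positivity)]
  nlinarith

/-- For almost every `t`, the flux through `∂{u > t}` is represented by the measure `sgn L_t`. -/
theorem DivField.exists_levelTrace (D : DivField Ω m f s) (hu : LipschitzWith 1 u)
    (hU : {x | 0 < u x} ⊆ Ω) (hgu : HasDerivAlong Ω m f s u gu) (hgm : Measurable gu) :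
    ∃ L : ℝ → Measure (Euc n), (∀ t, IsFiniteMeasure (L t)) ∧
      (∀ p : Euc n → ℝ, Measurable p → ∀ C, (∀ x, |p x| ≤ C) →
        Integrable (fun t => ∫ x, p x * signFn gu x ∂L t) ∧
        ∫ t in Ioi (0 : ℝ), ∫ x, p x * signFn gu x ∂L t = ∫ x in {x | 0 < u x}, p x * gu x ∂m) ∧
      ∀ᵐ t : ℝ, (∀ᵐ x ∂L t, u x = t) ∧ (∀ᵐ x ∂L t, x ∈ Ω) ∧
        (0 < t → ∀ φ g : Euc n → ℝ, ContinuousOn φ Ω → (∃ M, ∀ x ∈ Ω, |φ x| ≤ M) →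
          HasDerivAlong Ω m f s φ g →
          flux m s u φ g t = ∫ x, φ x * signFn gu x ∂L t) := by
  obtain ⟨L, hL, hLu, hLΩ, hLp⟩ := D.exists_disintegration hu hU hgu hgm
  refine ⟨L, hL, fun p hp C hC => ⟨(hLp p hp C hC).1, (hLp p hp C hC).2 _ measurableSet_Ioi
    subset_rfl⟩, ?_⟩
  have huc := hu.continuous
  obtain ⟨c, hc, hcΩ, hcd⟩ := exists_countable_dense_isC1c Ω
  -- the identity for a single test function
  have hone : ∀ ψ, IsC1c Ω ψ → ∀ᵐ t : ℝ, 0 < t →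
      flux m s u ψ (fun x => inner ℝ (gradient ψ x) (f x)) t = ∫ x, ψ x * signFn gu x ∂L t := by
    intro ψ hψ
    obtain ⟨B, hB⟩ := hψ.exists_bound
    have hgψ := D.hasDerivAlong_of_isC1c hψ
    have hψc := hψ.1.continuous
    have hp := hLp ψ hψc.measurable B hB
    have hR : ∀ R : ℕ, ∀ᵐ t : ℝ, t ∈ Ioo (0 : ℝ) R →
        flux m s u ψ (fun x => inner ℝ (gradient ψ x) (f x)) t =
          ∫ x, ψ x * signFn gu x ∂L t := fun R => by
      rw [← ae_restrict_iff' measurableSet_Ioo]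
      refine Integrable.ae_eq_of_forall_setIntegral_eq _ _ (integrableOn_superInt
        (D.integrable_flux_density hψc.continuousOn (fun x _ => hB x) hgψ) (by simp))
        hp.1.integrableOn fun A hA _ => ?_
      have hA' : MeasurableSet (A ∩ Ioo (0 : ℝ) R) := hA.inter measurableSet_Ioo
      rw [Measure.restrict_restrict hA, hp.2 _ hA' (fun t ht => ht.2.1)]
      exact (D.setIntegral_preimage hu hU hgu hψc.continuousOn (fun x _ => hB x) hgψ hA'
        inter_subset_right).symm
    filter_upwards [ae_all_iff.2 hR] with t ht ht0
    obtain ⟨R, hR⟩ := exists_nat_gt t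
    exact ht R ⟨ht0, hR⟩
  -- Countability yields one null set for the whole dense family.
  have hcall := (ae_ball_iff hc).2 fun ψ hψ => hone ψ (hcΩ ψ hψ)
  filter_upwards [hLu, hLΩ, hcall, D.ae_flux_le hu hU hgu] with t ht1 ht2 ht3 ht4
  refine ⟨ht1, ht2, fun ht0 => ?_⟩
  obtain ⟨K, hK0, hK⟩ := ht4 ht0
  have hfin := hL t
  -- all compactly supported functions of class `C¹`
  have hC1 : ∀ ψ, IsC1c Ω ψ → flux m s u ψ (fun x => inner ℝ (gradient ψ x) (f x)) t =
      ∫ x, ψ x * signFn gu x ∂L t := fun ψ hψ => by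
    obtain ⟨B, hB⟩ := hψ.exists_bound
    refine D.flux_eq_of_approx hgm ht2 hK0 hK hψ.1.continuous.continuousOn (fun x _ => hB x)
      (D.hasDerivAlong_of_isC1c hψ) fun ε hε => ?_
    obtain ⟨ψ', h1, h2⟩ := hcd ψ hψ ε hε
    exact ⟨ψ', hcΩ ψ' h1, h2, ht3 ψ' h1 ht0⟩
  rintro φ g hφ ⟨M, hM⟩ hg
  -- localized functions
  have hloc : ∀ χ, IsC1c Ω χ → flux m s u (fun x => χ x * φ x)
      (fun x => χ x * g x + φ x * inner ℝ (gradient χ x) (f x)) t =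
      ∫ x, χ x * φ x * signFn gu x ∂L t := fun χ hχ => by
    obtain ⟨B, hB⟩ := hχ.exists_bound
    have hcc : IsCc Ω fun x => χ x * φ x :=
      ⟨continuous_mul_of_tsupport_subset D.isOpen hχ.1.continuous hχ.2.2 hφ, hχ.2.1.mul_right,
        tsupport_mul_subset_left.trans hχ.2.2⟩
    refine D.flux_eq_of_approx hgm ht2 hK0 hK hcc.1.continuousOn (M := B * M) (fun x hx => ?_)
      (D.hasDerivAlong_mul hφ hg hχ) fun ε hε => ?_
    · rw [abs_mul]
      exact mul_le_mul (hB x) (hM x hx) (abs_nonneg _) ((abs_nonneg _).trans (hB x))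
    · obtain ⟨_, _, _, _, h4⟩ := hcc.exists_approx D.isOpen
      obtain ⟨η, h5, _, h6⟩ := h4 ε hε
      exact ⟨η, h5.isC1c, fun x => by rw [abs_sub_comm]; exact h6 x, hC1 η h5.isC1c⟩
  -- removing the localization
  obtain ⟨w, hw, hw1, hwo, hwe, hws⟩ := exists_smooth_superlevel huc ht0
  obtain ⟨χ, hχ, hχ1, ⟨C, hC⟩, hχe⟩ := exists_cutoff n
  have hwχ : ∀ j, IsC1c Ω fun x => w x * χ j x := fun j =>
    ⟨(hw.of_le (by simp)).mul (hχ j).isC1c.1, (hχ j).2.1.mul_left,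
      tsupport_mul_subset_left.trans (hws.trans fun x (hx : t / 2 ≤ u x) =>
        hU (lt_of_lt_of_le (half_pos ht0) hx))⟩
  have hbd : ∀ j x, |w x * χ j x| ≤ 1 := fun j x => by
    rw [abs_mul]
    exact mul_le_one₀ (hw1 x) (abs_nonneg _) (hχ1 j x)
  -- The flux sees only {u > t}, where w is locally constant. The possibly unbounded gradient of w
  -- therefore never enters.
  have hgr : ∀ j x, t < u x → gradient (fun y => w y * χ j y) x = gradient (χ j) x := by
    intro j x hx
    rw [gradient_mul (hw.differentiable (by simp) x) ((hχ j).isC1c.1.differentiable one_ne_zero x),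
      gradient_eq_zero_of_eventually_const (hwe x hx), (hwe x hx).eq_of_nhds, one_smul, smul_zero,
      add_zero]
  have hfd := D.integrable_flux_density hφ hM hg
  have L1 : Tendsto (fun j => flux m s u (fun x => w x * χ j x * φ x)
      (fun x => w x * χ j x * g x + φ x * inner ℝ (gradient (fun y => w y * χ j y) x) (f x)) t)
      atTop (𝓝 (flux m s u φ g t)) := by
    unfold flux superInt
    refine tendsto_integral_of_dominated_convergence
      (fun x => |-(g x + φ x * s x)| + M * C) (fun j => ?_)
      (hfd.abs.integrableOn.add (integrable_const _)) (fun j => ?_) ?_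
    · have := (D.integrable_flux_density (φ := fun x => w x * χ j x * φ x) (M := 1 * M)
        ((hwχ j).1.continuous.continuousOn.mul hφ) (fun x hx => ?_)
        (D.hasDerivAlong_mul hφ hg (hwχ j))).aestronglyMeasurable.restrict (s := {x | t < u x})
      · exact this
      · rw [abs_mul]
        exact mul_le_mul (hbd j x) (hM x hx) (abs_nonneg _) zero_le_one
    · filter_upwards [ae_restrict_mem (measurableSet_super huc t), ae_restrict_of_ae D.ae_mem]
        with x hx hxΩ
      rw [hgr j x hx]
      have e : -(w x * χ j x * g x + φ x * inner ℝ (gradient (χ j) x) (f x) +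
          w x * χ j x * φ x * s x) = w x * χ j x * (-(g x + φ x * s x)) -
            φ x * inner ℝ (gradient (χ j) x) (f x) := by ring
      rw [e]
      refine (norm_sub_le _ _).trans (add_le_add ?_ ?_)
      · rw [norm_mul]
        exact mul_le_of_le_one_left (norm_nonneg _) (hbd j x)
      · rw [norm_mul]
        exact mul_le_mul (hM x hxΩ) ((D.abs_inner_le _ x).trans (hC j x)) (norm_nonneg _)
          ((abs_nonneg _).trans (hM x hxΩ))
    · filter_upwards [ae_restrict_mem (measurableSet_super huc t)] with x hx
      refine tendsto_const_nhds.congr' ?_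
      filter_upwards [hχe x] with j hj
      rw [hgr j x hx, hj.1, hj.2, (hwe x hx).eq_of_nhds, inner_zero_left]
      ring
  have hLi := integrable_mul_signFn_of_ae_mem D.isOpen ht2 hgm hφ hM
  have L2 : Tendsto (fun j => ∫ x, w x * χ j x * φ x * signFn gu x ∂L t) atTop
      (𝓝 (∫ x, φ x * signFn gu x ∂L t)) := by
    refine tendsto_integral_of_dominated_convergence (fun x => |φ x * signFn gu x|) (fun j => ?_)
      hLi.abs (fun j => ae_of_all _ fun x => ?_) ?_
    · simp only [mul_assoc (w _ * χ j _)]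
      exact (hwχ j).1.continuous.aestronglyMeasurable.mul hLi.aestronglyMeasurable
    · rw [mul_assoc, norm_mul]
      exact mul_le_of_le_one_left (norm_nonneg _) (hbd j x)
    · filter_upwards [ht1] with x hx
      refine tendsto_const_nhds.congr' ?_
      filter_upwards [hχe x] with j hj
      rw [hj.1, hwo x hx.ge, one_mul, one_mul]
  exact tendsto_nhds_unique L1 (L2.congr fun j => (hloc _ (hwχ j)).symm)

end LevelTrace

/-! ### Distance functions and level sets. -/

section Geometry

variable {U : Set (Euc n)}

/-- The distance to the complement. -/
def complDist (U : Set (Euc n)) (x : Euc n) : ℝ := Metric.infDist x Uᶜ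

theorem lipschitzWith_complDist (U : Set (Euc n)) : LipschitzWith 1 (complDist U) :=
  Metric.lipschitz_infDist_pt _

theorem frontier_subset_compl (hU : IsOpen U) : frontier U ⊆ Uᶜ := by
  rw [hU.frontier_eq]
  exact fun x hx => hx.2

theorem setOf_complDist_pos (hU : IsOpen U) (h : (frontier U).Nonempty) :
    {x | 0 < complDist U x} = U := by
  ext x
  have := (hU.isClosed_compl.notMem_iff_infDist_pos (h.mono (frontier_subset_compl hU)) (x := x))
  rw [notMem_compl_iff] at this
  exact this.symm

/-- A nearest point of the complement is a limit of points of the open ball reaching up to it, which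
lies in U; so it is a boundary point. -/
theorem bdryDist_eq_complDist (hU : IsOpen U) (h : (frontier U).Nonempty) {x : Euc n}
    (hx : x ∈ U) : bdryDist U x = complDist U x := by
  have hne : (Uᶜ).Nonempty := h.mono (frontier_subset_compl hU)
  refine le_antisymm ?_ (Metric.infDist_le_infDist_of_subset (frontier_subset_compl hU) h)
  obtain ⟨y, hy, hxy⟩ := hU.isClosed_compl.exists_infDist_eq_dist hne x
  have hpos : 0 < Metric.infDist x Uᶜ := by
    have : x ∈ {x | 0 < complDist U x} := by rwa [setOf_complDist_pos hU h]
    exact this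
  have hyc : y ∈ closure U := by
    have h1 : y ∈ Metric.closedBall x (Metric.infDist x Uᶜ) := by
      rw [Metric.mem_closedBall, dist_comm, hxy]
    rw [← closure_ball x hpos.ne'] at h1
    exact closure_mono Metric.ball_infDist_compl_subset h1
  have hyf : y ∈ frontier U := by
    rw [hU.frontier_eq]
    exact ⟨hyc, hy⟩
  change Metric.infDist x (frontier U) ≤ Metric.infDist x Uᶜ
  rw [hxy]
  exact Metric.infDist_le_dist_of_mem hyf

theorem innerApprox_eq (hU : IsOpen U) (h : (frontier U).Nonempty) {t : ℝ} (ht : 0 ≤ t) :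
    innerApprox U t = {x | t < complDist U x} := by
  ext x
  have hiff : x ∈ U → (ENNReal.ofReal t < Metric.infEDist x (frontier U) ↔ t < complDist U x) :=
    fun hx => by
      rw [ENNReal.ofReal_lt_iff_lt_toReal ht (Metric.infEDist_ne_top h),
        ← bdryDist_eq_complDist hU h hx]
      rfl
  constructor
  · rintro ⟨hx, hlt⟩
    exact (hiff hx).1 hlt
  · intro hx
    have hxU : x ∈ U := by
      rw [← setOf_complDist_pos hU h]
      exact lt_of_le_of_lt ht hx
    exact ⟨hxU, (hiff hxU).2 hx⟩

theorem innerApprox_of_frontier_eq_empty (h : frontier U = ∅) (t : ℝ) : innerApprox U t = U := by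
  ext x
  simp [innerApprox, h]

theorem bdryDist_of_frontier_eq_empty (h : frontier U = ∅) : bdryDist U = fun _ => 0 := by
  ext x
  simp [bdryDist, h]

theorem lipschitzWith_bdryDist (U : Set (Euc n)) : LipschitzWith 1 (bdryDist U) :=
  Metric.lipschitz_infDist_pt _

/-- For all but countably many `t`, the level set `{u = t}` lies on the boundary of `{u > t}`. -/
theorem countable_setOf_not_level_subset_frontier {u : Euc n → ℝ} :
    {t | ¬ {x | u x = t} ⊆ frontier {x | t < u x}}.Countable := by
  set b := TopologicalSpace.countableBasis (Euc n)
  have hb := TopologicalSpace.isBasis_countableBasis (Euc n)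
  -- An exceptional t is the maximum of u over some basic open set, attained there, and each basic
  -- set has at most one maximum.
  have hc : (⋃ o ∈ b, {t | ∃ x ∈ o, u x = t ∧ ∀ y ∈ o, u y ≤ t}).Countable := by
    refine (TopologicalSpace.countable_countableBasis _).biUnion fun o _ =>
      Set.Subsingleton.countable ?_
    rintro t ⟨x, hx, hxt, h⟩ t' ⟨x', hx', hxt', h'⟩
    have h1 := h x' hx'
    have h2 := h' x hx
    linarith
  refine hc.mono fun t ht => ?_
  by_contra hn
  refine ht fun x hx => ⟨?_, fun hi => ?_⟩
  · rw [hb.mem_closure_iff]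
    intro o ho hxo
    by_contra he
    refine hn (mem_iUnion₂.2 ⟨o, ho, x, hxo, hx, fun y hy => ?_⟩)
    by_contra hlt
    exact he ⟨y, hy, not_le.1 hlt⟩
  · have h0 : x ∈ {x | t < u x} := interior_subset hi
    have h1 : t < u x := h0
    have h2 : u x = t := hx
    linarith

end Geometry

/-! ### Translation between signed measures and densities. -/

section Integrals

variable {m : Measure (Euc n)} [IsFiniteMeasure m] {g φ : Euc n → ℝ} {A : Set (Euc n)}

theorem integ_withDensityV (hg : Integrable g m) (hφ : AEStronglyMeasurable φ m) {C : ℝ}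
    (hC : ∀ᵐ x ∂m, |φ x| ≤ C) : integ (m.withDensityᵥ g) φ = ∫ x, φ x * g x ∂m := by
  unfold integ
  rw [vintegral_withDensityV hg _ hφ hC]
  refine integral_congr_ae (ae_of_all _ fun x => ?_)
  simp [mul_comm]

theorem setInteg_withDensityV (hg : Integrable g m) (hA : MeasurableSet A)
    (hφ : AEStronglyMeasurable φ m) {C : ℝ} (hC : ∀ᵐ x ∂m, |φ x| ≤ C) :
    setInteg (m.withDensityᵥ g) A φ = ∫ x in A, φ x * g x ∂m := by
  unfold setInteg
  rw [restrict_withDensityV hg hA, vintegral_withDensityV hg.restrict _ hφ.restrict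
    (ae_restrict_of_ae hC)]
  refine integral_congr_ae (ae_of_all _ fun x => ?_)
  simp [mul_comm]

theorem dotInteg_withDensityV {f : Euc n → Euc n} (hf : Integrable f m) {X : Euc n → Euc n}
    (hX : AEStronglyMeasurable X m) {C : ℝ} (hC : ∀ᵐ x ∂m, ‖X x‖ ≤ C) :
    dotInteg (m.withDensityᵥ f) X = ∫ x, inner ℝ (X x) (f x) ∂m := by
  unfold dotInteg
  rw [vintegral_withDensityV hf _ hX hC]
  rfl

omit [IsFiniteMeasure m] in
theorem concentratedOn_withDensityV {V : Type*} [NormedAddCommGroup V] [NormedSpace ℝ V]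
    [CompleteSpace V] {f : Euc n → V} (hf : Integrable f m) (hA : m Aᶜ = 0) :
    ConcentratedOn (m.withDensityᵥ f) A := by
  unfold ConcentratedOn
  rw [Measure.variation_withDensityᵥ hf]
  exact withDensity_absolutelyContinuous _ _ hA

/-- A signed measure on `Ω` is determined by its integrals of test functions. -/
theorem signedMeasure_ext_of_integ {Ω : Set (Euc n)} (hΩ : IsOpen Ω)
    {μ μ' : SignedMeasure (Euc n)} (hμ : ConcentratedOn μ Ω) (hμ' : ConcentratedOn μ' Ω)
    (h : ∀ ψ, IsCinfc Ω ψ → integ μ ψ = integ μ' ψ) : μ = μ' := by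
  obtain ⟨a, ha, ha1, hμa⟩ := exists_density_signed μ (m := μ.variation + μ'.variation)
    (Measure.le_add_right le_rfl)
  obtain ⟨b, hb, hb1, hμb⟩ := exists_density_signed μ' (m := μ.variation + μ'.variation)
    (Measure.le_add_left le_rfl)
  set l := μ.variation + μ'.variation with hl
  have hl0 : l Ωᶜ = 0 := by
    have h1 : μ.variation Ωᶜ = 0 := hμ
    have h2 : μ'.variation Ωᶜ = 0 := hμ'
    rw [hl, Measure.add_apply, h1, h2, add_zero]
  have hai : Integrable a l := Integrable.of_bound ha.aestronglyMeasurable 1 (ae_of_all _ ha1)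
  have hbi : Integrable b l := Integrable.of_bound hb.aestronglyMeasurable 1 (ae_of_all _ hb1)
  have hae := hΩ.ae_eq_zero_of_integral_contDiff_smul_eq_zero (μ := l) (f := fun x => a x - b x)
    ((hai.sub hbi).locallyIntegrable.locallyIntegrableOn _) fun ψ h1 h2 h3 => by
      have hψ : IsCinfc Ω ψ := ⟨h1, h2, h3⟩
      obtain ⟨B, hB⟩ := hψ.isC1c.exists_bound
      have he := h ψ hψ
      rw [hμa, hμb, integ_withDensityV hai h1.continuous.aestronglyMeasurable (ae_of_all _ hB),
        integ_withDensityV hbi h1.continuous.aestronglyMeasurable (ae_of_all _ hB)] at he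
      simp only [smul_eq_mul, mul_sub]
      rw [integral_sub (hai.bdd_mul h1.continuous.aestronglyMeasurable (ae_of_all _ hB))
        (hbi.bdd_mul h1.continuous.aestronglyMeasurable (ae_of_all _ hB)), he, sub_self]
  rw [hμa, hμb]
  refine WithDensityᵥEq.congr_ae ?_
  have hΩl : ∀ᵐ x ∂l, x ∈ Ω := hl0
  filter_upwards [hae, hΩl] with x hx hxΩ
  exact sub_eq_zero.1 (hx hxΩ)

/-- Restriction to a Borel set carrying the measure does not change integrals. -/
theorem setInteg_eq_integ {μ : SignedMeasure (Euc n)} (hA : MeasurableSet A)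
    (hμ : ConcentratedOn μ A) (φ : Euc n → ℝ) : setInteg μ A φ = integ μ φ := by
  have : VectorMeasure.restrict μ A = μ := by
    obtain ⟨a, ha, ha1, hμa⟩ := exists_density_signed μ le_rfl
    have hai : Integrable a μ.variation :=
      Integrable.of_bound ha.aestronglyMeasurable 1 (ae_of_all _ ha1)
    have hm : ∀ᵐ x ∂μ.variation, x ∈ A := hμ
    conv_lhs => rw [hμa]
    rw [restrict_withDensityV hai hA, Measure.restrict_eq_self_of_ae_mem hm, ← hμa]
  unfold setInteg integ
  rw [this]

omit [IsFiniteMeasure m] in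
theorem ConcentratedOn.mono {V : Type*} [NormedAddCommGroup V] {μ : VectorMeasure (Euc n) V}
    {B : Set (Euc n)} (h : ConcentratedOn μ A) (hAB : A ⊆ B) : ConcentratedOn μ B :=
  measure_mono_null (compl_subset_compl.2 hAB) h

end Integrals

/-! ### Test functions belong to W^{1,∞}. -/

section Smooth

variable {Ω : Set (Euc n)} {ψ η : Euc n → ℝ}

theorem inner_gradient (φ : Euc n → ℝ) (x v : Euc n) : inner ℝ (gradient φ x) v = fderiv ℝ φ x v :=
  InnerProductSpace.toDual_symm_apply

theorem IsC1c.integrable_mul_fderiv {η ψ : Euc n → ℝ} (hψ : Continuous ψ) (hη : IsC1c Ω η)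
    (v : Euc n) : Integrable fun x => ψ x * fderiv ℝ η x v :=
  (hψ.mul ((hη.1.continuous_fderiv one_ne_zero).clm_apply continuous_const)).integrable_of_hasCompactSupport
    ((hη.2.1.fderiv_apply ℝ v).mul_left)

theorem isC1c_integral_smul_gradient {η ψ : Euc n → ℝ} (hψ : IsC1c Ω ψ) (hη : IsC1c Ω η) :
    ∫ x, ψ x • gradient η x = - ∫ x, η x • gradient ψ x := by
  have hi : ∀ {a b : Euc n → ℝ}, IsC1c Ω a → IsC1c Ω b → Integrable fun x => a x • gradient b x :=
    fun ha hb => (ha.1.continuous.smul (continuous_gradient hb.1)).integrable_of_hasCompactSupport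
      ha.2.1.smul_right
  refine ext_inner_left ℝ fun v => ?_
  rw [inner_neg_right, ← integral_inner (hi hψ hη), ← integral_inner (hi hη hψ)]
  have e : ∀ a b : Euc n → ℝ, ∀ x, inner ℝ v (a x • gradient b x) = a x * fderiv ℝ b x v :=
    fun a b x => by rw [real_inner_smul_right, real_inner_comm, inner_gradient]
  simp only [e]
  have h1 : Integrable fun x => fderiv ℝ ψ x v * η x := by
    simp only [mul_comm _ (η _)]
    exact hψ.integrable_mul_fderiv hη.1.continuous v
  rw [integral_mul_fderiv_eq_neg_fderiv_mul_of_integrable h1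
    (hη.integrable_mul_fderiv hψ.1.continuous v)
    ((hψ.1.continuous.mul hη.1.continuous).integrable_of_hasCompactSupport hψ.2.1.mul_right)
    (fun x _ => hψ.1.differentiable one_ne_zero x) fun x _ => hη.1.differentiable one_ne_zero x]
  simp only [mul_comm]

theorem IsC1c.isW1inf (hψ : IsC1c Ω ψ) : IsW1inf Ω ψ := by
  obtain ⟨B, hB⟩ := hψ.exists_bound
  obtain ⟨B', hB'⟩ := hψ.exists_bound_gradient
  refine ⟨hψ.1.continuous.continuousOn,
    memLp_top_of_bound hψ.1.continuous.aestronglyMeasurable B (ae_of_all _ hB), gradient ψ,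
    memLp_top_of_bound (continuous_gradient hψ.1).aestronglyMeasurable B' (ae_of_all _ hB'),
    fun η hη => ?_⟩
  rw [setIntegral_eq_integral_of_forall_compl_eq_zero fun x hx => ?_,
    setIntegral_eq_integral_of_forall_compl_eq_zero fun x hx => ?_]
  · exact isC1c_integral_smul_gradient hψ hη.isC1c
  · rw [image_eq_zero_of_notMem_tsupport fun h => hx (hη.2.2 h), zero_smul]
  · rw [image_eq_zero_of_notMem_tsupport fun h => hx (hψ.2.2 h), zero_smul]

end Smooth

end DivMeas

end

/-! ### The measures div F, the pairing and the trace: existence and uniqueness. -/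

noncomputable section

namespace DivMeas

open scoped BoundedContinuousFunction

variable {n : ℕ} {Ω : Set (Euc n)} {F : VectorMeasure (Euc n) (Euc n)}

theorem integrable_inner_gradient {m : Measure (Euc n)} [IsFiniteMeasure m] {f : Euc n → Euc n}
    (hf : Measurable f) (hf1 : ∀ x, ‖f x‖ ≤ 1) {ψ : Euc n → ℝ} (hψ : IsC1c Ω ψ) :
    Integrable (fun x => inner ℝ (gradient ψ x) (f x)) m := by
  obtain ⟨B, hB⟩ := hψ.exists_bound_gradient
  refine Integrable.of_bound ((continuous_gradient hψ.1).aestronglyMeasurable.inner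
    hf.aestronglyMeasurable) B (ae_of_all _ fun x => ?_)
  calc _ ≤ ‖gradient ψ x‖ * ‖f x‖ := norm_inner_le_norm _ _
    _ ≤ B * 1 := mul_le_mul (hB x) (hf1 x) (norm_nonneg _) ((norm_nonneg _).trans (hB x))
    _ = B := mul_one B

/-- A test function as a bounded continuous function. -/
def IsC1c.toBCF {ψ : Euc n → ℝ} (hψ : IsC1c Ω ψ) : Euc n →ᵇ ℝ :=
  BoundedContinuousFunction.ofNormedAddCommGroup ψ hψ.1.continuous hψ.exists_bound.choose
    hψ.exists_bound.choose_spec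

/-- Finiteness of the variation says that ψ ↦ -∫ ∇ψ · dF is bounded in the uniform norm on C¹_c(Ω).
It extends to all bounded continuous functions by Hahn-Banach and is then represented on compactly
supported ones by a finite measure. -/
theorem exists_isDivergence (hΩ : IsOpen Ω) (hF : IsDMext Ω F) : ∃ σ, IsDivergence Ω F σ := by
  obtain ⟨f, hf, hf1, hFf⟩ := exists_density_euclidean F le_rfl
  set m := F.variation with hm
  have hfi : Integrable f m := Integrable.of_bound hf.aestronglyMeasurable 1 (ae_of_all _ hf1)
  have hdot : ∀ ψ, IsC1c Ω ψ → dotInteg F (gradient ψ) = ∫ x, inner ℝ (gradient ψ x) (f x) ∂m :=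
    fun ψ hψ => by
      obtain ⟨B, hB⟩ := hψ.exists_bound_gradient
      rw [hFf]
      exact dotInteg_withDensityV hfi (continuous_gradient hψ.1).aestronglyMeasurable
        (ae_of_all _ hB)
  let L : c1cSubmodule Ω →ₗ[ℝ] ℝ :=
    { toFun := fun ψ => - ∫ x, inner ℝ (gradient ψ.1 x) (f x) ∂m
      map_add' := fun a b => by
        rw [← neg_add, ← integral_add (integrable_inner_gradient hf hf1 a.2)
          (integrable_inner_gradient hf hf1 b.2)]
        congr 1
        refine integral_congr_ae (ae_of_all _ fun x => ?_)
        change inner ℝ (gradient (fun y => a.1 y + b.1 y) x) (f x) = _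
        rw [gradient_add (a.2.1.differentiable one_ne_zero x)
          (b.2.1.differentiable one_ne_zero x), inner_add_left]
      map_smul' := fun c a => by
        rw [RingHom.id_apply, smul_eq_mul, mul_neg, ← integral_const_mul]
        congr 1
        refine integral_congr_ae (ae_of_all _ fun x => ?_)
        change inner ℝ (gradient (fun y => c * a.1 y) x) (f x) = _
        rw [gradient_const_mul c (a.2.1.differentiable one_ne_zero x), real_inner_smul_left] }
  let ι : c1cSubmodule Ω →ₗ[ℝ] (Euc n →ᵇ ℝ) :=
    { toFun := fun ψ => IsC1c.toBCF (Ω := Ω) ψ.2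
      map_add' := fun a b => rfl
      map_smul' := fun c a => rfl }
  set V := (divVariation Ω F).toReal
  have hV : ∀ ψ, IsC1c Ω ψ → (∀ x, |ψ x| ≤ 1) → ∫ x, inner ℝ (gradient ψ x) (f x) ∂m ≤ V :=
    fun ψ hψ h1 => by
      rw [← hdot ψ hψ]
      refine (ENNReal.ofReal_le_iff_le_toReal hF.2.ne).1 ?_
      exact le_iSup_of_le ψ (le_iSup_of_le hψ (le_iSup_of_le h1 le_rfl))
  have hL1 : ∀ v, - L v ≤ V * ‖ι v‖ := fun v => by
    rcases eq_or_ne ‖ι v‖ 0 with h0 | h0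
    · have : v = 0 := by
        ext x
        exact congrArg (fun q : Euc n →ᵇ ℝ => q x) (norm_eq_zero.1 h0)
      rw [this, map_zero, map_zero, norm_zero, mul_zero, neg_zero]
    · have hpos : 0 < ‖ι v‖ := lt_of_le_of_ne (norm_nonneg _) (Ne.symm h0)
      have h2 := hV _ (‖ι v‖⁻¹ • v).2 fun x => by
        change |‖ι v‖⁻¹ * v.1 x| ≤ 1
        rw [abs_mul, abs_of_pos (inv_pos.2 hpos), inv_mul_le_iff₀ hpos, mul_one]
        exact (ι v).norm_coe_le_norm x
      have h3 : - L (‖ι v‖⁻¹ • v) ≤ V := by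
        change - - _ ≤ V
        rwa [neg_neg]
      rw [map_smul, smul_eq_mul, ← mul_neg, inv_mul_le_iff₀ hpos] at h3
      linarith
  have hL : ∀ v, |L v| ≤ V * ‖ι v‖ := fun v => by
    refine abs_le.2 ⟨by linarith [hL1 v], ?_⟩
    have := hL1 (-v)
    rw [map_neg, map_neg, norm_neg, neg_neg] at this
    exact this
  obtain ⟨ℓ, hℓ⟩ := exists_continuous_factor ι L V hL
  obtain ⟨τ, hτ, s, hs, hrep⟩ := exists_measure_density_of_dual ℓ
  have hsi : Integrable s (τ.restrict Ω) := hs.restrict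
  -- The representing measure may charge the complement of Ω, since the extension is arbitrary.
  -- Restricting it to Ω changes no integral of a test function.
  refine ⟨(τ.restrict Ω).withDensityᵥ s, concentratedOn_withDensityV hsi ?_, fun φ hφ => ?_⟩
  · rw [Measure.restrict_apply hΩ.measurableSet.compl, compl_inter_self, measure_empty]
  · obtain ⟨B, hB⟩ := hφ.exists_bound
    rw [integ_withDensityV hsi hφ.1.continuous.aestronglyMeasurable (ae_of_all _ hB), hdot φ hφ]
    have h1 : L ⟨φ, hφ⟩ = ℓ (ι ⟨φ, hφ⟩) := hℓ _
    have h2 := hrep (ι ⟨φ, hφ⟩) hφ.2.1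
    rw [setIntegral_eq_integral_of_forall_compl_eq_zero fun x hx => ?_]
    · exact (h1.trans h2).symm
    · rw [image_eq_zero_of_notMem_tsupport fun h => hx (hφ.2.2 h), zero_mul]

theorem existsUnique_isDivergence (hΩ : IsOpen Ω) (hF : IsDMext Ω F) :
    ∃! σ, IsDivergence Ω F σ := by
  obtain ⟨σ, hσ⟩ := exists_isDivergence hΩ hF
  refine ⟨σ, hσ, fun σ' hσ' => signedMeasure_ext_of_integ hΩ hσ'.1 hσ.1 fun ψ hψ => ?_⟩
  rw [hσ'.2 ψ hψ.isC1c, hσ.2 ψ hψ.isC1c]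

/-- `F` and its divergence have bounded densities with respect to one finite measure. -/
structure Represents (Ω : Set (Euc n)) (F : VectorMeasure (Euc n) (Euc n)) (m : Measure (Euc n))
    (f : Euc n → Euc n) (s : Euc n → ℝ) : Prop extends DivField Ω m f s where
  eq_field : F = m.withDensityᵥ f
  eq_div : divMeasure Ω F = m.withDensityᵥ s

theorem exists_represents (hΩ : IsOpen Ω) (hF : IsDMext Ω F) :
    ∃ (m : Measure (Euc n)) (_ : IsFiniteMeasure m) (f : Euc n → Euc n) (s : Euc n → ℝ),
      Represents Ω F m f s := by
  have hex := exists_isDivergence hΩ hF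
  have hσ : IsDivergence Ω F (divMeasure Ω F) := by
    unfold divMeasure
    rw [dif_pos hex]
    exact hex.choose_spec
  set σ := divMeasure Ω F with hσdef
  obtain ⟨f, hf, hf1, hFf⟩ := exists_density_euclidean F (m := F.variation + σ.variation)
    (Measure.le_add_right le_rfl)
  obtain ⟨s, hs, hs1, hσs⟩ := exists_density_signed σ (m := F.variation + σ.variation)
    (Measure.le_add_left le_rfl)
  set m := F.variation + σ.variation with hm
  have hfi : Integrable f m := Integrable.of_bound hf.aestronglyMeasurable 1 (ae_of_all _ hf1)
  have hsi : Integrable s m := Integrable.of_bound hs.aestronglyMeasurable 1 (ae_of_all _ hs1)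
  refine ⟨m, inferInstance, f, s, ⟨⟨hΩ, ?_, hf, hf1, hs, hs1, fun ψ hψ => ?_⟩, hFf,
    hσdef.symm.trans hσs⟩⟩
  · have h1 : F.variation Ωᶜ = 0 := hF.1
    have h2 : σ.variation Ωᶜ = 0 := hσ.1
    rw [hm, Measure.add_apply, h1, h2, add_zero]
  · obtain ⟨B, hB⟩ := hψ.exists_bound
    obtain ⟨B', hB'⟩ := hψ.exists_bound_gradient
    have h := hσ.2 ψ hψ
    rw [hσs, integ_withDensityV hsi hψ.1.continuous.aestronglyMeasurable (ae_of_all _ hB)] at h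
    rw [h, hFf, dotInteg_withDensityV hfi (continuous_gradient hψ.1).aestronglyMeasurable
      (ae_of_all _ hB')]

section Pairing

variable {m : Measure (Euc n)} [IsFiniteMeasure m] {f : Euc n → Euc n} {s : Euc n → ℝ}
  {φ g : Euc n → ℝ}

theorem isPairing_unique (hΩ : IsOpen Ω) {μ μ' : SignedMeasure (Euc n)}
    (h : IsPairing Ω F φ μ) (h' : IsPairing Ω F φ μ') : μ = μ' := by
  obtain ⟨ρ, hρ⟩ := exists_isStdMollifier n
  exact signedMeasure_ext_of_integ hΩ h.1 h'.1 fun ψ hψ =>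
    tendsto_nhds_unique (h.2 ρ hρ ψ hψ.isC1c.isCc) (h'.2 ρ hρ ψ hψ.isC1c.isCc)

/-- The density g is characterised without mollifiers, so the limit is the same for every mollifier.
-/
theorem Represents.isPairing (R : Represents Ω F m f s) (hφ : ContinuousOn φ Ω)
    (hv : ∀ ρ, IsStdMollifier ρ → IsApprox Ω φ fun δ => mollify Ω ρ δ φ)
    (hg : HasDerivAlong Ω m f s φ g) : IsPairing Ω F φ (m.withDensityᵥ g) := by
  refine ⟨concentratedOn_withDensityV hg.1 R.null, fun ρ hρ ψ hψ => ?_⟩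
  have hfi : Integrable f m :=
    Integrable.of_bound R.meas_f.aestronglyMeasurable 1 (ae_of_all _ R.f_le)
  obtain ⟨B, hB⟩ := hψ.1.bounded_above_of_compact_support hψ.2.1
  rw [integ_withDensityV hg.1 hψ.1.aestronglyMeasurable (ae_of_all _ hB)]
  refine (R.tendsto_of_isCc hφ hg (hv ρ hρ) hψ).congr' ?_
  filter_upwards [self_mem_nhdsWithin] with δ hδ
  have hc : Continuous fun x => ψ x • gradient (mollify Ω ρ δ φ) x :=
    hψ.1.smul (continuous_gradient ((hv ρ hρ).contDiff δ hδ))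
  obtain ⟨B', hB'⟩ := hc.bounded_above_of_compact_support hψ.2.1.smul_right
  rw [R.eq_field, dotInteg_withDensityV hfi hc.aestronglyMeasurable (ae_of_all _ hB')]
  simp only [real_inner_smul_left]

theorem Represents.pairing_eq (R : Represents Ω F m f s) (hφ : ContinuousOn φ Ω)
    (hv : ∀ ρ, IsStdMollifier ρ → IsApprox Ω φ fun δ => mollify Ω ρ δ φ)
    (hg : HasDerivAlong Ω m f s φ g) : pairing Ω F φ = m.withDensityᵥ g := by
  have hex : ∃ μ, IsPairing Ω F φ μ := ⟨_, R.isPairing hφ hv hg⟩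
  unfold pairing
  rw [dif_pos hex]
  exact isPairing_unique R.isOpen hex.choose_spec (R.isPairing hφ hv hg)

theorem Represents.existsUnique_isPairing (R : Represents Ω F m f s) (hφ : ContinuousOn φ Ω)
    (hv : ∀ ρ, IsStdMollifier ρ → IsApprox Ω φ fun δ => mollify Ω ρ δ φ) :
    ∃! μ, IsPairing Ω F φ μ := by
  obtain ⟨ρ, hρ⟩ := exists_isStdMollifier n
  obtain ⟨g, -, hg⟩ := R.exists_hasDerivAlong hφ (hv ρ hρ)
  exact ⟨_, R.isPairing hφ hv hg, fun μ hμ => isPairing_unique R.isOpen hμ (R.isPairing hφ hv hg)⟩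

/-- For fixed φ the trace is a measure in E with an integrable density; on superlevel sets it is the
flux. -/
theorem Represents.normalTrace_eq (R : Represents Ω F m f s) (hφ : IsW1inf Ω φ)
    (hg : HasDerivAlong Ω m f s φ g) {E : Set (Euc n)} (hE : MeasurableSet E) :
    normalTrace Ω F E φ = ∫ x in E, -(g x + φ x * s x) ∂m := by
  obtain ⟨M, hM⟩ := hφ.exists_bound R.isOpen
  have hsi : Integrable s m :=
    Integrable.of_bound R.meas_s.aestronglyMeasurable 1 (ae_of_all _ R.s_le)
  unfold normalTrace
  rw [R.pairing_eq hφ.1 (fun ρ hρ => isApprox_mollify_of_isW1inf R.isOpen hρ hφ) hg, R.eq_div,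
    withDensityᵥ_apply hg.1 hE, setInteg_withDensityV hsi hE (R.aestronglyMeasurable hφ.1)
      (R.ae_mem.mono fun x hx => hM x hx), integral_neg, integral_add hg.1.integrableOn
      (R.integrable_mul_s hφ.1 hM).integrableOn]
  ring

/-- Uniqueness of the measure representing the normal trace. -/
theorem isTraceMeasure_unique (hΩ : IsOpen Ω) {E : Set (Euc n)} {μ μ' : SignedMeasure (Euc n)}
    (h : IsTraceMeasure Ω F E μ) (h' : IsTraceMeasure Ω F E μ') : μ = μ' := by
  refine signedMeasure_ext_of_integ hΩ (h.1.mono inter_subset_right) (h'.1.mono inter_subset_right)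
    fun ψ hψ => ?_
  have hm : MeasurableSet (frontier E) := isClosed_frontier.measurableSet
  rw [← setInteg_eq_integ hm (h.1.mono inter_subset_left),
    ← setInteg_eq_integ hm (h'.1.mono inter_subset_left), ← h.2 ψ hψ.isC1c.isW1inf,
    ← h'.2 ψ hψ.isC1c.isW1inf]

theorem IsTraceMeasure.existsUnique (hΩ : IsOpen Ω) {E : Set (Euc n)} {μ : SignedMeasure (Euc n)}
    (h : IsTraceMeasure Ω F E μ) : ∃! μ, IsTraceMeasure Ω F E μ :=
  ⟨μ, h, fun _ h' => isTraceMeasure_unique hΩ h' h⟩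

theorem IsTraceMeasure.traceMeasure_eq (hΩ : IsOpen Ω) {E : Set (Euc n)}
    {μ : SignedMeasure (Euc n)} (h : IsTraceMeasure Ω F E μ) : traceMeasure Ω F E = μ := by
  have hex : ∃ μ, IsTraceMeasure Ω F E μ := ⟨μ, h⟩
  unfold traceMeasure
  rw [dif_pos hex]
  exact isTraceMeasure_unique hΩ hex.choose_spec h

end Pairing

end DivMeas

end

noncomputable section

namespace DivMeas

variable {n : ℕ} {Ω U : Set (Euc n)} {F : VectorMeasure (Euc n) (Euc n)}
  {m : Measure (Euc n)} [IsFiniteMeasure m] {f : Euc n → Euc n} {s u gu φ g : Euc n → ℝ}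

/-! ### The case of an empty boundary. -/

section EmptyBoundary

omit [IsFiniteMeasure m] in
theorem setInteg_zero (A : Set (Euc n)) (φ : Euc n → ℝ) : setInteg 0 A φ = 0 := by
  unfold setInteg
  rw [VectorMeasure.restrict_zero]
  simp

/-- The total flux through the boundary of the whole space vanishes. -/
theorem DivField.integral_flux_density_univ (D : DivField univ m f s) (hφ : Continuous φ) {M : ℝ}
    (hM : ∀ x, |φ x| ≤ M) (hg : HasDerivAlong univ m f s φ g) :
    ∫ x, -(g x + φ x * s x) ∂m = 0 := by
  obtain ⟨χ, hχ, hχ1, ⟨C, hC⟩, hχe⟩ := exists_cutoff n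
  have hM0 : 0 ≤ M := (abs_nonneg _).trans (hM 0)
  have hφs := D.integrable_mul_s hφ.continuousOn fun x _ => hM x
  have hlim : ∀ w : Euc n → ℝ, Integrable w m →
      Tendsto (fun j => ∫ x, χ j x * w x ∂m) atTop (𝓝 (∫ x, w x ∂m)) := fun w hw => by
    refine tendsto_integral_of_dominated_convergence (fun x => |w x|) (fun j => ?_) hw.abs
      (fun j => ae_of_all _ fun x => ?_) (ae_of_all _ fun x => ?_)
    · exact (hχ j).1.continuous.aestronglyMeasurable.mul hw.aestronglyMeasurable
    · rw [norm_mul]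
      exact mul_le_of_le_one_left (norm_nonneg _) (hχ1 j x)
    · refine tendsto_const_nhds.congr' ?_
      filter_upwards [hχe x] with j hj
      rw [hj.1, one_mul]
  have T3 : Tendsto (fun j => ∫ x, φ x * inner ℝ (gradient (χ j) x) (f x) ∂m) atTop
      (𝓝 (∫ _x, (0 : ℝ) ∂m)) := by
    refine tendsto_integral_of_dominated_convergence (fun x => M * C) (fun j => ?_)
      (integrable_const _) (fun j => ae_of_all _ fun x => ?_) (ae_of_all _ fun x => ?_)
    · exact hφ.aestronglyMeasurable.mul
        (D.aestronglyMeasurable_inner (continuous_gradient (hχ j).isC1c.1))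
    · rw [norm_mul]
      exact mul_le_mul (hM x) ((D.abs_inner_le _ x).trans (hC j x)) (norm_nonneg _) hM0
    · refine tendsto_const_nhds.congr' ?_
      filter_upwards [hχe x] with j hj
      rw [hj.2, inner_zero_left, mul_zero]
  rw [integral_zero] at T3
  have hR := (hlim _ hφs).neg.sub T3
  have := tendsto_nhds_unique (hlim g hg.1) (hR.congr fun j => by
    rw [hg.2 _ (hχ j).isC1c]
    simp only [mul_assoc])
  rw [integral_neg, integral_add hg.1 hφs, this]
  ring

/-- By connectedness U is empty or the whole space. In the latter case Ω is the whole space too, and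
the total flux vanishes. -/
theorem Represents.normalTrace_of_frontier_eq_empty (R : Represents Ω F m f s) (hUΩ : U ⊆ Ω)
    (h : frontier U = ∅) (hφ : IsW1inf Ω φ) : normalTrace Ω F U φ = 0 := by
  obtain ⟨ρ, hρ⟩ := exists_isStdMollifier n
  obtain ⟨g, -, hg⟩ := R.exists_hasDerivAlong hφ.1 (isApprox_mollify_of_isW1inf R.isOpen hρ hφ)
  rcases isClopen_iff.1 (isClopen_iff_frontier_eq_empty.2 h) with rfl | rfl
  · rw [R.normalTrace_eq hφ hg MeasurableSet.empty, setIntegral_empty]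
  · obtain rfl : Ω = univ := univ_subset_iff.1 hUΩ
    obtain ⟨M, hM⟩ := hφ.exists_bound R.isOpen
    rw [R.normalTrace_eq hφ hg MeasurableSet.univ, setIntegral_univ]
    exact R.integral_flux_density_univ (continuousOn_univ.1 hφ.1) (fun x => hM x (mem_univ x)) hg

theorem Represents.pairing_zero (R : Represents Ω F m f s) : pairing Ω F (fun _ => 0) = 0 := by
  have h : HasDerivAlong Ω m f s (fun _ => 0) 0 := ⟨integrable_zero _ _ _, fun ψ _ => by simp⟩
  rw [R.pairing_eq continuousOn_const (fun ρ hρ => isApprox_mollify_of_lipschitzWith R.isOpen hρ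
    (LipschitzWith.const (0 : ℝ))) h, withDensityᵥ_zero]

theorem Represents.isTraceMeasure_of_frontier_eq_empty (R : Represents Ω F m f s) (hUΩ : U ⊆ Ω)
    (h : frontier U = ∅) : IsTraceMeasure Ω F U 0 := by
  refine ⟨?_, fun φ hφ => ?_⟩
  · unfold ConcentratedOn
    simp
  · rw [R.normalTrace_of_frontier_eq_empty hUΩ h hφ, setInteg_zero]

end EmptyBoundary

/-! ### The case of a nonempty boundary. -/

section NonemptyBoundary

theorem Represents.normalTrace_superlevel (R : Represents Ω F m f s) (hu : Continuous u)
    (hφ : IsW1inf Ω φ) (hg : HasDerivAlong Ω m f s φ g) (t : ℝ) :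
    normalTrace Ω F {x | t < u x} φ = flux m s u φ g t :=
  R.normalTrace_eq hφ hg (measurableSet_super hu t)

/-- The integral against a trace measure given by a density on a level set. -/
theorem setInteg_levelMeasure {l : Measure (Euc n)} [IsFiniteMeasure l] {E : Set (Euc n)}
    (hl : ∀ᵐ x ∂l, x ∈ frontier E) (hgm : Measurable gu) (hφ : AEStronglyMeasurable φ l) {M : ℝ}
    (hM : ∀ᵐ x ∂l, |φ x| ≤ M) :
    setInteg (l.withDensityᵥ (signFn gu)) (frontier E) φ = ∫ x, φ x * signFn gu x ∂l := by
  have hi : Integrable (signFn gu) l :=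
    Integrable.of_bound (measurable_signFn hgm).aestronglyMeasurable 1
      (ae_of_all _ (abs_signFn_le gu))
  rw [setInteg_eq_integ isClosed_frontier.measurableSet (concentratedOn_withDensityV hi hl),
    integ_withDensityV hi hφ hM]

theorem Represents.isTraceMeasure_superlevel (R : Represents Ω F m f s) (hu : Continuous u)
    (hgm : Measurable gu) {t : ℝ} {l : Measure (Euc n)} [IsFiniteMeasure l]
    (hlu : ∀ᵐ x ∂l, u x = t) (hlΩ : ∀ᵐ x ∂l, x ∈ Ω)
    (hfr : {x | u x = t} ⊆ frontier {x | t < u x})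
    (hl : ∀ φ g : Euc n → ℝ, ContinuousOn φ Ω → (∃ M, ∀ x ∈ Ω, |φ x| ≤ M) →
      HasDerivAlong Ω m f s φ g → flux m s u φ g t = ∫ x, φ x * signFn gu x ∂l) :
    IsTraceMeasure Ω F {x | t < u x} (l.withDensityᵥ (signFn gu)) := by
  have hi : Integrable (signFn gu) l :=
    Integrable.of_bound (measurable_signFn hgm).aestronglyMeasurable 1
      (ae_of_all _ (abs_signFn_le gu))
  have hlf : ∀ᵐ x ∂l, x ∈ frontier {x | t < u x} := hlu.mono fun x hx => hfr hx
  refine ⟨concentratedOn_withDensityV hi (hlf.and hlΩ), fun φ hφ => ?_⟩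
  obtain ⟨ρ, hρ⟩ := exists_isStdMollifier n
  obtain ⟨g, -, hg⟩ := R.exists_hasDerivAlong hφ.1 (isApprox_mollify_of_isW1inf R.isOpen hρ hφ)
  obtain ⟨M, hM⟩ := hφ.exists_bound R.isOpen
  have hφl : AEStronglyMeasurable φ l := by
    rw [← Measure.restrict_eq_self_of_ae_mem hlΩ]
    exact hφ.1.aestronglyMeasurable R.isOpen.measurableSet
  rw [R.normalTrace_superlevel hu hφ hg, hl φ g hφ.1 ⟨M, hM⟩ hg,
    setInteg_levelMeasure hlf hgm hφl (hlΩ.mono fun x hx => hM x hx)]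

/-- The integral of `∇u · F` over a collar of the boundary of `{u > 0}`. -/
theorem Represents.setInteg_collar (R : Represents Ω F m f s) (hu : LipschitzWith 1 u)
    (hU : {x | 0 < u x} ⊆ Ω) (hgu : HasDerivAlong Ω m f s u gu) {gd : Euc n → ℝ}
    (hgd : Integrable gd m) (hgdu : ∀ᵐ x ∂m, x ∈ {x | 0 < u x} → gd x = gu x)
    (hφ : ContinuousOn φ Ω) {M : ℝ} (hM : ∀ x ∈ Ω, |φ x| ≤ M) (hg : HasDerivAlong Ω m f s φ g)
    {ε : ℝ} (hε : 0 < ε) :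
    setInteg (m.withDensityᵥ gd) ({x | 0 < u x} \ closure {x | ε < u x}) φ =
      ∫ t in Ioo 0 (0 + ε), flux m s u φ g t := by
  have huc := hu.continuous
  have hS : MeasurableSet ({x | 0 < u x} \ closure {x | ε < u x}) :=
    (measurableSet_super huc 0).diff isClosed_closure.measurableSet
  have hT : MeasurableSet (u ⁻¹' Ioo 0 ε) := huc.measurable measurableSet_Ioo
  -- The collar and {0 < u < ε} can differ only inside {u = ε}, part of which may lie outside the
  -- closure of {u > ε}. The density gu vanishes almost everywhere there.
  have hnull := R.ae_eq_zero_of_null hu hU hgu (measurableSet_singleton ε) (by simp)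
    (singleton_subset_iff.2 hε)
  rw [zero_add, setInteg_withDensityV hgd hS (R.aestronglyMeasurable hφ)
    (R.ae_mem.mono fun x hx => hM x hx),
    ← R.setIntegral_preimage hu hU hgu hφ hM hg measurableSet_Ioo subset_rfl,
    ← integral_indicator hS, ← integral_indicator hT]
  refine integral_congr_ae ?_
  filter_upwards [hgdu, hnull] with x hx hx'
  have hcl : closure {x | ε < u x} ⊆ {x | ε ≤ u x} :=
    closure_minimal (fun y (hy : ε < u y) => hy.le) (isClosed_le continuous_const huc)
  by_cases hxT : x ∈ u ⁻¹' Ioo 0 ε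
  · have hxS : x ∈ {x | 0 < u x} \ closure {x | ε < u x} :=
      ⟨hxT.1, fun h => not_lt.2 (show ε ≤ u x from hcl h) hxT.2⟩
    rw [indicator_of_mem hxT, indicator_of_mem hxS, hx hxS.1]
  · rw [indicator_of_notMem hxT]
    by_cases hxS : x ∈ {x | 0 < u x} \ closure {x | ε < u x}
    · have h1 : u x = ε := by
        refine le_antisymm ?_ ?_
        · by_contra h
          have : x ∈ {x | ε < u x} := not_le.1 h
          exact hxS.2 (subset_closure this)
        · by_contra h
          exact hxT ⟨hxS.1, not_le.1 h⟩
      rw [indicator_of_mem hxS, hx hxS.1, hx' h1, mul_zero]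
    · rw [indicator_of_notMem hxS]

end NonemptyBoundary

end DivMeas

end

/-! ### Assembly of the theorem. -/

theorem theorem9p2 (n : ℕ) (hn : 2 ≤ n) (Ω : Set (Euc n)) (hΩ : IsOpen Ω)
    (F : VectorMeasure (Euc n) (Euc n)) (hF : IsDMext Ω F)
    (U : Set (Euc n)) (hU : IsOpen U) (hUΩ : U ⊆ Ω) :
    -- the objects in the statement are well defined
    ((∃! σ, IsDivergence Ω F σ) ∧
      (∀ φ : Euc n → ℝ, IsW1inf Ω φ → ∃! μ, IsPairing Ω F φ μ) ∧
      (∃! μ, IsPairing Ω F (bdryDist U) μ)) ∧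
    ∃ N : Set ℝ, N ⊆ Ioi 0 ∧ volume N = 0 ∧
      -- (i)
      (∀ ε : ℝ, 0 < ε → ε ∉ N → ∃! μ, IsTraceMeasure Ω F (innerApprox U ε) μ) ∧
      -- (ii)
      (∀ φ : Euc n → ℝ, IsW1inf Ω φ → ∀ ε : ℕ → ℝ, (∀ k, 0 < ε k ∧ ε k ∉ N) →
        Tendsto ε atTop (𝓝 0) →
        Tendsto (fun k => setInteg (traceMeasure Ω F (innerApprox U (ε k)))
            (frontier (innerApprox U (ε k))) φ)
          atTop (𝓝 (normalTrace Ω F U φ))) ∧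
      -- (iii)
      (∀ φ : Euc n → ℝ, IsW1inf Ω φ →
        Tendsto (fun ε : ℝ => 1 / ε *
            setInteg (pairing Ω F (bdryDist U)) (U \ closure (innerApprox U ε)) φ)
          (𝓝[>] 0) (𝓝 (normalTrace Ω F U φ))) ∧
      -- (iv)
      (∀ φ : Euc n → ℝ, Measurable φ → (∃ C : ℝ, ∀ x ∈ Ω, |φ x| ≤ C) →
        IntegrableOn (fun t : ℝ => setInteg (traceMeasure Ω F (innerApprox U t))
            (frontier (innerApprox U t)) φ) (Ioi 0) volume ∧
        ∫ t in Ioi (0 : ℝ), setInteg (traceMeasure Ω F (innerApprox U t))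
            (frontier (innerApprox U t)) φ =
          setInteg (pairing Ω F (bdryDist U)) U φ) := by
  obtain ⟨m, hm, f, s, R⟩ := exists_represents hΩ hF
  obtain ⟨ρ, hρ⟩ := exists_isStdMollifier n
  have hlip : ∀ {v : Euc n → ℝ}, LipschitzWith 1 v → ∀ ρ, IsStdMollifier ρ →
      IsApprox Ω v fun δ => mollify Ω ρ δ v := fun hv ρ hρ =>
    isApprox_mollify_of_lipschitzWith hΩ hρ hv
  have hdl := lipschitzWith_bdryDist U
  refine ⟨⟨existsUnique_isDivergence hΩ hF, fun φ hφ => R.existsUnique_isPairing hφ.1 fun ρ hρ =>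
    isApprox_mollify_of_isW1inf hΩ hρ hφ, R.existsUnique_isPairing hdl.continuous.continuousOn
      (hlip hdl)⟩, ?_⟩
  rcases (frontier U).eq_empty_or_nonempty with hfr | hfr
  · have htm := R.isTraceMeasure_of_frontier_eq_empty hUΩ hfr
    have hpair : pairing Ω F (bdryDist U) = 0 := by
      rw [bdryDist_of_frontier_eq_empty hfr, R.pairing_zero]
    simp only [innerApprox_of_frontier_eq_empty hfr, htm.traceMeasure_eq hΩ, hpair, setInteg_zero]
    refine ⟨∅, empty_subset _, measure_empty, fun _ _ _ => htm.existsUnique hΩ,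
      fun φ hφ _ _ _ => ?_, fun φ hφ => ?_, fun φ _ _ => ⟨integrableOn_zero, by simp⟩⟩
    · rw [R.normalTrace_of_frontier_eq_empty hUΩ hfr hφ]
      exact tendsto_const_nhds
    · rw [R.normalTrace_of_frontier_eq_empty hUΩ hfr hφ]
      simp
  -- The distance to ∂U is also positive outside the closure of U, so its superlevel sets are not
  -- the U^t. The distance to the complement has the right superlevel sets and coincides with d on
  -- U.
  · set u := complDist U with hudef
    have hu : LipschitzWith 1 u := lipschitzWith_complDist U
    have huc := hu.continuous
    have hu0 : {x | 0 < u x} = U := setOf_complDist_pos hU hfr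
    have huΩ : {x | 0 < u x} ⊆ Ω := hu0.trans_subset hUΩ
    obtain ⟨gu, hgus, hgu⟩ := R.exists_hasDerivAlong huc.continuousOn (hlip hu ρ hρ)
    obtain ⟨gd, -, hgd⟩ := R.exists_hasDerivAlong hdl.continuous.continuousOn (hlip hdl ρ hρ)
    have hgm := hgus.measurable
    -- By locality on the open set U the pairing of d may be replaced by that of u.
    have hgdu : ∀ᵐ x ∂m, x ∈ {x | 0 < u x} → gd x = gu x := by
      rw [hu0]
      exact HasDerivAlong.ae_eq hU hUΩ hgd hgu fun x hx => bdryDist_eq_complDist hU hfr hx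
    have hpair : pairing Ω F (bdryDist U) = m.withDensityᵥ gd :=
      R.pairing_eq hdl.continuous.continuousOn (hlip hdl) hgd
    have hin : ∀ t, 0 < t → innerApprox U t = {x | t < u x} := fun t ht =>
      innerApprox_eq hU hfr ht.le
    obtain ⟨L, hL, hLp, hLt⟩ := R.exists_levelTrace hu huΩ hgu hgm
    have hgood := hLt.and ((countable_setOf_not_level_subset_frontier (u := u)).ae_notMem volume)
    set P : ℝ → Prop := fun t => ((∀ᵐ x ∂L t, u x = t) ∧ (∀ᵐ x ∂L t, x ∈ Ω) ∧
        (0 < t → ∀ φ g : Euc n → ℝ, ContinuousOn φ Ω → (∃ M, ∀ x ∈ Ω, |φ x| ≤ M) →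
          HasDerivAlong Ω m f s φ g →
          flux m s u φ g t = ∫ x, φ x * signFn gu x ∂L t)) ∧
        t ∉ {t | ¬ {x | u x = t} ⊆ frontier {x | t < u x}} with hP
    have hgood' : ∀ᵐ t, P t := hgood
    have htrace : ∀ t, 0 < t → P t →
        IsTraceMeasure Ω F (innerApprox U t) ((L t).withDensityᵥ (signFn gu)) := by
      rintro t ht ⟨⟨h1, h2, h3⟩, h4⟩
      rw [hin t ht]
      have := hL t
      exact R.isTraceMeasure_superlevel huc hgm h1 h2 (not_not.1 h4) (h3 ht)
    have hNP : ∀ t, 0 < t → t ∉ {t | 0 < t ∧ ¬ P t} → P t := fun t ht h => by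
      by_contra hn
      exact h ⟨ht, hn⟩
    refine ⟨{t | 0 < t ∧ ¬ P t}, fun t ht => ht.1,
      measure_mono_null (fun t ht => ht.2) hgood', fun t ht htN =>
        (htrace t ht (hNP t ht htN)).existsUnique hΩ, fun φ hφ ε hε hε0 => ?_, fun φ hφ => ?_,
      fun φ hφ hC => ?_⟩
    · obtain ⟨g, -, hg⟩ := R.exists_hasDerivAlong hφ.1 (isApprox_mollify_of_isW1inf hΩ hρ hφ)
      obtain ⟨M, hM⟩ := hφ.exists_bound hΩ
      -- The trace on ∂U is the flux at level 0, so the claim is right continuity of the flux at 0.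
      have hlim := (tendsto_superInt huc (R.integrable_flux_density hφ.1 hM hg) 0).comp
        (tendsto_nhdsWithin_iff.2 ⟨hε0, Eventually.of_forall fun k => (hε k).1⟩)
      have hnt := R.normalTrace_superlevel huc hφ hg 0
      rw [hu0] at hnt
      rw [hnt]
      refine hlim.congr fun k => ?_
      have ht := htrace _ (hε k).1 (hNP _ (hε k).1 (hε k).2)
      rw [ht.traceMeasure_eq hΩ, ← ht.2 φ hφ, hin _ (hε k).1, R.normalTrace_superlevel huc hφ hg]
      rfl
    · obtain ⟨g, -, hg⟩ := R.exists_hasDerivAlong hφ.1 (isApprox_mollify_of_isW1inf hΩ hρ hφ)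
      obtain ⟨M, hM⟩ := hφ.exists_bound hΩ
      have hlim := tendsto_average_superInt huc (R.integrable_flux_density hφ.1 hM hg) 0
      have hnt := R.normalTrace_superlevel huc hφ hg 0
      rw [hu0] at hnt
      rw [hnt]
      refine hlim.congr' ?_
      filter_upwards [self_mem_nhdsWithin] with ε hε
      have hcol := R.setInteg_collar hu huΩ hgu hgd.1 hgdu hφ.1 hM hg hε
      rw [hu0] at hcol
      rw [hpair, hin ε hε, hcol]
      rfl
    · obtain ⟨C, hC⟩ := hC
      -- The function φ is bounded on Ω only; cutting it off outside Ω changes nothing, as all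
      -- measures involved live on Ω.
      have hp : Measurable (Ω.indicator φ) := hφ.indicator hΩ.measurableSet
      have hpC : ∀ x, |Ω.indicator φ x| ≤ max C 0 := fun x => by
        by_cases hx : x ∈ Ω
        · rw [indicator_of_mem hx]
          exact (hC x hx).trans (le_max_left _ _)
        · rw [indicator_of_notMem hx, abs_zero]
          exact le_max_right _ _
      obtain ⟨hI, hE⟩ := hLp _ hp _ hpC
      have hae : ∀ᵐ t ∂volume.restrict (Ioi (0 : ℝ)),
          ∫ x, Ω.indicator φ x * signFn gu x ∂L t =
            setInteg (traceMeasure Ω F (innerApprox U t)) (frontier (innerApprox U t)) φ := by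
        filter_upwards [ae_restrict_of_ae hgood', ae_restrict_mem measurableSet_Ioi] with t hPt ht
        have hfin := hL t
        have htr := htrace t ht hPt
        rw [htr.traceMeasure_eq hΩ, hin t ht, setInteg_levelMeasure
          (hPt.1.1.mono fun x hx => not_not.1 hPt.2 hx) hgm hφ.aestronglyMeasurable
          (hPt.1.2.1.mono fun x hx => hC x hx)]
        refine integral_congr_ae ?_
        filter_upwards [hPt.1.2.1] with x hx
        rw [indicator_of_mem hx]
      refine ⟨hI.integrableOn.congr_fun_ae hae, ?_⟩
      rw [← integral_congr_ae hae, hE, hpair, setInteg_withDensityV hgd.1 hU.measurableSet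
        hφ.aestronglyMeasurable (R.ae_mem.mono fun x hx => hC x hx), hu0]
      refine setIntegral_congr_ae hU.measurableSet ?_
      rw [hu0] at hgdu
      filter_upwards [hgdu] with x hx hxU
      rw [hx hxU, indicator_of_mem (hUΩ hxU)]
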